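/- **Networks.** All networks use the ReLU activation $\sigma(x)=\max(x,0)$. A neural network $\mathbb R^{d_1}\to\mathbb R^{d_3}$ is a composition of finitely many affine maps with $\sigma$ applied componentwise between consecutive ones, with at least one hidden layer; its size is the number of its nonzero weights and biases. An infinite-width network of depth $I\ge 1$ is a composition $f_{I+1}\circ\dots\circ f_1$ through $\mathbb R^{d_1}\to\ell^2(\mathbb N)\to\dots\to\ell^2(\mathbb N)\to\mathbb R^{d_3}$, where $f_1(x)=w^1_0+\sum_{m=1}^{d_1}x_m w^1_m$ and $f_{i+1}(y)=w^{i+1}_0+\sum_{m\ge1}\sigma(y_{m-1})\,w^{i+1}_m$ for $1\le i\le I$. Its parameters are $w^i=(w^i_m)_m$ with $\sum_m\|w^i_m\|<\infty$, each $w^i_m$ lying in the range space of $f_i$; the parameter space is the product of the corresponding $\ell^1$-spaces. The size is the number in $\{0,1,\dots,\infty\}$ of nonzero components of the parameters. A random network is an infinite-width network of fixed depth whose parameters are a Borel random variable on $\Omega$. For a function $h$ on $\mathbb R^{D}$ put $\mathrm{Growth}(h)=\sup_x\|h(x)\|/(1+\|x\|)$. **Setting.** Let $T>0$, $N\ge1$,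 $t_n=nT/N$, and for $N_0\ge1$ let $t^n_k=t_n+kT/(NN_0)$, $\Delta W_{t^n_k}=W_{t^n_{k+1}}-W_{t^n_k}$. For a dimension $D\ge1$ let $(\Omega,\mathcal F,(\mathcal F_t),\mathbb P)$ be a filtered probability space, $W$ a $D$-dimensional $(\mathcal F_t)$-Brownian motion on $[0,T]$, $X$ an $\mathbb R^D$-valued process with $X_0=x_0$ a.s., and $g(t,x)$ a real payoff function. The Snell envelope is $Y^*_n=\operatorname{ess\,sup}_{\tau}\mathbb E[g(\tau,X_\tau)\mid\mathcal F_{t_n}]$ over stopping times $\tau$ with values in $\{t_n,\dots,t_N\}$, and a value function $V_n$ is a Borel function with $V_n(X_{t_n})=Y^*_n$ a.s. Put $$\tilde\rho^{N_0}_{n+1}(A)=\mathbb E\Big[\sum_{k=0}^{N_0-1}\|\Delta W_{t^n_k}\|^2\,1_A(X_{t_{n+1}})\Big],\qquad A\in\mathcal B(\mathbb R^D).$$ **Dynamic assumption** (exponent $p$, constants $c,q>0$). $(X_{t_n})_{n=0}^N$ is adapted to and Markov with respect to $(\mathcal F_{t_n})_{n=0}^N$, $\|x_0\|\le cD^q$,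 and for $n=0,\dots,N-1$ there is a $\mathcal B(\mathbb R^D)\otimes\mathcal F_{t_{n+1}}$-measurable $f_n:\mathbb R^D\times\Omega\to\mathbb R^D$ such that: $X_{t_{n+1}}=f_n(X_{t_n},\cdot)$ a.s.; for each $x$, $f_n(x,\cdot)$ is independent of $\mathcal F_{t_n}$; $\mathbb E[X_{t_{n+1}}\mid\mathcal F_{t_n}]=\mathbb E[X_{t_{n+1}}\mid X_{t_n}]=\mathbb E[f_n(x,\cdot)]|_{x=X_{t_n}}$ a.s.; $(\mathbb E|\mathrm{Growth}(f_n(*,\cdot))|^p)^{1/p}\le cD^q$; and there is a random network $\hat f_n$ of depth at most $cD^q$ with $\mathbb E[\mathrm{size}(\hat f_n)]\le cD^q$ such that, for a.e. $\omega$, $f_n(x,\omega)=\hat f_n(x,\omega)$ for all $x$. **Payoff assumption** (constants $c,q,r>0$). For every $\varepsilon>0$ and $n=0,\dots,N$ there is a neural network $\hat g_n:\mathbb R^D\to\mathbb R$ with $|\hat g_n(x)-g(t_n,x)|\le\varepsilon cD^q(1+\|x\|)$ for all $x$, $\mathrm{size}(\hat g_n)\le cD^q\varepsilon^{-r}$,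 $\mathrm{Lip}(\hat g_n)\le cD^q$, and $|g(t_n,0)|\le cD^q$. **Theorem (neural $\hat V$ approximation with expressivity).** Let $T>0$, $N\ge 1$, $p>2$, $c,q,r>0$ and $n\in\{0,\dots,N-1\}$. There exist constants $c_{n+1},q_{n+1},\tau_{n+1}\in[1,\infty)$, depending only on these data and in particular not on $D$, such that for every $D\ge1$ and every setting as above in dimension $D$ which satisfies the dynamic assumption with exponent $p$ and constants $c,q$ and the payoff assumption with constants $c,q,r$, the following holds. A value function $V_{n+1}$ exists, and for every value function $V_{n+1}$, every $\varepsilon>0$ and every integer $N_0\ge1$ there is a neural network $\hat V_{n+1}:\mathbb R^D\to\mathbb R$ with $$\Big(\int_{\mathbb R^D}\big(V_{n+1}(z)-\hat V_{n+1}(z)\big)^2\,d\tilde\rho^{N_0}_{n+1}(z)\Big)^{1/2}\le\varepsilon,$$ $$\mathrm{size}(\hat V_{n+1})\le c_{n+1}D^{q_{n+1}}\varepsilon^{-\tau_{n+1}},\qquad \mathrm{Growth}(\hat V_{n+1})\le c_{n+1}D^{q_{n+1}}\varepsilon^{-\tau_{n+1}}.$$ -/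

import Mathlib

open MeasureTheory ProbabilityTheory
open scoped NNReal ENNReal

noncomputable section

namespace DeepMartingale

/-- `ℝ^d` with the Euclidean norm. -/
abbrev E (d : ℕ) : Type := EuclideanSpace ℝ (Fin d)

/-- The ReLU activation. -/
def relu (x : ℝ) : ℝ := max x 0

/-! ### Growth rate -/

/-- `Growth(h) = sup_x ‖h x‖ / (1 + ‖x‖)`, with values in `[0, ∞]`. -/
def growth {F G : Type*} [NormedAddCommGroup F] [NormedAddCommGroup G] (h : F → G) : ℝ≥0∞ :=
  ⨆ x : F, ‖h x‖ₑ / (1 + ‖x‖ₑ)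

/-! ### Deterministic feed-forward ReLU networks -/

/-- Parameters of a feed-forward network `ℝ^d₁ → ℝ^d₃`: a finite list of hidden layers (an affine
map followed by the componentwise activation), and a final affine map. -/
inductive Net : ℕ → ℕ → Type
  | output {d₁ d₃ : ℕ} (A : Matrix (Fin d₃) (Fin d₁) ℝ) (b : Fin d₃ → ℝ) : Net d₁ d₃
  | hidden {d₁ m d₃ : ℕ} (A : Matrix (Fin m) (Fin d₁) ℝ) (b : Fin m → ℝ) (rest : Net m d₃) :
      Net d₁ d₃

/-- Number of hidden layers. -/
def Net.depth : {d₁ d₃ : ℕ} → Net d₁ d₃ → ℕ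
  | _, _, .output _ _ => 0
  | _, _, .hidden _ _ rest => rest.depth + 1

/-- The function realized by the network. -/
def Net.eval : {d₁ d₃ : ℕ} → Net d₁ d₃ → (Fin d₁ → ℝ) → (Fin d₃ → ℝ)
  | _, _, .output A b => fun x => A.mulVec x + b
  | _, _, .hidden A b rest => fun x => rest.eval (fun i => relu ((A.mulVec x + b) i))

/-- Number of nonzero entries of an affine layer. -/
def affineSize {m d : ℕ} (A : Matrix (Fin m) (Fin d) ℝ) (b : Fin m → ℝ) : ℕ :=
  Set.ncard {ij : Fin m × Fin d | A ij.1 ij.2 ≠ 0} + Set.ncard {i : Fin m | b i ≠ 0}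

/-- The size of a network: the number of its nonzero weights and biases. -/
def Net.size : {d₁ d₃ : ℕ} → Net d₁ d₃ → ℕ
  | _, _, .output A b => affineSize A b
  | _, _, .hidden A b rest => affineSize A b + rest.size

/-- The real-valued function on `ℝ^d` realized by a network with one output. -/
def Net.real {d : ℕ} (φ : Net d 1) (x : E d) : ℝ := φ.eval x.ofLp 0

/-! ### Infinite-width networks and random networks

An `X`-valued vector measure of finite total variation on a countable discrete set `Θ` is
`∑ m, w m • δ_m` with `‖w‖_TV = ∑ m, ‖w m‖ < ∞`; the Banach space of these is `ℓ¹(Θ; X)`.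
The weight `w 0` is the bias of the layer. -/

/-- `ℓ²(ℕ)`. -/
abbrev ell2 : Type := lp (fun _ : ℕ => ℝ) 2

/-- Parameters of the first layer `ℝ^d → ℓ²(ℕ)`. -/
abbrev ParamIn (d : ℕ) : Type := lp (fun _ : Fin (d + 1) => ell2) 1

/-- Parameters of a middle layer `ℓ²(ℕ) → ℓ²(ℕ)`. -/
abbrev ParamMid : Type := lp (fun _ : ℕ => ell2) 1

/-- Parameters of the last layer `ℓ²(ℕ) → ℝ^d`. -/
abbrev ParamOut (d : ℕ) : Type := lp (fun _ : ℕ => E d) 1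

/-- Parameters of an infinite-width network with `k + 1` hidden layers. The product topology is
that of the product metric. -/
abbrev NetParam (d₁ k d₃ : ℕ) : Type := ParamIn d₁ × (Fin k → ParamMid) × ParamOut d₃

/-- Features of the input: the constant `1`, then the coordinates. -/
def featIn {d : ℕ} (x : E d) : Fin (d + 1) → ℝ := Fin.cons 1 (fun i => x i)

/-- Features of a hidden layer: the constant `1`, then the activated coordinates. -/
def feat (y : ell2) : ℕ → ℝ
  | 0 => 1
  | m + 1 => relu (y m)

/-- First layer. -/
def layerIn {d : ℕ} (w : ParamIn d) (x : E d) : ell2 := ∑ m, featIn x m • w m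

/-- Middle layer. -/
def layerMid (w : ParamMid) (y : ell2) : ell2 := ∑' m, feat y m • w m

/-- Last layer. -/
def layerOut {d : ℕ} (w : ParamOut d) (y : ell2) : E d := ∑' m, feat y m • w m

/-- The function realized by an infinite-width network with `k + 1` hidden layers. -/
def NetParam.eval {d₁ k d₃ : ℕ} (θ : NetParam d₁ k d₃) (x : E d₁) : E d₃ :=
  layerOut θ.2.2 (Fin.foldl k (fun y i => layerMid (θ.2.1 i) y) (layerIn θ.1 x))

/-- The size of an infinite-width network: the number, possibly infinite, of its nonzero
parameters. -/
def NetParam.size {d₁ k d₃ : ℕ} (θ : NetParam d₁ k d₃) : ℕ∞ :=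
  Set.encard {mn : Fin (d₁ + 1) × ℕ | θ.1 mn.1 mn.2 ≠ 0}
    + ∑ i, Set.encard {mn : ℕ × ℕ | θ.2.1 i mn.1 mn.2 ≠ 0}
    + Set.encard {mn : ℕ × Fin d₃ | θ.2.2 mn.1 mn.2 ≠ 0}

/-! ### Time grid, Brownian motion, and the weighted measure -/

/-- The monitoring date `t_n = n T / N`. -/
def date (T : ℝ≥0) (N n : ℕ) : ℝ≥0 := n * T / N

/-- The observation date `t^n_k = t_n + k T / (N N₀)`. -/
def subdate (T : ℝ≥0) (N N₀ n k : ℕ) : ℝ≥0 := date T N n + k * (T / (N * N₀))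

/-- `W` is a `D`-dimensional Brownian motion on `[0, T]` with respect to the filtration `ℱ`. -/
structure IsBrownianMotion {Ω : Type*} {mΩ : MeasurableSpace Ω} (P : Measure Ω)
    (ℱ : Filtration ℝ≥0 mΩ) (T : ℝ≥0) {D : ℕ} (W : ℝ≥0 → Ω → E D) : Prop where
  zero : ∀ᵐ ω ∂P, W 0 ω = 0
  adapted : ∀ t ≤ T, Measurable[ℱ t] (W t)
  continuous : ∀ᵐ ω ∂P, ContinuousOn (fun t => W t ω) (Set.Icc 0 T)
  law : ∀ s t, s ≤ t → t ≤ T →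
    HasLaw (fun ω => W t ω - W s ω) (multivariateGaussian 0 (((t : ℝ) - s) • 1)) P
  indep : ∀ s t, s ≤ t → t ≤ T →
    Indep (MeasurableSpace.comap (fun ω => W t ω - W s ω) inferInstance) (ℱ s) P

/-- The measure `A ↦ 𝔼[∑_{k < N₀} ‖W_{t^n_{k+1}} - W_{t^n_k}‖² 1_A(X_{t_{n+1}})]` on `ℝ^D`. -/
def rhoTilde {Ω : Type*} {mΩ : MeasurableSpace Ω} (P : Measure Ω) (T : ℝ≥0) (N N₀ n : ℕ) {D : ℕ}
    (W X : ℝ≥0 → Ω → E D) : Measure (E D) :=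
  (P.withDensity (fun ω => ∑ k ∈ Finset.range N₀,
    ‖W (subdate T N N₀ n (k + 1)) ω - W (subdate T N N₀ n k) ω‖ₑ ^ 2)).map (X (date T N (n + 1)))

/-! ### Optimal stopping -/

/-- The filtration `(ℱ_{t_n})_n`. -/
def disFiltration {Ω : Type*} {mΩ : MeasurableSpace Ω} (ℱ : Filtration ℝ≥0 mΩ) (T : ℝ≥0) (N : ℕ) :
    Filtration ℕ mΩ where
  seq n := ℱ (date T N n)
  mono' m n h := ℱ.mono (by unfold date; gcongr)
  le' n := ℱ.le _

/-- Stopping rules with values in `{n, …, N}` (the dates `t_n, …, t_N`). -/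
def IsStoppingRule {Ω : Type*} {mΩ : MeasurableSpace Ω} (ℱ : Filtration ℝ≥0 mΩ) (T : ℝ≥0)
    (N n : ℕ) (τ : Ω → ℕ) : Prop :=
  IsStoppingTime (disFiltration ℱ T N) (fun ω => (τ ω : WithTop ℕ)) ∧ ∀ ω, n ≤ τ ω ∧ τ ω ≤ N

/-- `Y` is (a version of) the essential supremum of the family `S` of random variables. -/
structure IsEssSup {Ω : Type*} {mΩ : MeasurableSpace Ω} (P : Measure Ω) (S : Set (Ω → ℝ))
    (Y : Ω → ℝ) : Prop where
  measurable : Measurable Y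
  upper : ∀ Z ∈ S, Z ≤ᵐ[P] Y
  least : ∀ Y' : Ω → ℝ, Measurable Y' → (∀ Z ∈ S, Z ≤ᵐ[P] Y') → Y ≤ᵐ[P] Y'

/-- `Y` is the Snell envelope at `t_n`: the essential supremum of `𝔼[g(τ, X_τ) | ℱ_{t_n}]` over
the stopping times `τ` with values in `{t_n, …, t_N}`. -/
def IsSnellEnvelope {Ω : Type*} {mΩ : MeasurableSpace Ω} (P : Measure Ω) (ℱ : Filtration ℝ≥0 mΩ)
    (T : ℝ≥0) (N n : ℕ) {D : ℕ} (X : ℝ≥0 → Ω → E D) (g : ℝ≥0 → E D → ℝ) (Y : Ω → ℝ) : Prop :=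
  IsEssSup P
    {Z | ∃ τ : Ω → ℕ, IsStoppingRule ℱ T N n τ ∧
      Z = P[fun ω => g (date T N (τ ω)) (X (date T N (τ ω)) ω) | ℱ (date T N n)]} Y

/-- `V` is a value function at `t_n`: a Borel function for which `V(X_{t_n})` is the Snell
envelope at `t_n`. It is unique up to null sets of the law of `X_{t_n}`. -/
def IsValueFunction {Ω : Type*} {mΩ : MeasurableSpace Ω} (P : Measure Ω) (ℱ : Filtration ℝ≥0 mΩ)
    (T : ℝ≥0) (N n : ℕ) {D : ℕ} (X : ℝ≥0 → Ω → E D) (g : ℝ≥0 → E D → ℝ) (V : E D → ℝ) : Prop :=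
  Measurable V ∧ IsSnellEnvelope P ℱ T N n X g (fun ω => V (X (date T N n) ω))

/-! ### The structural assumptions -/

/-- The `p`-dynamic process assumption with constants `c, q`, for given transition maps `f n`. -/
structure DynamicAssumptionWith {Ω : Type*} {mΩ : MeasurableSpace Ω} (P : Measure Ω)
    (ℱ : Filtration ℝ≥0 mΩ) (T : ℝ≥0) (N : ℕ) (p c q : ℝ) {D : ℕ} (x₀ : E D)
    (X : ℝ≥0 → Ω → E D) (f : ℕ → E D → Ω → E D) : Prop where
  initial : ∀ᵐ ω ∂P, X 0 ω = x₀
  adapted : ∀ n ≤ N, Measurable[ℱ (date T N n)] (X (date T N n))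
  markov : ∀ m n, m ≤ n → n ≤ N → ∀ A : Set (E D), MeasurableSet A →
    P[(X (date T N n) ⁻¹' A).indicator (fun _ => (1 : ℝ)) | ℱ (date T N m)] =ᵐ[P]
      P[(X (date T N n) ⁻¹' A).indicator (fun _ => (1 : ℝ)) |
        MeasurableSpace.comap (X (date T N m)) inferInstance]
  measurable : ∀ n < N,
    Measurable[MeasurableSpace.prod inferInstance (ℱ (date T N (n + 1)))]
      (fun z : E D × Ω => f n z.1 z.2)
  transition : ∀ n < N, ∀ᵐ ω ∂P, X (date T N (n + 1)) ω = f n (X (date T N n) ω) ω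
  indep : ∀ n < N, ∀ x, Indep (MeasurableSpace.comap (f n x) inferInstance) (ℱ (date T N n)) P
  condExp_eq : ∀ n < N, P[X (date T N (n + 1)) | ℱ (date T N n)] =ᵐ[P]
    P[X (date T N (n + 1)) | MeasurableSpace.comap (X (date T N n)) inferInstance]
  condExp_eq_integral : ∀ n < N, P[X (date T N (n + 1)) | ℱ (date T N n)] =ᵐ[P]
    fun ω => ∫ ω', f n (X (date T N n) ω) ω' ∂P
  growth_le : ∀ n < N,
    (∫⁻ ω, growth (fun x => f n x ω) ^ p ∂P) ^ (1 / p) ≤ ENNReal.ofReal (c * (D : ℝ) ^ q)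
  /-- `f n` is represented by a random network with `k + 1` hidden layers. -/
  random_net : ∀ n < N, ∃ (k : ℕ) (θ : Ω → NetParam D k D),
    Measurable[mΩ, borel (NetParam D k D)] θ ∧
    ((k + 1 : ℕ) : ℝ) ≤ c * (D : ℝ) ^ q ∧
    (∀ᵐ ω ∂P, ∀ x, f n x ω = (θ ω).eval x) ∧
    ∫⁻ ω, ((θ ω).size : ℝ≥0∞) ∂P ≤ ENNReal.ofReal (c * (D : ℝ) ^ q)
  initial_le : ‖x₀‖ ≤ c * (D : ℝ) ^ q

/-- The `p`-dynamic process assumption with constants `c, q`. -/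
def DynamicAssumption {Ω : Type*} {mΩ : MeasurableSpace Ω} (P : Measure Ω)
    (ℱ : Filtration ℝ≥0 mΩ) (T : ℝ≥0) (N : ℕ) (p c q : ℝ) {D : ℕ} (x₀ : E D)
    (X : ℝ≥0 → Ω → E D) : Prop :=
  ∃ f : ℕ → E D → Ω → E D, DynamicAssumptionWith P ℱ T N p c q x₀ X f

/-- The assumption on the payoff `g` with constants `c, q, r`. -/
def PayoffAssumption (T : ℝ≥0) (N : ℕ) (c q r : ℝ) {D : ℕ} (g : ℝ≥0 → E D → ℝ) : Prop :=
  ∀ ε : ℝ, 0 < ε → ∀ n ≤ N, ∃ φ : Net D 1, 1 ≤ φ.depth ∧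
    (∀ x, |φ.real x - g (date T N n) x| ≤ ε * c * (D : ℝ) ^ q * (1 + ‖x‖)) ∧
    (φ.size : ℝ) ≤ c * (D : ℝ) ^ q * ε ^ (-r) ∧
    LipschitzWith (c * (D : ℝ) ^ q).toNNReal φ.real ∧
    |g (date T N n) 0| ≤ c * (D : ℝ) ^ q

end DeepMartingale

end

noncomputable section

namespace DeepMartingale

/-! Dynamic programming gives one version of the value functions: V_N = g(t_N, ·) and V_m(x) =
max(g(t_m, x), E V_{m+1}(f_m(x, ·))). Any other version agrees with it almost everywhere for the law
of X_{t_m}, so it suffices to approximate this recursion (`isValueFunction_dpValue`,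
`IsValueFunction.eLpNorm_sub_eq`).

Let Λ be the sum of the squared Brownian increments between t_n and t_{n+1}, and ν_m the law of
X_{t_m} under the measure with density Λ; then ν_{n+1} is the measure of the theorem. For m ≥ n+1
the weight Λ is known at t_m while f_m(x, ·) is independent of the past, so ν_{m+1} is the image of
ν_m ⊗ P under f_m (`map_freezing`). If v approximates V_{m+1} in L²(ν_{m+1}), then by Jensen x ↦ E
v(f_m(x, ·)) approximates the continuation value in L²(ν_m) with no larger error.

The expectation is replaced by an average over M samples. Each new sample adds in the mean at most
the second moment of v ∘ f_m to the squared error of the sum, so fixed sample points exist which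
control the error, the growth and the total size of the sampled maps at once (`exists_sample`,
`exists_average`). The maximum with an approximate payoff needs one ReLU. This is
`Approximable.step`, iterated over the N - n - 1 dates after t_{n+1}.

Complexity is counted by straight-line programs, for which substitution adds lengths and no
synchronization of depths is needed. A sampled infinite-width network of size s is a program of
length 2s whatever its depth, and a program of length s becomes a network of size O(s²)
(`NetParam.exists_build`, `Build.exists_net`).

All bounds are powers of one number B which dominates c D^q and the second moments of the ν_m:
accuracy 1/B costs B^k, with k depending only on r and the number of remaining dates. The moments
are bounded independently of N₀ by Hölder's inequality, where p > 2 enters, and by Gaussian moments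
of the increments. Finally B = C D^Q, divided by ε when ε ≤ 1. -/

/-! ### Straight-line ReLU programs -/

/-- `Build B s L`: starting from the functions in `B`, the functions in `L` are generated by `s`
instructions, each of which adds a function `a u + b v + e σ(u)` of two available functions. -/
inductive Build {X : Type*} (B : Set (X → ℝ)) : ℕ → Set (X → ℝ) → Prop
  | refl : Build B 0 B
  | step {s : ℕ} {L : Set (X → ℝ)} {u v : X → ℝ} (a b e : ℝ) (h : Build B s L) (hu : u ∈ L)
      (hv : v ∈ L) : Build B (s + 1) (insert (fun x => a * u x + b * v x + e * relu (u x)) L)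

namespace Build

variable {X Y : Type*} {B L M : Set (X → ℝ)} {s t : ℕ}

theorem subset (h : Build B s L) : B ⊆ L := by
  induction h with
  | refl => exact subset_rfl
  | step a b e h hu hv ih => exact ih.trans (Set.subset_insert _ _)

theorem trans (h : Build B s L) (h' : Build L t M) : Build B (s + t) M := by
  induction h' with
  | refl => exact h
  | step a b e h hu hv ih => exact .step a b e ih hu hv

theorem union (h : Build B s L) (C : Set (X → ℝ)) : Build (B ∪ C) s (L ∪ C) := by
  induction h with
  | refl => exact .refl
  | step a b e h hu hv ih =>
    rw [Set.insert_union]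
    exact .step a b e ih (Or.inl hu) (Or.inl hv)

/-- A larger set of initial functions may be used. -/
theorem mono (h : Build B s L) {C : Set (X → ℝ)} (hBC : B ⊆ C) : Build C s (L ∪ C) := by
  have := h.union C
  rwa [Set.union_eq_self_of_subset_left hBC] at this

/-- Two programs can be run one after the other. -/
theorem both (h : Build B s L) (h' : Build B t M) : Build B (s + t) (M ∪ L) :=
  h.trans (h'.mono h.subset)

/-- Substitution into a program. -/
theorem comp (h : Build B s L) (φ : Y → X) :
    Build ((fun u => u ∘ φ) '' B) s ((fun u => u ∘ φ) '' L) := by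
  induction h with
  | refl => exact .refl
  | step a b e h hu hv ih =>
    rw [Set.image_insert_eq]
    exact .step a b e ih (Set.mem_image_of_mem _ hu) (Set.mem_image_of_mem _ hv)

theorem continuous [TopologicalSpace X] (h : Build B s L) (hB : ∀ u ∈ B, Continuous u) :
    ∀ u ∈ L, Continuous u := by
  induction h with
  | refl => exact hB
  | step a b e h hu hv ih =>
    intro w hw
    rcases hw with rfl | hw
    · have := ih _ hu
      have := ih _ hv
      unfold relu
      fun_prop
    · exact ih w hw

/-- The linear combinations given by a sparse matrix cost one instruction per entry. -/
theorem exists_linear {ι κ : Type*} (u : ι → X → ℝ) (hu : ∀ i, u i ∈ B) (h0 : (fun _ => 0) ∈ B)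
    (w : ι → κ → ℝ) (S : Finset (ι × κ)) [DecidableEq κ] :
    ∃ L, Build B S.card L ∧
      ∀ j, (fun x => ∑ p ∈ S with p.2 = j, w p.1 p.2 * u p.1 x) ∈ L := by
  classical
  induction S using Finset.induction_on with
  | empty => exact ⟨B, .refl, by simpa using fun _ => h0⟩
  | insert p S hp ih =>
    obtain ⟨L, hL, hmem⟩ := ih
    rw [Finset.card_insert_of_notMem hp]
    refine ⟨_, .step (w p.1 p.2) 1 0 hL (hL.subset (hu p.1)) (hmem p.2), fun j => ?_⟩
    by_cases hj : p.2 = j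
    · left
      subst hj
      funext x
      rw [Finset.filter_insert, if_pos rfl, Finset.sum_insert (by simp [hp])]
      ring
    · right
      rw [Finset.filter_insert, if_neg hj]
      exact hmem j

theorem exists_relu {κ : Type*} (v : κ → X → ℝ) (hv : ∀ j, v j ∈ B) (J : Finset κ) :
    ∃ L, Build B J.card L ∧ ∀ j ∈ J, (fun x => relu (v j x)) ∈ L := by
  classical
  induction J using Finset.induction_on with
  | empty => exact ⟨B, .refl, by simp⟩
  | insert j J hj ih =>
    obtain ⟨L, hL, hmem⟩ := ih
    rw [Finset.card_insert_of_notMem hj]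
    refine ⟨_, .step 0 0 1 hL (hL.subset (hv j)) (hL.subset (hv j)), fun i hi => ?_⟩
    rcases Finset.mem_insert.1 hi with rfl | hi
    · left
      funext x
      ring
    · exact Or.inr (hmem i hi)

/-- A layer of a network, before and after activation. -/
theorem exists_layer {ι κ : Type*} (u : ι → X → ℝ) (hu : ∀ i, u i ∈ B) (h0 : (fun _ => 0) ∈ B)
    (w : ι → κ → ℝ) (S : Finset (ι × κ)) [DecidableEq κ] :
    ∃ L, Build B (2 * S.card) L ∧
      ∀ j, (fun x => ∑ p ∈ S with p.2 = j, w p.1 p.2 * u p.1 x) ∈ L ∧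
        (fun x => relu (∑ p ∈ S with p.2 = j, w p.1 p.2 * u p.1 x)) ∈ L := by
  classical
  obtain ⟨L, hL, hmem⟩ := exists_linear u hu h0 w S
  obtain ⟨L', hL', hmem'⟩ := exists_relu _ hmem (S.image Prod.snd)
  obtain ⟨k, hk⟩ := Nat.exists_eq_add_of_le (Finset.card_image_le (s := S) (f := Prod.snd))
  -- Lengths are exact, so a shorter program is padded by instructions that produce the zero
  -- function again.
  have hpad : ∀ k, Build L' k L' := by
    intro k
    induction k with
    | zero => exact .refl
    | succ k ih =>
      have h0' := hL'.subset (hL.subset h0)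
      have := Build.step (0 : ℝ) 0 0 ih h0' h0'
      rwa [Set.insert_eq_of_mem] at this
      simpa using h0'
  refine ⟨L', ?_, fun j => ⟨hL'.subset (hmem j), ?_⟩⟩
  · rw [two_mul]
    nth_rewrite 2 [hk]
    exact hL.trans (hL'.trans (hpad k))
  · by_cases hj : j ∈ S.image Prod.snd
    · exact hmem' j hj
    -- A column without entries is the zero function and needs no ReLU instruction. Hence there are
    -- at most as many ReLU instructions as weights.
    · have : ∀ x, ∑ p ∈ S with p.2 = j, w p.1 p.2 * u p.1 x = 0 := fun x => by
        refine Finset.sum_eq_zero fun p hp => ?_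
        rw [Finset.mem_filter] at hp
        exact absurd (Finset.mem_image.2 ⟨p, hp.1, hp.2⟩) hj
      simp only [this, relu, max_self]
      exact hL'.subset (hL.subset h0)

end Build

/-- The constants `0`, `1` and the coordinates. -/
def coordBase (d : ℕ) : Set (E d → ℝ) :=
  {u | u = (fun _ => 0) ∨ u = (fun _ => 1) ∨ ∃ i, u = fun x => x i}

theorem zero_mem_coordBase (d : ℕ) : (fun _ => 0) ∈ coordBase d := Or.inl rfl

theorem one_mem_coordBase (d : ℕ) : (fun _ => 1) ∈ coordBase d := Or.inr (Or.inl rfl)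

theorem coord_mem_coordBase {d : ℕ} (i : Fin d) : (fun x : E d => x i) ∈ coordBase d :=
  Or.inr (Or.inr ⟨i, rfl⟩)

theorem continuous_of_mem_coordBase {d : ℕ} (u : E d → ℝ) (hu : u ∈ coordBase d) :
    Continuous u := by
  rcases hu with rfl | rfl | ⟨i, rfl⟩ <;> fun_prop

/-! ### From networks to programs -/

theorem Net.depth_hidden {d m l : ℕ} (A : Matrix (Fin m) (Fin d) ℝ) (b : Fin m → ℝ)
    (φ : Net m l) : (Net.hidden A b φ).depth = φ.depth + 1 := rfl

theorem Net.size_hidden {d m l : ℕ} (A : Matrix (Fin m) (Fin d) ℝ) (b : Fin m → ℝ)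
    (φ : Net m l) : (Net.hidden A b φ).size = affineSize A b + φ.size := rfl

theorem Net.size_output {d m : ℕ} (A : Matrix (Fin m) (Fin d) ℝ) (b : Fin m → ℝ) :
    (Net.output A b).size = affineSize A b := rfl

theorem Net.eval_hidden {d m l : ℕ} (A : Matrix (Fin m) (Fin d) ℝ) (b : Fin m → ℝ)
    (φ : Net m l) (x : Fin d → ℝ) :
    (Net.hidden A b φ).eval x = φ.eval (fun i => relu ((A.mulVec x + b) i)) := rfl

theorem Net.eval_output {d m : ℕ} (A : Matrix (Fin m) (Fin d) ℝ) (b : Fin m → ℝ)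
    (x : Fin d → ℝ) : (Net.output A b).eval x = A.mulVec x + b := rfl

/-- An affine layer of a finite network. -/
theorem Build.exists_affine {X : Type*} {B : Set (X → ℝ)} {m d : ℕ} (A : Matrix (Fin m) (Fin d) ℝ)
    (b : Fin m → ℝ) (u : X → Fin d → ℝ) (hu : ∀ i, (fun x => u x i) ∈ B)
    (h0 : (fun _ => 0) ∈ B) (h1 : (fun _ => 1) ∈ B) :
    ∃ L, Build B (2 * affineSize A b) L ∧
      ∀ j, (fun x => (A.mulVec (u x) + b) j) ∈ L ∧
        (fun x => relu ((A.mulVec (u x) + b) j)) ∈ L := by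
  classical
  -- The index `none` stands for the constant feature 1, so that biases become ordinary weights.
  let w : Option (Fin d) → Fin m → ℝ := fun i j => i.elim (b j) (fun i => A j i)
  let v : Option (Fin d) → X → ℝ := fun i x => i.elim 1 (fun i => u x i)
  let S : Finset (Option (Fin d) × Fin m) := Finset.univ.filter fun p => w p.1 p.2 ≠ 0
  have hv : ∀ i, v i ∈ B := by
    rintro (_ | i)
    · exact h1
    · exact hu i
  have hS : S.card = affineSize A b := by
    have e1 : S = ((Finset.univ.filter fun p : Fin m × Fin d => A p.1 p.2 ≠ 0).map
        ⟨fun p => (some p.2, p.1), fun p p' h => by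
          simp only [Prod.mk.injEq, Option.some.injEq] at h
          exact Prod.ext h.2 h.1⟩) ∪ ((Finset.univ.filter fun j : Fin m => b j ≠ 0).map
        ⟨fun j => (none, j), fun p p' h => by simpa using h⟩) := by
      ext ⟨i, j⟩
      rcases i with _ | i <;> simp [S, w, DFunLike.coe]
    rw [e1, Finset.card_union_of_disjoint, Finset.card_map, Finset.card_map, affineSize]
    · simp only [Set.ncard_eq_toFinset_card', Set.toFinset_ofPred]
    · rw [Finset.disjoint_left]
      rintro ⟨i, j⟩ h h'
      rcases i with _ | i <;> simp [DFunLike.coe] at h h'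
  obtain ⟨L, hL, hmem⟩ := Build.exists_layer v hv h0 w S
  refine ⟨L, hS ▸ hL, fun j => ?_⟩
  have key : ∀ x, (A.mulVec (u x) + b) j = ∑ p ∈ S with p.2 = j, w p.1 p.2 * v p.1 x := by
    intro x
    have h1 : ∑ p ∈ S with p.2 = j, w p.1 p.2 * v p.1 x = ∑ i, w i j * v i x := by
      have : ∑ i, w i j * v i x = ∑ p : Option (Fin d) × Fin m with p.2 = j,
          w p.1 p.2 * v p.1 x := by
        rw [Finset.sum_filter, Fintype.sum_prod_type]
        refine Finset.sum_congr rfl fun i _ => ?_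
        simp
      rw [this]
      refine Finset.sum_subset ?_ ?_
      · intro p hp
        simp only [Finset.mem_filter, S, Finset.mem_univ, true_and] at hp ⊢
        exact hp.2
      · intro p hp hp'
        simp only [Finset.mem_filter, S, Finset.mem_univ, true_and, not_and] at hp hp'
        have : w p.1 p.2 = 0 := by
          by_contra h
          exact hp' h hp
        simp [this]
    rw [h1, Fintype.sum_option]
    simp [w, v, Matrix.mulVec, dotProduct, add_comm]
  simp only [key]
  exact hmem j

/-- The induction generalizes over `B`: the remaining layers take everything generated by the first
layer as initial functions. -/
theorem Net.exists_build {X : Type*} {B : Set (X → ℝ)} {d m : ℕ} (φ : Net d m)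
    (u : X → Fin d → ℝ) (hu : ∀ i, (fun x => u x i) ∈ B)
    (h0 : (fun _ => 0) ∈ B) (h1 : (fun _ => 1) ∈ B) :
    ∃ L, Build B (2 * φ.size) L ∧ ∀ j, (fun x => φ.eval (u x) j) ∈ L := by
  induction φ generalizing B with
  | output A b =>
    obtain ⟨L, hL, h⟩ := Build.exists_affine A b u hu h0 h1
    exact ⟨L, hL, fun j => (h j).1⟩
  | hidden A b rest ih =>
    obtain ⟨L, hL, h⟩ := Build.exists_affine A b u hu h0 h1
    obtain ⟨L', hrest, h'⟩ := ih (B := L) (fun x i => relu ((A.mulVec (u x) + b) i))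
      (fun i => (h i).2) (hL.subset h0) (hL.subset h1)
    refine ⟨L', ?_, h'⟩
    rw [Net.size_hidden, mul_add]
    exact hL.trans hrest

/-! ### From programs to networks -/

/-- A network with inputs indexed by a finite type, of size at most `s`. -/
def Realizes {ι : Type*} [Fintype ι] (F : (ι → ℝ) → ℝ) (s : ℕ) : Prop :=
  ∃ φ : Net (Fintype.card ι) 1, φ.size ≤ s ∧
    ∀ y, φ.eval (fun k => y ((Fintype.equivFin ι).symm k)) 0 = F y

theorem ncard_fin_pair_le {m d : ℕ} (S : Set (Fin m × Fin d)) (K : ℕ)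
    (h : ∀ i, Set.ncard {j | (i, j) ∈ S} ≤ K) : S.ncard ≤ m * K := by
  classical
  rw [Set.ncard_eq_toFinset_card']
  rw [Finset.card_eq_sum_card_fiberwise (f := Prod.fst) (t := Finset.univ) (by simp)]
  calc _ ≤ ∑ _i : Fin m, K := Finset.sum_le_sum fun i _ => ?_
    _ = m * K := by simp
  refine le_trans ?_ (h i)
  rw [Set.ncard_eq_toFinset_card']
  refine Finset.card_le_card_of_injOn Prod.snd ?_ ?_
  · rintro ⟨a, b⟩ hp
    simp only [Finset.coe_filter, Set.mem_toFinset, Set.mem_ofPred_eq] at hp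
    simp [← hp.2, hp.1]
  · rintro ⟨a, b⟩ hp ⟨a', b'⟩ hp' h
    simp only [Finset.coe_filter, Set.mem_toFinset, Set.mem_ofPred_eq] at hp hp'
    exact Prod.ext (hp.2.trans hp'.2.symm) h

/-- Precomposition with a layer each of whose rows has at most `K` nonzero weights. -/
theorem Realizes.exists_hidden {κ : Type*} [Fintype κ] {d : ℕ} {F : (κ → ℝ) → ℝ} {s : ℕ}
    (h : Realizes F s) (A : κ → Fin d → ℝ) (b : κ → ℝ) (K : ℕ)
    (hA : ∀ i, Set.ncard {j | A i j ≠ 0} ≤ K) :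
    ∃ φ : Net d 1, 1 ≤ φ.depth ∧ φ.size ≤ s + Fintype.card κ * (K + 1) ∧
      ∀ y, φ.eval y 0 = F (fun i => relu (∑ j, A i j * y j + b i)) := by
  obtain ⟨φ, hφ, hF⟩ := h
  let e := Fintype.equivFin κ
  refine ⟨.hidden (Matrix.of fun i j => A (e.symm i) j) (fun i => b (e.symm i)) φ, ?_, ?_,
    fun y => ?_⟩
  · rw [Net.depth_hidden]; omega
  · rw [Net.size_hidden, affineSize]
    have h1 := ncard_fin_pair_le {ij : Fin (Fintype.card κ) × Fin d | A (e.symm ij.1) ij.2 ≠ 0} K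
      (fun i => by simpa using hA (e.symm i))
    have h2 : Set.ncard {i : Fin (Fintype.card κ) | b (e.symm i) ≠ 0} ≤ Fintype.card κ := by
      refine (Set.ncard_le_card _).trans (by simp)
    calc _ ≤ Fintype.card κ * K + Fintype.card κ + s := by
          gcongr
          exact h1
      _ = _ := by ring
  · rw [Net.eval_hidden, ← hF]
    rfl

theorem Realizes.comp_hidden {ι κ : Type*} [Fintype ι] [Fintype κ] {F : (κ → ℝ) → ℝ} {s : ℕ}
    (h : Realizes F s) (A : κ → ι → ℝ) (K : ℕ) (hA : ∀ i, Set.ncard {j | A i j ≠ 0} ≤ K) :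
    Realizes (fun y : ι → ℝ => F (fun i => relu (∑ j, A i j * y j)))
      (s + Fintype.card κ * (K + 1)) := by
  let e := Fintype.equivFin ι
  obtain ⟨φ, -, h1, h2⟩ := h.exists_hidden (fun i j => A i (e.symm j)) 0 K fun i => by
    refine le_trans ?_ (hA i)
    rw [← Set.ncard_image_of_injective _ e.symm.injective]
    refine Set.ncard_le_ncard ?_ (Set.toFinite _)
    rintro _ ⟨j, hj, rfl⟩
    exact hj
  refine ⟨φ, h1, fun y => ?_⟩
  rw [h2]
  congr 1
  funext i
  rw [Pi.zero_apply, add_zero, ← e.symm.sum_comp]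

/-- Positive and negative parts. -/
def signed (β : Bool) (t : ℝ) : ℝ := relu (if β then t else -t)

/-- Through this identity a value of either sign survives any number of ReLU layers. -/
theorem signed_sub (t : ℝ) : signed true t - signed false t = t := by
  simp only [signed, relu]
  rcases le_total t 0 with h | h <;> simp [h]

/-- A function is a network applied to the positive and negative parts of `K` functions in `L`. -/
def Readout {X : Type*} (L : Set (X → ℝ)) (F : X → ℝ) (K s : ℕ) : Prop :=
  ∃ (u : Fin K → X → ℝ) (G : (Fin K × Bool → ℝ) → ℝ), (∀ k, u k ∈ L) ∧ Realizes G s ∧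
    ∀ x, F x = G (fun p => signed p.2 (u p.1 x))

theorem ncard_ne_zero_le {ι : Type*} [Fintype ι] (A : ι → ℝ) (S : Finset ι)
    (h : ∀ j ∉ S, A j = 0) : Set.ncard {j | A j ≠ 0} ≤ S.card := by
  rw [← Set.ncard_coe_finset]
  refine Set.ncard_le_ncard ?_ (Set.toFinite _)
  intro j hj
  by_contra h'
  exact hj (h j h')

theorem Readout.of_mem {X : Type*} {L : Set (X → ℝ)} {F : X → ℝ} (h : F ∈ L) :
    Readout L F 1 2 := by
  let e := Fintype.equivFin (Fin 1 × Bool)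
  refine ⟨fun _ => F, fun y => y (0, true) - y (0, false), fun _ => h,
    ⟨.output (Matrix.of fun _ k => if (e.symm k).2 then 1 else -1) 0, ?_, fun y => ?_⟩, fun x => ?_⟩
  · rw [Net.size_output, affineSize]
    have h1 := ncard_fin_pair_le (m := 1) (d := Fintype.card (Fin 1 × Bool))
      {ij | (if (e.symm ij.2).2 = true then (1 : ℝ) else -1) ≠ 0} 2 (fun i => by
        refine (Set.ncard_le_card _).trans (by simp))
    simpa using h1
  · rw [Net.eval_output]
    simp only [Matrix.mulVec, dotProduct, Pi.add_apply, Pi.zero_apply, add_zero]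
    rw [← e.sum_comp]
    simp only [e, Equiv.symm_apply_apply]
    rw [Fintype.sum_prod_type]
    simp
    ring
  · exact (signed_sub _).symm

/-- The last instruction w = a u + b v + e σ(u) is turned into a layer. With positive and negative
parts, w = (a + e) u⁺ - a u⁻ + b v⁺ - b v⁻, and each other input z is carried along as z⁺ - z⁻. All
occurrences of w use the same two new inputs u and v, so the width grows by 2 only. The layer has 2K
rows with at most 4 weights each; one further unit per row is allowed for a bias. -/
theorem Readout.step {X : Type*} {L : Set (X → ℝ)} {F : X → ℝ} {K s : ℕ} {u v : X → ℝ}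
    (a b e : ℝ) (hu : u ∈ L) (hv : v ∈ L)
    (h : Readout (insert (fun x => a * u x + b * v x + e * relu (u x)) L) F K s) :
    Readout L F (K + 2) (s + 2 * K * 5) := by
  classical
  obtain ⟨z, G, hz, hG, hF⟩ := h
  -- A slot that held the eliminated function is filled with `u` as a dummy; it receives only zero
  -- weights.
  let z' : Fin (K + 2) → X → ℝ := Fin.addCases (fun k => if z k ∈ L then z k else u) ![u, v]
  let A : Fin K × Bool → Fin (K + 2) × Bool → ℝ := fun p =>
    let σ : ℝ := if p.2 then 1 else -1
    if z p.1 ∈ L then fun r =>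
      if r = (Fin.castAdd 2 p.1, true) then σ else if r = (Fin.castAdd 2 p.1, false) then -σ else 0
    else fun r =>
      if r = (Fin.natAdd K 0, true) then σ * (a + e)
      else if r = (Fin.natAdd K 0, false) then -σ * a
      else if r = (Fin.natAdd K 1, true) then σ * b
      else if r = (Fin.natAdd K 1, false) then -σ * b else 0
  have hA : ∀ p, Set.ncard {r | A p r ≠ 0} ≤ 4 := by
    intro p
    by_cases hp : z p.1 ∈ L
    · refine (ncard_ne_zero_le (A p) {(Fin.castAdd 2 p.1, true), (Fin.castAdd 2 p.1, false)}
        fun j hj => ?_).trans (Finset.card_le_two.trans (by norm_num))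
      simp only [Finset.mem_insert, Finset.mem_singleton, not_or] at hj
      simp [A, hp, hj.1, hj.2]
    · refine (ncard_ne_zero_le (A p) {(Fin.natAdd K 0, true), (Fin.natAdd K 0, false),
        (Fin.natAdd K 1, true), (Fin.natAdd K 1, false)} fun j hj => ?_).trans Finset.card_le_four
      simp only [Finset.mem_insert, Finset.mem_singleton, not_or] at hj
      simp only [A, hp, if_false, hj.1, hj.2.1, hj.2.2.1, hj.2.2.2]
  refine ⟨z', fun y => G (fun i => relu (∑ j, A i j * y j)), ?_, ?_, fun x => ?_⟩
  · intro k
    induction k using Fin.addCases with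
    | left k =>
      simp only [z', Fin.addCases_left]
      split_ifs with hk
      · exact hk
      · exact hu
    | right k =>
      simp only [z', Fin.addCases_right]
      fin_cases k
      · exact hu
      · exact hv
  · convert hG.comp_hidden A 4 hA using 1
    simp
    ring
  · rw [hF]
    congr 1
    funext p
    have hs : ∀ t, signed p.2 t = relu ((if p.2 then 1 else -1) * t) := by
      intro t
      unfold signed
      cases p.2 <;> simp
    have hsum : ∀ t : ℝ, t = signed true t - signed false t := fun t => (signed_sub t).symm
    rw [hs]
    congr 1
    rw [Fintype.sum_prod_type, Fin.sum_univ_add]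
    simp only [Fintype.sum_bool, Fin.sum_univ_two]
    by_cases hp : z p.1 ∈ L
    · have e1 : ∀ k : Fin K, A p (Fin.castAdd 2 k, true) * signed true (z' (Fin.castAdd 2 k) x)
          + A p (Fin.castAdd 2 k, false) * signed false (z' (Fin.castAdd 2 k) x)
          = if k = p.1 then (if p.2 then 1 else -1) * z p.1 x else 0 := by
        intro k
        by_cases hk : k = p.1
        · subst hk
          simp only [A, hp, if_true, z', Fin.addCases_left]
          conv_rhs => rw [hsum (z p.1 x)]
          simp
          split_ifs <;> ring
        · have : Fin.castAdd 2 k ≠ Fin.castAdd 2 p.1 := fun h => hk (Fin.castAdd_injective _ _ h)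
          simp [A, hp, hk, this]
      have e2 : ∀ (k : Fin 2) β, A p (Fin.natAdd K k, β) = 0 := by
        intro k β
        have : Fin.natAdd K k ≠ Fin.castAdd 2 p.1 := by
          intro h
          have := congrArg Fin.val h
          simp at this
          omega
        simp [A, hp, this]
      simp [e1, e2]
    · have hw : z p.1 = fun x => a * u x + b * v x + e * relu (u x) := by
        rcases hz p.1 with h | h
        · exact h
        · exact absurd h hp
      have e1 : ∀ (k : Fin K) β, A p (Fin.castAdd 2 k, β) = 0 := by
        intro k β
        have : ∀ l : Fin 2, Fin.castAdd 2 k ≠ Fin.natAdd K l := by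
          intro l h
          have := congrArg Fin.val h
          simp at this
          omega
        simp [A, hp, this]
      have e2 : z' (Fin.natAdd K 0) = u := by simp [z']
      have e3 : z' (Fin.natAdd K 1) = v := by simp [z']
      have hne : Fin.natAdd K (1 : Fin 2) ≠ Fin.natAdd K 0 := by
        intro h
        have := congrArg Fin.val h
        simp at this
      have hr : relu (u x) = signed true (u x) := by simp [signed]
      simp only [e1, e2, e3, hw]
      simp only [A, hp, if_false]
      simp only [Prod.mk.injEq, hne, reduceCtorEq, and_false, and_true, if_false, if_true,
        zero_mul, Finset.sum_const_zero, add_zero, zero_add]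
      rw [hr]
      conv_lhs => rw [hsum (v x)]
      conv_lhs => enter [2, 1, 1]; rw [hsum (u x)]
      ring

/-- The instructions are removed from the last to the first. The width never exceeds K + 2s and each
of the s layers costs at most ten times the width, whence a quadratic bound. -/
theorem Build.readout {X : Type*} {B L : Set (X → ℝ)} {s : ℕ} (h : Build B s L) {F : X → ℝ}
    {K σ : ℕ} (hF : Readout L F K σ) : Readout B F (K + 2 * s) (σ + 10 * s * (K + 2 * s)) := by
  induction h generalizing K σ with
  | refl => simpa using hF
  | @step s L u v a b e h hu hv ih =>
    obtain ⟨z, G, h1, ⟨φ, h2, h3⟩, h4⟩ := ih (hF.step a b e hu hv)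
    have hK : K + 2 + 2 * s = K + 2 * (s + 1) := by ring
    rw [← hK]
    refine ⟨z, G, h1, ⟨φ, h2.trans ?_, h3⟩, h4⟩
    nlinarith

/-- A program of length `s` is realized by a network of size `O(s²)`. -/
theorem Build.exists_net {d s : ℕ} {L : Set (E d → ℝ)} (h : Build (coordBase d) s L)
    {F : E d → ℝ} (hF : F ∈ L) :
    ∃ φ : Net d 1, 1 ≤ φ.depth ∧ φ.size ≤ 50 * (s + 1) ^ 2 ∧ ∀ x, φ.real x = F x := by
  classical
  obtain ⟨u, G, hu, hG, hFG⟩ := h.readout (Readout.of_mem hF)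
  -- Only initial functions are left to be read. They are affine with at most one weight, so one
  -- hidden layer produces all their signed parts.
  have hrep : ∀ k, ∃ (a : Fin d → ℝ) (b : ℝ), Set.ncard {j | a j ≠ 0} ≤ 1 ∧
      ∀ x, u k x = ∑ j, a j * x j + b := by
    intro k
    rcases hu k with h | h | ⟨i, h⟩
    · exact ⟨0, 0, by simp, by simp [h]⟩
    · exact ⟨0, 1, by simp, by simp [h]⟩
    · refine ⟨Pi.single i 1, 0, ?_, fun x => by simp [h, Pi.single_apply]⟩
      refine (ncard_ne_zero_le _ {i} fun j hj => ?_).trans (by simp)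
      simp at hj
      simp [hj]
  choose a b ha hab using hrep
  obtain ⟨φ, h1, h2, h3⟩ := hG.exists_hidden
    (fun p j => (if p.2 then 1 else -1) * a p.1 j) (fun p => (if p.2 then 1 else -1) * b p.1) 1
    (fun p => by
      refine le_trans (Set.ncard_le_ncard ?_ (Set.toFinite _)) (ha p.1)
      intro j hj
      exact right_ne_zero_of_mul hj)
  refine ⟨φ, h1, h2.trans ?_, fun x => ?_⟩
  · simp only [Fintype.card_prod, Fintype.card_fin, Fintype.card_bool]
    nlinarith
  · rw [Net.real, h3, hFG]
    congr 1
    funext p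
    rw [hab, signed]
    congr 1
    cases p.2 <;> simp [Finset.sum_neg_distrib, add_comm]

/-! ### Infinite-width networks of finite size -/

/-- A layer with finitely many nonzero weights, coordinatewise. -/
theorem Build.exists_sparse {X ι κ : Type*} {B : Set (X → ℝ)} (u : ι → X → ℝ) (hu : ∀ i, u i ∈ B)
    (h0 : (fun _ => 0) ∈ B) (w : ι → κ → ℝ) (F : X → κ → ℝ)
    (hfin : {p : ι × κ | w p.1 p.2 ≠ 0}.Finite)
    (hF : ∀ (T : Finset ι), (∀ i ∉ T, ∀ j, w i j = 0) → ∀ x j, F x j = ∑ i ∈ T, w i j * u i x) :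
    ∃ L, Build B (2 * {p : ι × κ | w p.1 p.2 ≠ 0}.ncard) L ∧
      ∀ j, (fun x => F x j) ∈ L ∧ (fun x => relu (F x j)) ∈ L := by
  classical
  obtain ⟨L, hL, hmem⟩ := Build.exists_layer u hu h0 w hfin.toFinset
  rw [Set.ncard_eq_toFinset_card _ hfin]
  refine ⟨L, hL, fun j => ?_⟩
  have key : ∀ x, F x j = ∑ p ∈ hfin.toFinset with p.2 = j, w p.1 p.2 * u p.1 x := by
    intro x
    rw [hF (hfin.toFinset.image Prod.fst) ?_ x j]
    · symm
      rw [← Finset.sum_filter_of_ne (p := fun i => w i j ≠ 0)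
        (fun i _ h => left_ne_zero_of_mul h)]
      refine Finset.sum_bij' (fun p _ => p.1) (fun i _ => (i, j)) ?_ ?_ ?_ ?_ ?_
      · rintro ⟨i, j'⟩ hp
        simp only [Finset.mem_filter, Set.Finite.mem_toFinset, Set.mem_ofPred_eq] at hp
        simp only [Finset.mem_filter, Finset.mem_image, Set.Finite.mem_toFinset, Set.mem_ofPred_eq]
        obtain ⟨hp, rfl⟩ := hp
        exact ⟨⟨(i, j'), hp, rfl⟩, hp⟩
      · intro i hi
        simp only [Finset.mem_filter, Set.Finite.mem_toFinset, Set.mem_ofPred_eq] at hi ⊢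
        exact ⟨hi.2, trivial⟩
      · rintro ⟨i, j'⟩ hp
        simp only [Finset.mem_filter] at hp
        rw [hp.2]
      · intro i _
        rfl
      · rintro ⟨i, j'⟩ hp
        simp only [Finset.mem_filter] at hp
        simp only [← hp.2]
    · intro i hi j'
      by_contra h
      exact hi (Finset.mem_image.2 ⟨(i, j'), by simpa using h, rfl⟩)
  simp only [key]
  exact hmem j

/-- The sum may run over any finite set that carries the weights; this is the form in which
`Build.exists_sparse` consumes the three kinds of layers. -/
theorem layerIn_apply {d : ℕ} (w : ParamIn d) (T : Finset (Fin (d + 1)))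
    (hT : ∀ i ∉ T, ∀ j, w i j = 0) (x : E d) (j : ℕ) :
    layerIn w x j = ∑ i ∈ T, w i j * featIn x i := by
  rw [layerIn, lp.coeFn_sum, Finset.sum_apply]
  rw [← Finset.sum_subset (Finset.subset_univ T)]
  · refine Finset.sum_congr rfl fun i _ => ?_
    rw [lp.coeFn_smul, Pi.smul_apply, smul_eq_mul, mul_comm]
  · intro i _ hi
    rw [lp.coeFn_smul, Pi.smul_apply, hT i hi j, smul_zero]

theorem layerMid_apply (w : ParamMid) (T : Finset ℕ) (hT : ∀ i ∉ T, ∀ j, w i j = 0) (y : ell2)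
    (j : ℕ) : layerMid w y j = ∑ i ∈ T, w i j * feat y i := by
  have h0 : ∀ i ∉ T, w i = 0 := fun i hi => lp.ext (funext fun j => by simpa using hT i hi j)
  rw [layerMid, tsum_eq_sum (s := T) (fun i hi => by rw [h0 i hi, smul_zero]), lp.coeFn_sum,
    Finset.sum_apply]
  refine Finset.sum_congr rfl fun i _ => ?_
  rw [lp.coeFn_smul, Pi.smul_apply, smul_eq_mul, mul_comm]

theorem layerOut_apply {d : ℕ} (w : ParamOut d) (T : Finset ℕ) (hT : ∀ i ∉ T, ∀ j, w i j = 0)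
    (y : ell2) (j : Fin d) : layerOut w y j = ∑ i ∈ T, w i j * feat y i := by
  have h0 : ∀ i ∉ T, w i = 0 := fun i hi => by
    ext j
    simpa using hT i hi j
  rw [layerOut, tsum_eq_sum (s := T) (fun i hi => by rw [h0 i hi, smul_zero]), WithLp.ofLp_sum,
    Finset.sum_apply]
  refine Finset.sum_congr rfl fun i _ => ?_
  rw [WithLp.ofLp_smul, Pi.smul_apply, smul_eq_mul, mul_comm]

theorem feat_mem {X : Type*} {L : Set (X → ℝ)} (y : X → ell2) (h1 : (fun _ => 1) ∈ L)
    (h : ∀ j, (fun x => relu (y x j)) ∈ L) (m : ℕ) : (fun x => feat (y x) m) ∈ L := by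
  cases m with
  | zero => exact h1
  | succ m => exact h m

/-- A coordinate without nonzero weights is the zero function, so finitely many instructions make
all coordinates of the infinite hidden layers available. -/
theorem Build.exists_foldl {X : Type*} {B : Set (X → ℝ)} (h0 : (fun _ => 0) ∈ B)
    (h1 : (fun _ => 1) ∈ B) (y : X → ell2) (hy : ∀ j, (fun x => relu (y x j)) ∈ B) :
    ∀ (k : ℕ) (w : Fin k → ParamMid), (∀ i, {p : ℕ × ℕ | w i p.1 p.2 ≠ 0}.Finite) →
      ∃ L, Build B (2 * ∑ i, {p : ℕ × ℕ | w i p.1 p.2 ≠ 0}.ncard) L ∧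
        ∀ j, (fun x => relu (Fin.foldl k (fun y i => layerMid (w i) y) (y x) j)) ∈ L
  | 0, w, _ => ⟨B, by simpa using Build.refl, by simpa using hy⟩
  | k + 1, w, hw => by
    obtain ⟨L, hL, hmem⟩ := Build.exists_foldl h0 h1 y hy k (fun i => w i.castSucc)
      (fun i => hw _)
    obtain ⟨L', hL', hmem'⟩ := Build.exists_sparse (B := L)
      (fun i x => feat (Fin.foldl k (fun y i => layerMid (w i.castSucc) y) (y x)) i)
      (feat_mem _ (hL.subset h1) hmem) (hL.subset h0) (fun m j => w (Fin.last k) m j)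
      (fun x j => layerMid (w (Fin.last k))
        (Fin.foldl k (fun y i => layerMid (w i.castSucc) y) (y x)) j) (hw _)
      (fun T hT x j => layerMid_apply _ T hT _ j)
    refine ⟨L', ?_, fun j => ?_⟩
    · rw [Fin.sum_univ_castSucc, mul_add]
      exact hL.trans hL'
    · simp only [Fin.foldl_succ_last]
      exact (hmem' j).2

/-- The size is a sum in ℕ∞, so if it is finite, each layer has finitely many nonzero weights and
its series are finite sums. The length obtained does not involve the depth. -/
theorem NetParam.exists_build {d k d' : ℕ} (θ : NetParam d k d') {s : ℕ} (hs : θ.size = s) :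
    ∃ L, Build (coordBase d) (2 * s) L ∧ ∀ j, (fun x => θ.eval x j) ∈ L := by
  have hne : θ.size ≠ ⊤ := by simp [hs]
  rw [NetParam.size] at hne hs
  have f1 : {p : Fin (d + 1) × ℕ | θ.1 p.1 p.2 ≠ 0}.Finite := by
    rw [← Set.encard_ne_top_iff]
    intro h
    simp [h] at hne
  have f2 : ∀ i, {p : ℕ × ℕ | θ.2.1 i p.1 p.2 ≠ 0}.Finite := by
    intro i
    rw [← Set.encard_ne_top_iff]
    intro h
    refine hne ?_
    have : ∑ i, Set.encard {mn : ℕ × ℕ | θ.2.1 i mn.1 mn.2 ≠ 0} = ⊤ := by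
      refine top_le_iff.1 (h.ge.trans ?_)
      exact Finset.single_le_sum (f := fun i => Set.encard {mn : ℕ × ℕ | θ.2.1 i mn.1 mn.2 ≠ 0})
        (fun _ _ => zero_le) (Finset.mem_univ i)
    rw [this]
    simp
  have f3 : {p : ℕ × Fin d' | θ.2.2 p.1 p.2 ≠ 0}.Finite := by
    rw [← Set.encard_ne_top_iff]
    intro h
    simp [h] at hne
  have hs' : s = {p : Fin (d + 1) × ℕ | θ.1 p.1 p.2 ≠ 0}.ncard
      + ∑ i, {p : ℕ × ℕ | θ.2.1 i p.1 p.2 ≠ 0}.ncard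
      + {p : ℕ × Fin d' | θ.2.2 p.1 p.2 ≠ 0}.ncard := by
    rw [← f1.cast_ncard_eq, ← f3.cast_ncard_eq] at hs
    simp only [← (f2 _).cast_ncard_eq] at hs
    exact_mod_cast hs.symm
  have hin : ∀ i, (fun x => featIn x i) ∈ coordBase d := by
    intro i
    cases i using Fin.cases with
    | zero => exact one_mem_coordBase d
    | succ i => exact coord_mem_coordBase i
  obtain ⟨L₁, hL₁, hm₁⟩ := Build.exists_sparse (B := coordBase d) (fun i x => featIn x i) hin
    (zero_mem_coordBase d) (fun m j => θ.1 m j) (fun x j => layerIn θ.1 x j) f1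
    (fun T hT x j => layerIn_apply _ T hT _ j)
  have h0 := hL₁.subset (zero_mem_coordBase d)
  have h1 := hL₁.subset (one_mem_coordBase d)
  obtain ⟨L₂, hL₂, hm₂⟩ := Build.exists_foldl h0 h1 (fun x => layerIn θ.1 x)
    (fun j => (hm₁ j).2) k θ.2.1 f2
  obtain ⟨L₃, hL₃, hm₃⟩ := Build.exists_sparse (B := L₂)
    (fun i x => feat (Fin.foldl k (fun y i => layerMid (θ.2.1 i) y) (layerIn θ.1 x)) i)
    (feat_mem _ (hL₂.subset h1) hm₂) (hL₂.subset h0) (fun m j => θ.2.2 m j)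
    (fun x j => θ.eval x j) f3 (fun T hT x j => layerOut_apply _ T hT _ j)
  refine ⟨L₃, ?_, fun j => (hm₃ j).1⟩
  rw [hs', mul_add, mul_add]
  exact (hL₁.trans hL₂).trans hL₃

/-! ### Measurability of the size and of the growth -/

/-- The count is a countable sum of indicators of measurable events. -/
theorem measurable_encard_ne_zero {Ω ι : Type*} [MeasurableSpace Ω] [Countable ι]
    (a : Ω → ι → ℝ) (ha : ∀ i, Measurable fun ω => a ω i) :
    Measurable fun ω => ((Set.encard {i | a ω i ≠ 0} : ℕ∞) : ℝ≥0∞) := by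
  let _ : MeasurableSpace ι := ⊤
  have h : ∀ ω, ((Set.encard {i | a ω i ≠ 0} : ℕ∞) : ℝ≥0∞)
      = ∑' i, {ω | a ω i ≠ 0}.indicator (fun _ => (1 : ℝ≥0∞)) ω := by
    intro ω
    rw [← Measure.count_apply (MeasurableSpace.measurableSet_top),
      ← lintegral_indicator_one (MeasurableSpace.measurableSet_top), lintegral_count]
    rfl
  simp only [h]
  refine Measurable.tsum fun i => ?_
  exact measurable_const.indicator ((measurableSet_singleton (0 : ℝ)).compl.preimage (ha i))

theorem measurable_size {Ω : Type*} {mΩ : MeasurableSpace Ω} {d k d' : ℕ}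
    {θ : Ω → NetParam d k d'} (hθ : Measurable[mΩ, borel (NetParam d k d')] θ) :
    Measurable fun ω => ((θ ω).size : ℝ≥0∞) := by
  let _ : MeasurableSpace (NetParam d k d') := borel _
  have : BorelSpace (NetParam d k d') := ⟨rfl⟩
  have hc : ∀ F : NetParam d k d' → ℝ, Continuous F → Measurable fun ω => F (θ ω) :=
    fun F hF => hF.measurable.comp hθ
  have e2 : ∀ n, Continuous fun y : ell2 => y n := fun n =>
    (lp.evalCLM ℝ (fun _ : ℕ => ℝ) 2 n).continuous
  simp only [NetParam.size, ENat.toENNReal_add]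
  refine (Measurable.add ?_ ?_).add ?_
  · refine measurable_encard_ne_zero (fun ω (p : Fin (d + 1) × ℕ) => (θ ω).1 p.1 p.2) fun p => ?_
    refine hc (fun θ => θ.1 p.1 p.2) ((e2 _).comp ?_)
    exact (lp.evalCLM ℝ (fun _ : Fin (d + 1) => ell2) 1 p.1).continuous.comp continuous_fst
  · have : ∀ ω, ((∑ i, Set.encard {mn : ℕ × ℕ | (θ ω).2.1 i mn.1 mn.2 ≠ 0} : ℕ∞) : ℝ≥0∞)
        = ∑ i, ((Set.encard {mn : ℕ × ℕ | (θ ω).2.1 i mn.1 mn.2 ≠ 0} : ℕ∞) : ℝ≥0∞) :=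
      fun ω => map_sum ENat.toENNRealRingHom _ _
    simp only [this]
    refine Finset.measurable_sum _ fun i _ => ?_
    refine measurable_encard_ne_zero (fun ω (p : ℕ × ℕ) => (θ ω).2.1 i p.1 p.2) fun p => ?_
    refine hc (fun θ => θ.2.1 i p.1 p.2) ((e2 _).comp ?_)
    exact (lp.evalCLM ℝ (fun _ : ℕ => ell2) 1 p.1).continuous.comp
      ((continuous_apply i).comp (continuous_fst.comp continuous_snd))
  · refine measurable_encard_ne_zero (fun ω (p : ℕ × Fin d') => (θ ω).2.2 p.1 p.2) fun p => ?_
    refine hc (fun θ => θ.2.2 p.1 p.2) ?_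
    have e3 : Continuous fun y : E d' => y p.2 := by fun_prop
    refine e3.comp ?_
    exact (lp.evalCLM ℝ (fun _ : ℕ => E d') 1 p.1).continuous.comp
      (continuous_snd.comp continuous_snd)

theorem enorm_le_growth {d d' : ℕ} (h : E d → E d') (x : E d) :
    ‖h x‖ₑ ≤ growth h * (1 + ‖x‖ₑ) := by
  have h1 : ‖h x‖ₑ / (1 + ‖x‖ₑ) ≤ growth h := le_iSup (fun x => ‖h x‖ₑ / (1 + ‖x‖ₑ)) x
  exact (ENNReal.div_le_iff (by simp) (by simp)).1 h1

/-- The quotient is continuous in the point, so a dense sequence attains the supremum; a countable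
supremum remains measurable in a random parameter. -/
theorem growth_eq_iSup_denseSeq {d d' : ℕ} {h : E d → E d'} (hc : Continuous h) :
    growth h = ⨆ i : ℕ, ‖h (TopologicalSpace.denseSeq (E d) i)‖ₑ /
      (1 + ‖TopologicalSpace.denseSeq (E d) i‖ₑ) := by
  have key : ∀ x, ‖h x‖ₑ / (1 + ‖x‖ₑ) = ENNReal.ofReal (‖h x‖ / (1 + ‖x‖)) := by
    intro x
    rw [ENNReal.ofReal_div_of_pos (by positivity), ENNReal.ofReal_add (by positivity)
      (by positivity), ENNReal.ofReal_one, ofReal_norm, ofReal_norm]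
  have hcont : Continuous fun x => ENNReal.ofReal (‖h x‖ / (1 + ‖x‖)) := by
    refine ENNReal.continuous_ofReal.comp (hc.norm.div (by fun_prop) fun x => ?_)
    positivity
  refine le_antisymm (iSup_le fun x => ?_) (iSup_le fun i => ?_)
  · rw [key]
    refine (TopologicalSpace.denseRange_denseSeq (E d)).induction_on
      (p := fun x => ENNReal.ofReal (‖h x‖ / (1 + ‖x‖)) ≤ _) x
      (isClosed_le hcont continuous_const) fun i => ?_
    rw [← key]
    exact le_iSup (fun i : ℕ => ‖h (TopologicalSpace.denseSeq (E d) i)‖ₑ /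
      (1 + ‖TopologicalSpace.denseSeq (E d) i‖ₑ)) i
  · exact le_iSup (fun x => ‖h x‖ₑ / (1 + ‖x‖ₑ)) _

theorem aemeasurable_growth {Ω : Type*} {mΩ : MeasurableSpace Ω} {P : Measure Ω} {d d' : ℕ}
    {f : E d → Ω → E d'} (hf : ∀ x, Measurable (f x))
    (hc : ∀ᵐ ω ∂P, Continuous fun x => f x ω) :
    AEMeasurable (fun ω => growth fun x => f x ω) P := by
  refine ⟨fun ω => ⨆ i : ℕ, ‖f (TopologicalSpace.denseSeq (E d) i) ω‖ₑ /
      (1 + ‖TopologicalSpace.denseSeq (E d) i‖ₑ), ?_, ?_⟩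
  · exact Measurable.iSup fun i => (hf _).enorm.div_const _
  · filter_upwards [hc] with ω hω
    exact growth_eq_iSup_denseSeq hω

/-! ### Freezing a measurable argument of a random function -/

section Freezing

variable {Ω : Type*} {𝒢 mΩ : MeasurableSpace Ω} {P : Measure Ω}
  {d d' : ℕ} {F : E d → Ω → E d'}

/-- On each event {X = x} the argument is a constant. There the weight Λ 1_{X = x} is 𝒢-measurable
and F(x, ·) is independent of 𝒢, so the integral factors. -/
theorem lintegral_freezing_simpleFunc (h𝒢 : 𝒢 ≤ mΩ) (hF : Measurable (Function.uncurry F))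
    (hind : ∀ x, Indep (MeasurableSpace.comap (F x) inferInstance) 𝒢 P)
    (X : @SimpleFunc Ω 𝒢 (E d)) {Λ : Ω → ℝ≥0∞} (hΛ : Measurable[𝒢] Λ) {h : E d' → ℝ≥0∞}
    (hh : Measurable h) :
    ∫⁻ ω, Λ ω * h (F (X ω) ω) ∂P = ∫⁻ ω, Λ ω * ∫⁻ ω', h (F (X ω) ω') ∂P ∂P := by
  classical
  have hset : ∀ x, MeasurableSet[𝒢] (X ⁻¹' {x}) := fun x =>
    @SimpleFunc.measurableSet_fiber _ _ 𝒢 X x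
  have hFx : ∀ x, Measurable (F x) := fun x => hF.comp measurable_prodMk_left
  have hfin : (Set.range X).Finite := @SimpleFunc.finite_range _ _ 𝒢 X
  have split : ∀ k : E d → Ω → ℝ≥0∞, (∀ x, Measurable (k x)) →
      ∫⁻ ω, Λ ω * k (X ω) ω ∂P
        = ∑ x ∈ hfin.toFinset, ∫⁻ ω, (X ⁻¹' {x}).indicator Λ ω * k x ω ∂P := by
    intro k hk
    have hm : ∀ x ∈ hfin.toFinset, Measurable fun ω => (X ⁻¹' {x}).indicator Λ ω * k x ω :=
      fun x _ => ((hΛ.mono h𝒢 le_rfl).indicator (h𝒢 _ (hset x))).mul (hk x)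
    rw [← lintegral_finsetSum _ hm]
    refine lintegral_congr fun ω => ?_
    rw [Finset.sum_eq_single (X ω)]
    · simp
    · intro x _ hx
      rw [Set.indicator_of_notMem, zero_mul]
      exact fun h => hx h.symm
    · intro hX
      simp at hX
  rw [split (fun x ω => h (F x ω)) fun x => hh.comp (hFx x),
    split (fun x _ => ∫⁻ ω', h (F x ω') ∂P) fun x => measurable_const]
  refine Finset.sum_congr rfl fun x _ => ?_
  rw [lintegral_mul_const _ ((hΛ.mono h𝒢 le_rfl).indicator (h𝒢 _ (hset x)))]
  exact lintegral_mul_eq_lintegral_mul_lintegral_of_independent_measurableSpace h𝒢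
    (hFx x).comap_le (hind x).symm (hΛ.indicator (hset x)) (hh.comp (comap_measurable (F x)))

/-- Independence of 𝒢 is known for each fixed x only, not for the random field F as a whole. The
general case therefore follows from simple X by approximation, and continuity of x ↦ F(x, ω) passes
to the limit. -/
theorem map_freezing [IsProbabilityMeasure P] (h𝒢 : 𝒢 ≤ mΩ) (hF : Measurable (Function.uncurry F))
    (hc : ∀ᵐ ω ∂P, Continuous fun x => F x ω)
    (hind : ∀ x, Indep (MeasurableSpace.comap (F x) inferInstance) 𝒢 P)
    {X : Ω → E d} (hX : Measurable[𝒢] X) {Λ : Ω → ℝ≥0∞} (hΛ : Measurable[𝒢] Λ)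
    (hfin : ∫⁻ ω, Λ ω ∂P ≠ ⊤) :
    (P.withDensity Λ).map (fun ω => F (X ω) ω)
      = (((P.withDensity Λ).map X).prod P).map (Function.uncurry F) := by
  have hΛ' : Measurable Λ := hΛ.mono h𝒢 le_rfl
  have hX' : Measurable X := hX.mono h𝒢 le_rfl
  have : IsFiniteMeasure (P.withDensity Λ) := isFiniteMeasure_withDensity hfin
  have hFX : Measurable fun ω => F (X ω) ω := hF.comp (hX'.prodMk measurable_id)
  -- Bounded continuous test functions determine a finite measure. Their continuity gives pointwise
  -- convergence along the approximations of `X`, and their boundedness gives domination by a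
  -- multiple of `Λ`.
  refine ext_of_forall_lintegral_eq_of_IsFiniteMeasure fun h => ?_
  have hh : Measurable fun y => (h y : ℝ≥0∞) := by
    have := h.continuous.measurable
    fun_prop
  have hhF : Measurable fun z => (h (Function.uncurry F z) : ℝ≥0∞) := hh.comp hF
  have hhX : Measurable fun ω => (h (F (X ω) ω) : ℝ≥0∞) := hh.comp hFX
  have hHm : Measurable fun x => ∫⁻ ω', h (F x ω') ∂P :=
    Measurable.lintegral_prod_right (hh.comp hF)
  obtain ⟨C, hC⟩ : ∃ C : ℝ≥0, ∀ y, h y ≤ C := ⟨_, h.apply_le_nndist_zero⟩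
  have hbd : ∀ y, (h y : ℝ≥0∞) ≤ C := fun y => by exact_mod_cast hC y
  have hHX : Measurable fun ω => ∫⁻ ω', h (F (X ω) ω') ∂P := hHm.comp hX'
  rw [lintegral_map hh hFX, lintegral_map hh hF, lintegral_prod _ hhF.aemeasurable]
  simp only [Function.uncurry_apply_pair]
  rw [lintegral_map hHm hX', lintegral_withDensity_eq_lintegral_mul _ hΛ' hhX,
    lintegral_withDensity_eq_lintegral_mul _ hΛ' hHX]
  simp only [Pi.mul_apply]
  have hcont : Continuous fun x => ∫⁻ ω', h (F x ω') ∂P := by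
    refine continuous_iff_seqContinuous.2 fun x x₀ hx => ?_
    refine tendsto_lintegral_of_dominated_convergence (fun _ => (C : ℝ≥0∞))
      (fun n => hh.comp (hF.comp measurable_prodMk_left)) (fun n => ae_of_all _ fun ω => hbd _)
      (by simp) ?_
    filter_upwards [hc] with ω hω
    exact (ENNReal.continuous_coe.comp (h.continuous.comp hω)).continuousAt.tendsto.comp hx
  have hXs : StronglyMeasurable[𝒢] X := hX.stronglyMeasurable
  have hlim : ∀ ω, Filter.Tendsto (fun n => hXs.approx n ω) Filter.atTop (nhds (X ω)) :=
    hXs.tendsto_approx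
  have hXn : ∀ n, Measurable (hXs.approx n) := fun n =>
    (@SimpleFunc.measurable _ _ 𝒢 _ (hXs.approx n)).mono h𝒢 le_rfl
  have hΛt : ∀ᵐ ω ∂P, Λ ω ≠ ⊤ := by
    filter_upwards [ae_lt_top hΛ' hfin] with ω hω using hω.ne
  have lim1 : Filter.Tendsto (fun n => ∫⁻ ω, Λ ω * h (F (hXs.approx n ω) ω) ∂P) Filter.atTop
      (nhds (∫⁻ ω, Λ ω * h (F (X ω) ω) ∂P)) := by
    refine tendsto_lintegral_of_dominated_convergence (fun ω => Λ ω * C)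
      (fun n => hΛ'.mul (hh.comp (hF.comp ((hXn n).prodMk measurable_id))))
      (fun n => ae_of_all _ fun ω => by simp only; gcongr; exact hC _) ?_ ?_
    · rw [lintegral_mul_const _ hΛ']
      exact ENNReal.mul_ne_top hfin (by simp)
    · filter_upwards [hc, hΛt] with ω hω hω'
      refine ENNReal.Tendsto.const_mul ?_ (Or.inr hω')
      exact (ENNReal.continuous_coe.comp (h.continuous.comp hω)).continuousAt.tendsto.comp (hlim ω)
  have lim2 : Filter.Tendsto (fun n => ∫⁻ ω, Λ ω * ∫⁻ ω', h (F (hXs.approx n ω) ω') ∂P ∂P)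
      Filter.atTop (nhds (∫⁻ ω, Λ ω * ∫⁻ ω', h (F (X ω) ω') ∂P ∂P)) := by
    refine tendsto_lintegral_of_dominated_convergence (fun ω => Λ ω * C)
      (fun n => hΛ'.mul (hHm.comp (hXn n)))
      (fun n => ae_of_all _ fun ω => ?_) ?_ ?_
    · simp only
      gcongr
      calc _ ≤ ∫⁻ _, (C : ℝ≥0∞) ∂P := lintegral_mono fun ω' => hbd _
        _ = C := by simp
    · rw [lintegral_mul_const _ hΛ']
      exact ENNReal.mul_ne_top hfin (by simp)
    · filter_upwards [hΛt] with ω hω'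
      refine ENNReal.Tendsto.const_mul ?_ (Or.inr hω')
      exact hcont.continuousAt.tendsto.comp (hlim ω)
  refine tendsto_nhds_unique lim1 (lim2.congr fun n => ?_)
  exact (lintegral_freezing_simpleFunc h𝒢 hF hind (hXs.approx n) hΛ hh).symm

end Freezing

/-! ### Dynamic programming -/

/-- The dynamic programming recursion with `j` remaining dates, started at the date `n`. -/
def dpValue {Ω : Type*} {mΩ : MeasurableSpace Ω} (P : Measure Ω) {D : ℕ} (γ : ℕ → E D → ℝ)
    (f : ℕ → E D → Ω → E D) : ℕ → ℕ → E D → ℝ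
  | 0, n => γ n
  | j + 1, n => fun x => max (γ n x) (∫ ω, dpValue P γ f j (n + 1) (f n x ω) ∂P)

section Growth

variable {Ω : Type*} {mΩ : MeasurableSpace Ω} {P : Measure Ω} {D : ℕ}

/-- `V` has at most linear growth. -/
def LinGrowth (V : E D → ℝ) : Prop := ∃ K : ℝ≥0, ∀ x, ‖V x‖ₑ ≤ K * (1 + ‖x‖ₑ)

theorem LinGrowth.integral [IsProbabilityMeasure P] {V : E D → ℝ} (hV : LinGrowth V)
    {F : E D → Ω → E D} (hG : ∫⁻ ω, growth (fun x => F x ω) ∂P ≠ ⊤) :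
    LinGrowth fun x => ∫ ω, V (F x ω) ∂P := by
  obtain ⟨K, hK⟩ := hV
  set g := ∫⁻ ω, growth (fun x => F x ω) ∂P with hg
  refine ⟨K * (1 + g.toNNReal), fun x => ?_⟩
  calc ‖∫ ω, V (F x ω) ∂P‖ₑ ≤ ∫⁻ ω, ‖V (F x ω)‖ₑ ∂P := enorm_integral_le_lintegral_enorm _
    _ ≤ ∫⁻ ω, K * (1 + (1 + ‖x‖ₑ) * growth (fun x => F x ω)) ∂P := by
        refine lintegral_mono fun ω => (hK _).trans ?_
        gcongr
        rw [mul_comm]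
        exact enorm_le_growth (fun x => F x ω) x
    _ = K * (1 + (1 + ‖x‖ₑ) * g) := by
        rw [lintegral_const_mul' _ _ (by simp), lintegral_add_left measurable_const,
          lintegral_const_mul' _ _ (by simp)]
        simp [hg]
    _ ≤ K * ((1 + ‖x‖ₑ) + (1 + ‖x‖ₑ) * g) := by
        gcongr
        exact le_self_add
    _ = ((K * (1 + g.toNNReal) : ℝ≥0) : ℝ≥0∞) * (1 + ‖x‖ₑ) := by
        push_cast
        rw [ENNReal.coe_toNNReal hG]
        ring

theorem LinGrowth.max {V V' : E D → ℝ} (h : LinGrowth V) (h' : LinGrowth V') :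
    LinGrowth fun x => max (V x) (V' x) := by
  obtain ⟨K, hK⟩ := h
  obtain ⟨K', hK'⟩ := h'
  refine ⟨K + K', fun x => ?_⟩
  push_cast
  rw [add_mul]
  rcases max_choice (V x) (V' x) with h | h <;> rw [h]
  · exact (hK x).trans le_self_add
  · exact (hK' x).trans le_add_self

theorem LinGrowth.integrable [IsFiniteMeasure P] {V : E D → ℝ} (h : LinGrowth V)
    (hV : Measurable V) {Z : Ω → E D} (hZ : Integrable Z P) : Integrable (fun ω => V (Z ω)) P := by
  obtain ⟨K, hK⟩ := h
  refine Integrable.mono' ((((integrable_const (1 : ℝ)).add hZ.norm)).const_mul (K : ℝ))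
    (hV.comp_aemeasurable hZ.aemeasurable).aestronglyMeasurable (ae_of_all _ fun ω => ?_)
  have := ENNReal.toReal_mono (by finiteness) (hK (Z ω))
  rw [ENNReal.toReal_mul, ENNReal.toReal_add (by simp) (by simp)] at this
  simpa using this

end Growth

/-! ### Backward induction for the optimal stopping problem. -/

section Snell

variable {Ω : Type*} {mΩ : MeasurableSpace Ω}

/-- A Markov chain driven by random continuous maps, and payoffs of linear growth. -/
structure StoppingProblem (P : Measure Ω) (𝓕 : Filtration ℕ mΩ) (N : ℕ) {D : ℕ}
    (Z : ℕ → Ω → E D) (γ : ℕ → E D → ℝ) (f : ℕ → E D → Ω → E D) : Prop where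
  adapted : ∀ n ≤ N, Measurable[𝓕 n] (Z n)
  integrable : ∀ n ≤ N, Integrable (Z n) P
  measurable : ∀ n < N, Measurable (Function.uncurry (f n))
  continuous : ∀ n < N, ∀ᵐ ω ∂P, Continuous fun x => f n x ω
  indep : ∀ n < N, ∀ x, Indep (MeasurableSpace.comap (f n x) inferInstance) (𝓕 n) P
  transition : ∀ n < N, ∀ᵐ ω ∂P, Z (n + 1) ω = f n (Z n ω) ω
  growth_ne_top : ∀ n < N, ∫⁻ ω, growth (fun x => f n x ω) ∂P ≠ ⊤
  payoff_measurable : ∀ n ≤ N, Measurable (γ n)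
  payoff_growth : ∀ n ≤ N, LinGrowth (γ n)

/-- A stopping time with values in `{n, …, N}`. -/
def IsRule (𝓕 : Filtration ℕ mΩ) (N n : ℕ) (τ : Ω → ℕ) : Prop :=
  (∀ i, MeasurableSet[𝓕 i] {ω | τ ω ≤ i}) ∧ ∀ ω, n ≤ τ ω ∧ τ ω ≤ N

variable {P : Measure Ω} {𝓕 : Filtration ℕ mΩ} {N : ℕ} {D : ℕ}
  {Z : ℕ → Ω → E D} {γ : ℕ → E D → ℝ} {f : ℕ → E D → Ω → E D}

namespace StoppingProblem

theorem map_eq [IsProbabilityMeasure P] (h : StoppingProblem P 𝓕 N Z γ f) {n : ℕ} (hn : n < N)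
    {Λ : Ω → ℝ≥0∞} (hΛ : Measurable[𝓕 n] Λ) (hfin : ∫⁻ ω, Λ ω ∂P ≠ ⊤) :
    (P.withDensity Λ).map (Z (n + 1))
      = (((P.withDensity Λ).map (Z n)).prod P).map (Function.uncurry (f n)) := by
  rw [← map_freezing (𝓕.le n) (h.measurable n hn) (h.continuous n hn) (h.indep n hn)
    (h.adapted n hn.le) hΛ hfin]
  exact Measure.map_congr ((withDensity_absolutelyContinuous P Λ).ae_le (h.transition n hn))

theorem dpValue_measurable [IsProbabilityMeasure P] (h : StoppingProblem P 𝓕 N Z γ f) :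
    ∀ j n, n + j = N → Measurable (dpValue P γ f j n)
  | 0, n, hn => h.payoff_measurable n (by omega)
  | j + 1, n, hn => by
    refine (h.payoff_measurable n (by omega)).max ?_
    have := (h.dpValue_measurable j (n + 1) (by omega)).comp (h.measurable n (by omega))
    exact (this.stronglyMeasurable.integral_prod_right' (ν := P)).measurable

theorem dpValue_growth [IsProbabilityMeasure P] (h : StoppingProblem P 𝓕 N Z γ f) :
    ∀ j n, n + j = N → LinGrowth (dpValue P γ f j n)
  | 0, n, hn => h.payoff_growth n (by omega)
  | j + 1, n, hn => (h.payoff_growth n (by omega)).max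
      ((h.dpValue_growth j (n + 1) (by omega)).integral (h.growth_ne_top n (by omega)))

theorem dpValue_integrable [IsProbabilityMeasure P] (h : StoppingProblem P 𝓕 N Z γ f) {j n : ℕ}
    (hn : n + j = N) : Integrable (fun ω => dpValue P γ f j n (Z n ω)) P :=
  (h.dpValue_growth j n hn).integrable (h.dpValue_measurable j n hn) (h.integrable n (by omega))

/-- For A in 𝓕 n, the freezing identity with weight 1_A and Fubini's theorem give equal integrals of
both sides over A. -/
theorem condExp_eq [IsProbabilityMeasure P] (h : StoppingProblem P 𝓕 N Z γ f) {n : ℕ} (hn : n < N)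
    {V : E D → ℝ} (hV : Measurable V) (hg : LinGrowth V) :
    P[fun ω => V (Z (n + 1) ω) | 𝓕 n] =ᵐ[P] fun ω => ∫ ω', V (f n (Z n ω) ω') ∂P := by
  have hCm : Measurable fun x => ∫ ω', V (f n x ω') ∂P :=
    ((hV.comp (h.measurable n hn)).stronglyMeasurable.integral_prod_right' (ν := P)).measurable
  have hZ := (h.adapted n hn.le)
  have hZ' : Measurable (Z n) := hZ.mono (𝓕.le n) le_rfl
  have hZ1 : Measurable (Z (n + 1)) := (h.adapted (n + 1) hn).mono (𝓕.le _) le_rfl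
  have hint : Integrable (fun ω => V (Z (n + 1) ω)) P := hg.integrable hV (h.integrable _ hn)
  have hCint : Integrable (fun ω => ∫ ω', V (f n (Z n ω) ω') ∂P) P :=
    (hg.integral (h.growth_ne_top n hn)).integrable hCm (h.integrable n hn.le)
  symm
  refine ae_eq_condExp_of_forall_setIntegral_eq (𝓕.le n) hint (fun _ _ _ => hCint.integrableOn)
    (fun A hA _ => ?_) (hCm.comp hZ).stronglyMeasurable.aestronglyMeasurable
  have hA' : MeasurableSet A := 𝓕.le n A hA
  have hone : Measurable[𝓕 n] (1 : Ω → ℝ≥0∞) := @measurable_const _ _ _ (𝓕 n) 1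
  have hmap := h.map_eq hn (Λ := A.indicator 1) (hone.indicator hA) (by
    rw [lintegral_indicator_one hA']
    exact measure_ne_top _ _)
  rw [withDensity_indicator_one hA'] at hmap
  have hint' : Integrable V ((P.restrict A).map (Z (n + 1))) := by
    rw [integrable_map_measure hV.aestronglyMeasurable hZ1.aemeasurable]
    exact hint.integrableOn
  calc ∫ ω in A, ∫ ω', V (f n (Z n ω) ω') ∂P ∂P
      = ∫ x, ∫ ω', V (f n x ω') ∂P ∂((P.restrict A).map (Z n)) := by
        rw [integral_map hZ'.aemeasurable hCm.aestronglyMeasurable]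
    _ = ∫ z, V (Function.uncurry (f n) z) ∂(((P.restrict A).map (Z n)).prod P) := by
        rw [integral_prod]
        · rfl
        · rw [hmap, integrable_map_measure hV.aestronglyMeasurable
            (h.measurable n hn).aemeasurable] at hint'
          exact hint'
    _ = ∫ ω in A, V (Z (n + 1) ω) ∂P := by
        rw [← integral_map (h.measurable n hn).aemeasurable hV.aestronglyMeasurable, ← hmap,
          integral_map hZ1.aemeasurable hV.aestronglyMeasurable]

theorem reward_integrable [IsProbabilityMeasure P] (h : StoppingProblem P 𝓕 N Z γ f) {n : ℕ}
    {τ : Ω → ℕ} (hτ : IsRule 𝓕 N n τ) : Integrable (fun ω => γ (τ ω) (Z (τ ω) ω)) P := by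
  have hm : ∀ k, MeasurableSet {ω | τ ω = k} := by
    intro k
    have hle : ∀ i, MeasurableSet {ω | τ ω ≤ i} := fun i => 𝓕.le i _ (hτ.1 i)
    have hτm : Measurable τ := measurable_of_Iic fun i => hle i
    exact hτm (measurableSet_singleton k)
  have heq : (fun ω => γ (τ ω) (Z (τ ω) ω)) = fun ω => ∑ k ∈ Finset.range (N + 1),
      {ω | τ ω = k}.indicator (fun ω => γ k (Z k ω)) ω := by
    funext ω
    rw [Finset.sum_eq_single (τ ω)]
    · simp
    · intro k _ hk
      rw [Set.indicator_of_notMem]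
      exact fun h => hk h.symm
    · intro h'
      have := (hτ.2 ω).2
      simp at h'
      omega
  rw [heq]
  refine integrable_finsetSum _ fun k hk => Integrable.indicator ?_ (hm k)
  have hkN : k ≤ N := by
    have := Finset.mem_range.1 hk
    omega
  exact (h.payoff_growth k hkN).integrable (h.payoff_measurable k hkN) (h.integrable k hkN)

/-- Stopping at `n` on the event `A`, and following `τ` otherwise. -/
theorem isRule_ite {n : ℕ} (hn : n < N) {τ : Ω → ℕ} (hτ : IsRule 𝓕 N (n + 1) τ) {A : Set Ω}
    [DecidablePred (· ∈ A)] (hA : MeasurableSet[𝓕 n] A) :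
    IsRule 𝓕 N n (fun ω => if ω ∈ A then n else τ ω) := by
  refine ⟨fun i => ?_, fun ω => ?_⟩
  · by_cases hi : n ≤ i
    · have : {ω | (if ω ∈ A then n else τ ω) ≤ i} = A ∪ {ω | τ ω ≤ i} := by
        ext ω
        by_cases hω : ω ∈ A <;> simp [hω, hi]
      rw [this]
      exact (𝓕.mono hi A hA).union (hτ.1 i)
    · have : {ω | (if ω ∈ A then n else τ ω) ≤ i} = ∅ := by
        ext ω
        have := (hτ.2 ω).1
        by_cases hω : ω ∈ A <;> simp [hω] <;> omega
      rw [this]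
      exact @MeasurableSet.empty _ (𝓕 i)
  · have := hτ.2 ω
    simp only
    split_ifs <;> omega

/-- On A the reward is known at time n; off A the tower property applies. The event is {τ ≤ n} in
the upper bound and {continuation value ≤ payoff} for the optimal rule. -/
theorem condExp_reward_ite [IsProbabilityMeasure P] (h : StoppingProblem P 𝓕 N Z γ f) {n : ℕ}
    (hn : n < N) {τ ρ : Ω → ℕ} (hτ : IsRule 𝓕 N (n + 1) τ) {A : Set Ω}
    (hA : MeasurableSet[𝓕 n] A) (h1 : ∀ ω ∈ A, ρ ω = n) (h2 : ∀ ω ∉ A, ρ ω = τ ω) :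
    P[fun ω => γ (ρ ω) (Z (ρ ω) ω) | 𝓕 n] =ᵐ[P] A.indicator (fun ω => γ n (Z n ω))
      + Aᶜ.indicator (P[P[fun ω => γ (τ ω) (Z (τ ω) ω) | 𝓕 (n + 1)] | 𝓕 n]) := by
  have hA' : MeasurableSet A := 𝓕.le n A hA
  have heq : (fun ω => γ (ρ ω) (Z (ρ ω) ω)) = A.indicator (fun ω => γ n (Z n ω))
      + Aᶜ.indicator (fun ω => γ (τ ω) (Z (τ ω) ω)) := by
    funext ω
    by_cases hω : ω ∈ A
    · simp [hω, h1 ω hω]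
    · simp [hω, h2 ω hω]
  have hi1 : Integrable (A.indicator (fun ω => γ n (Z n ω))) P :=
    ((h.payoff_growth n hn.le).integrable (h.payoff_measurable n hn.le)
      (h.integrable n hn.le)).indicator hA'
  have hi2 := h.reward_integrable hτ
  rw [heq]
  have e1 : P[A.indicator (fun ω => γ n (Z n ω)) | 𝓕 n] = A.indicator (fun ω => γ n (Z n ω)) :=
    condExp_of_stronglyMeasurable (𝓕.le n)
      ((((h.payoff_measurable n hn.le).comp (h.adapted n hn.le)).stronglyMeasurable).indicator hA)
      hi1
  refine (condExp_add hi1 (hi2.indicator hA'.compl) (𝓕 n)).trans ?_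
  rw [e1]
  filter_upwards [condExp_indicator (m := 𝓕 n) hi2 hA.compl,
    condExp_condExp_of_le (μ := P) (f := fun ω => γ (τ ω) (Z (τ ω) ω)) (𝓕.mono n.le_succ)
      (𝓕.le (n + 1))] with ω hω hω'
  rw [Pi.add_apply, Pi.add_apply, hω]
  congr 1
  by_cases hωA : ω ∈ Aᶜ
  · rw [Set.indicator_of_mem hωA, Set.indicator_of_mem hωA, hω']
  · rw [Set.indicator_of_notMem hωA, Set.indicator_of_notMem hωA]

/-- A rule from n either stops at once, which earns the payoff, or follows a rule from n + 1, which
by induction earns at most the continuation value. -/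
theorem condExp_reward_le [IsProbabilityMeasure P] (h : StoppingProblem P 𝓕 N Z γ f) :
    ∀ j n, n + j = N → ∀ τ, IsRule 𝓕 N n τ →
      P[fun ω => γ (τ ω) (Z (τ ω) ω) | 𝓕 n] ≤ᵐ[P] fun ω => dpValue P γ f j n (Z n ω)
  | 0, n, hn, τ, hτ => by
    have hτn : ∀ ω, τ ω = n := fun ω => by
      have := hτ.2 ω
      omega
    have hn' : n ≤ N := by omega
    simp only [hτn]
    rw [condExp_of_stronglyMeasurable (f := fun ω => γ n (Z n ω)) (𝓕.le n)
      (((h.payoff_measurable n hn').comp (h.adapted n hn')).stronglyMeasurable)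
      ((h.payoff_growth n hn').integrable (h.payoff_measurable n hn') (h.integrable n hn'))]
    exact Filter.EventuallyLE.rfl
  | j + 1, n, hn, τ, hτ => by
    have hnN : n < N := by omega
    -- The modified rule agrees with `τ` on {τ > n}, the only event where it is used.
    have hτ' : IsRule 𝓕 N (n + 1) (fun ω => max (τ ω) (n + 1)) := by
      refine ⟨fun i => ?_, fun ω => ?_⟩
      · by_cases hi : n + 1 ≤ i
        · have : {ω | max (τ ω) (n + 1) ≤ i} = {ω | τ ω ≤ i} := by
            ext ω
            simp [hi]
          rw [this]
          exact hτ.1 i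
        · have : {ω | max (τ ω) (n + 1) ≤ i} = ∅ := by
            ext ω
            simp
            omega
          rw [this]
          exact @MeasurableSet.empty _ (𝓕 i)
      · have := hτ.2 ω
        simp only
        omega
    have hV := h.dpValue_measurable j (n + 1) (by omega)
    have hg := h.dpValue_growth j (n + 1) (by omega)
    have ih := h.condExp_reward_le j (n + 1) (by omega) _ hτ'
    have hmono := condExp_mono (m := 𝓕 n) integrable_condExp
      (h.dpValue_integrable (j := j) (n := n + 1) (by omega)) ih
    filter_upwards [h.condExp_reward_ite hnN hτ' (ρ := τ) (hτ.1 n)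
      (fun ω hω => le_antisymm hω (hτ.2 ω).1)
      (fun ω hω => by
        have : ¬ τ ω ≤ n := hω
        omega), hmono, h.condExp_eq hnN hV hg] with ω h1 h2 h3
    rw [h1, Pi.add_apply, dpValue]
    by_cases hω : ω ∈ {ω | τ ω ≤ n}
    · rw [Set.indicator_of_mem hω, Set.indicator_of_notMem (by simpa using hω), add_zero]
      exact le_max_left _ _
    · rw [Set.indicator_of_notMem hω, Set.indicator_of_mem (by simpa using hω), zero_add]
      exact (h2.trans h3.le).trans (le_max_right _ _)

/-- Stopping as soon as the payoff is at least the continuation value turns the upper bound into an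
equality, so the essential supremum is attained. -/
theorem exists_optimal [IsProbabilityMeasure P] (h : StoppingProblem P 𝓕 N Z γ f) :
    ∀ j n, n + j = N → ∃ τ, IsRule 𝓕 N n τ ∧
      P[fun ω => γ (τ ω) (Z (τ ω) ω) | 𝓕 n] =ᵐ[P] fun ω => dpValue P γ f j n (Z n ω)
  | 0, n, hn => by
    have hn' : n ≤ N := by omega
    refine ⟨fun _ => n, ⟨fun i => @MeasurableSet.const _ (𝓕 i) _, fun ω => ⟨le_rfl, hn'⟩⟩, ?_⟩
    rw [condExp_of_stronglyMeasurable (f := fun ω => γ n (Z n ω)) (𝓕.le n)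
      (((h.payoff_measurable n hn').comp (h.adapted n hn')).stronglyMeasurable)
      ((h.payoff_growth n hn').integrable (h.payoff_measurable n hn') (h.integrable n hn'))]
    exact Filter.EventuallyEq.rfl
  | j + 1, n, hn => by
    classical
    have hnN : n < N := by omega
    obtain ⟨τ, hτ, hopt⟩ := h.exists_optimal j (n + 1) (by omega)
    have hV := h.dpValue_measurable j (n + 1) (by omega)
    have hg := h.dpValue_growth j (n + 1) (by omega)
    have hCm : Measurable fun x => ∫ ω', dpValue P γ f j (n + 1) (f n x ω') ∂P :=
      ((hV.comp (h.measurable n hnN)).stronglyMeasurable.integral_prod_right' (ν := P)).measurable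
    let A : Set Ω := Z n ⁻¹' {x | ∫ ω', dpValue P γ f j (n + 1) (f n x ω') ∂P ≤ γ n x}
    have hA : MeasurableSet[𝓕 n] A :=
      h.adapted n hnN.le (measurableSet_le hCm (h.payoff_measurable n hnN.le))
    refine ⟨_, isRule_ite hnN hτ hA, ?_⟩
    filter_upwards [h.condExp_reward_ite hnN hτ hA (fun ω hω => if_pos hω)
      (fun ω hω => if_neg hω), condExp_congr_ae (m := 𝓕 n) hopt, h.condExp_eq hnN hV hg]
      with ω h1 h2 h3
    rw [h1, Pi.add_apply, dpValue]
    by_cases hω : ω ∈ A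
    · rw [Set.indicator_of_mem hω, Set.indicator_of_notMem (by simpa using hω), add_zero]
      exact (max_eq_left hω).symm
    · rw [Set.indicator_of_notMem hω, Set.indicator_of_mem (by simpa using hω), zero_add, h2, h3]
      exact (max_eq_right (not_le.1 hω).le).symm

end StoppingProblem

end Snell

/-! ### Moments -/

theorem lintegral_Lp_sum_le {Ω ι : Type*} {mΩ : MeasurableSpace Ω} {μ : Measure Ω} {s : ℝ}
    (hs : 1 ≤ s) (I : Finset ι) (u : ι → Ω → ℝ≥0∞) (hu : ∀ i, AEMeasurable (u i) μ) :
    (∫⁻ ω, (∑ i ∈ I, u i ω) ^ s ∂μ) ^ (1 / s) ≤ ∑ i ∈ I, (∫⁻ ω, u i ω ^ s ∂μ) ^ (1 / s) := by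
  classical
  have hs0 : 0 < s := by linarith
  induction I using Finset.induction_on with
  | empty => simp [hs0]
  | insert i I hi ih =>
    simp only [Finset.sum_insert hi]
    refine (ENNReal.lintegral_Lp_add_le (f := u i) (g := fun ω => ∑ i ∈ I, u i ω) (hu i)
      (Finset.aemeasurable_fun_sum I fun i _ => hu i) hs).trans ?_
    gcongr

theorem enorm_sq_eq_sum {D : ℕ} (x : E D) : ‖x‖ₑ ^ 2 = ∑ i, ‖x i‖ₑ ^ 2 := by
  have h : ∀ {F : Type} [NormedAddCommGroup F] (y : F), ‖y‖ₑ ^ 2 = ENNReal.ofReal (‖y‖ ^ 2) := by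
    intro F _ y
    rw [ENNReal.ofReal_pow (norm_nonneg _), ofReal_norm]
  simp only [h]
  rw [← ENNReal.ofReal_sum_of_nonneg fun i _ => by positivity, EuclideanSpace.norm_sq_eq]

/-- The `L^s` norm of the square of a standard Gaussian variable. -/
def gaussSqNorm (s : ℝ) : ℝ≥0∞ := (∫⁻ y, (‖y‖ₑ ^ 2) ^ s ∂gaussianReal 0 1) ^ (1 / s)

theorem gaussSqNorm_ne_top {s : ℝ} (hs : 1 ≤ s) : gaussSqNorm s ≠ ⊤ := by
  have hs0 : 0 < s := by linarith
  have h := memLp_id_gaussianReal (μ := 0) (v := 1) (2 * s).toNNReal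
  have h2 : (((2 * s).toNNReal : ℝ≥0∞)).toReal = 2 * s := by
    rw [ENNReal.coe_toReal, Real.coe_toNNReal _ (by positivity)]
  have hlt := lintegral_rpow_enorm_lt_top_of_eLpNorm_lt_top (by simp; positivity) (by simp) h.2
  rw [h2] at hlt
  refine ENNReal.rpow_ne_top_of_nonneg (by positivity) ?_
  refine ne_of_lt (lt_of_le_of_lt (le_of_eq (lintegral_congr fun y => ?_)) hlt)
  rw [← ENNReal.rpow_natCast, ← ENNReal.rpow_mul]
  simp

theorem lintegral_gaussianReal_sq {s : ℝ} (hs : 1 ≤ s) (v : ℝ≥0) :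
    (∫⁻ y, (‖y‖ₑ ^ 2) ^ s ∂gaussianReal 0 v) ^ (1 / s) = v * gaussSqNorm s := by
  have hs0 : 0 < s := by linarith
  have hmap : (gaussianReal 0 1).map (fun y => (NNReal.sqrt v : ℝ) * y) = gaussianReal 0 v := by
    rw [gaussianReal_map_const_mul]
    congr 1
    · simp
    · ext
      simp
  rw [← hmap, lintegral_map (by fun_prop) (by fun_prop), gaussSqNorm]
  have h1 : ∀ y : ℝ, (‖(NNReal.sqrt v : ℝ) * y‖ₑ ^ 2) ^ s = (v : ℝ≥0∞) ^ s * (‖y‖ₑ ^ 2) ^ s := by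
    intro y
    rw [enorm_mul, mul_pow, ENNReal.mul_rpow_of_nonneg _ _ hs0.le]
    congr 2
    have : ‖((NNReal.sqrt v : ℝ≥0) : ℝ)‖ₑ = (NNReal.sqrt v : ℝ≥0∞) := by
      rw [Real.enorm_eq_ofReal (by positivity), ENNReal.ofReal_coe_nnreal]
    rw [this, ← ENNReal.coe_pow, NNReal.sq_sqrt]
  simp only [h1]
  rw [lintegral_const_mul _ (by fun_prop), ENNReal.mul_rpow_of_nonneg _ _ (by positivity),
    ← ENNReal.rpow_mul, mul_one_div_cancel hs0.ne', ENNReal.rpow_one]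

/-- Each coordinate is a centred Gaussian of variance v. Minkowski's inequality for the D squares
then gives a bound linear in D. -/
theorem lintegral_multivariateGaussian_sq_le {Ω : Type*} {mΩ : MeasurableSpace Ω} {P : Measure Ω}
    {D : ℕ} {s : ℝ} (hs : 1 ≤ s) {Y : Ω → E D} {v : ℝ} (hv : 0 ≤ v)
    (hY : HasLaw Y (multivariateGaussian 0 (v • 1)) P) :
    (∫⁻ ω, (‖Y ω‖ₑ ^ 2) ^ s ∂P) ^ (1 / s) ≤ D * (ENNReal.ofReal v * gaussSqNorm s) := by
  have hpsd : (v • (1 : Matrix (Fin D) (Fin D) ℝ)).PosSemidef := Matrix.PosSemidef.one.smul hv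
  simp only [enorm_sq_eq_sum]
  have hYm := hY.aemeasurable
  refine (lintegral_Lp_sum_le hs _ (fun i ω => ‖Y ω i‖ₑ ^ 2) fun i => ?_).trans ?_
  · have : Measurable fun y : E D => ‖y i‖ₑ ^ 2 := by fun_prop
    exact this.comp_aemeasurable hYm
  · have h1 : ∀ i, (∫⁻ ω, (‖Y ω i‖ₑ ^ 2) ^ s ∂P) ^ (1 / s) = ENNReal.ofReal v * gaussSqNorm s := by
      intro i
      have hm := measurePreserving_eval_multivariateGaussian (μ := (0 : E D)) hpsd (i := i)
      have hmeas : Measurable fun y : ℝ => (‖y‖ₑ ^ 2) ^ s := by fun_prop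
      have e1 : ∫⁻ ω, (‖Y ω i‖ₑ ^ 2) ^ s ∂P = ∫⁻ y, (‖y‖ₑ ^ 2) ^ s ∂gaussianReal 0 v.toNNReal := by
        have e2 : gaussianReal 0 v.toNNReal = (multivariateGaussian 0 (v • 1)).map
            (fun x : E D => x i) := by
          rw [hm.map_eq]
          simp
        rw [e2, ← hY.map_eq, lintegral_map hmeas (by fun_prop),
          lintegral_map' (by fun_prop) hYm]
      rw [e1, lintegral_gaussianReal_sq hs]
      rfl
    rw [Finset.sum_congr rfl fun i _ => h1 i]
    simp

/-- Moments of the image of a measure under a random map of linear growth. -/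
theorem lintegral_map_uncurry_le {Ω : Type*} {mΩ : MeasurableSpace Ω} {P : Measure Ω}
    [IsProbabilityMeasure P] {D : ℕ} {F : E D → Ω → E D} (hF : Measurable (Function.uncurry F))
    (ν : Measure (E D)) [SFinite ν] {p : ℝ} (hp : 0 ≤ p) :
    ∫⁻ x, (1 + ‖x‖ₑ) ^ p ∂((ν.prod P).map (Function.uncurry F))
      ≤ (∫⁻ ω, (1 + growth fun x => F x ω) ^ p ∂P) * ∫⁻ x, (1 + ‖x‖ₑ) ^ p ∂ν := by
  have hm : Measurable fun x : E D => (1 + ‖x‖ₑ) ^ p := by fun_prop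
  rw [lintegral_map hm hF, lintegral_prod _ (by fun_prop)]
  calc _ ≤ ∫⁻ x, ∫⁻ ω, (1 + ‖x‖ₑ) ^ p * (1 + growth fun x => F x ω) ^ p ∂P ∂ν := by
        refine lintegral_mono fun x => lintegral_mono fun ω => ?_
        rw [← ENNReal.mul_rpow_of_nonneg _ _ hp]
        gcongr
        calc 1 + ‖F x ω‖ₑ ≤ (1 + ‖x‖ₑ) + growth (fun x => F x ω) * (1 + ‖x‖ₑ) := by
              gcongr
              · exact le_self_add
              · exact enorm_le_growth (fun x => F x ω) x
          _ = _ := by ring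
    _ = ∫⁻ x, (1 + ‖x‖ₑ) ^ p * ∫⁻ ω, (1 + growth fun x => F x ω) ^ p ∂P ∂ν := by
        refine lintegral_congr fun x => lintegral_const_mul' _ _ ?_
        exact ENNReal.rpow_ne_top_of_nonneg hp (by simp)
    _ = _ := by
        rw [lintegral_mul_const _ hm, mul_comm]

theorem lintegral_one_add_rpow_le {Ω : Type*} {mΩ : MeasurableSpace Ω} {P : Measure Ω}
    [IsProbabilityMeasure P] {G : Ω → ℝ≥0∞} (hG : AEMeasurable G P) {p : ℝ} (hp : 1 ≤ p)
    {b : ℝ≥0∞} (h : (∫⁻ ω, G ω ^ p ∂P) ^ (1 / p) ≤ b) :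
    ∫⁻ ω, (1 + G ω) ^ p ∂P ≤ (1 + b) ^ p := by
  have hp0 : 0 < p := by linarith
  have := ENNReal.lintegral_Lp_add_le (μ := P) (f := fun _ => 1) (g := G) aemeasurable_const hG hp
  rw [← ENNReal.rpow_le_rpow_iff (z := 1 / p) (by positivity), ← ENNReal.rpow_mul,
    mul_one_div_cancel hp0.ne', ENNReal.rpow_one]
  refine this.trans ?_
  gcongr
  simp

/-- The mean is bounded by the `L^p` norm. -/
theorem lintegral_le_of_rpow_le {Ω : Type*} {mΩ : MeasurableSpace Ω} {P : Measure Ω}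
    [IsProbabilityMeasure P] {G : Ω → ℝ≥0∞} (hG : AEMeasurable G P) {p : ℝ} (hp : 1 < p)
    {b : ℝ≥0∞} (h : (∫⁻ ω, G ω ^ p ∂P) ^ (1 / p) ≤ b) : ∫⁻ ω, G ω ∂P ≤ b := by
  have := ENNReal.lintegral_mul_le_Lp_mul_Lq P (Real.HolderConjugate.conjExponent hp) hG
    (aemeasurable_const (b := (1 : ℝ≥0∞)))
  simp only [Pi.mul_apply, mul_one, ENNReal.one_rpow, lintegral_const, measure_univ] at this
  exact this.trans h

/-! ### Consequences of the structural assumptions -/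

section Dynamic

variable {Ω : Type*} {mΩ : MeasurableSpace Ω} {P : Measure Ω}
  {ℱ : Filtration ℝ≥0 mΩ} {T : ℝ≥0} {N : ℕ} {p c q : ℝ} {D : ℕ} {x₀ : E D}
  {X : ℝ≥0 → Ω → E D} {f : ℕ → E D → Ω → E D}

namespace DynamicAssumptionWith

theorem measurable_uncurry (h : DynamicAssumptionWith P ℱ T N p c q x₀ X f) {n : ℕ} (hn : n < N) :
    Measurable (Function.uncurry (f n)) :=
  (h.measurable n hn).mono (sup_le_sup le_rfl (MeasurableSpace.comap_mono (ℱ.le _))) le_rfl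

/-- This extracts from the random network what the approximation needs: a measurable size with
bounded mean, and for almost every ω a program of twice that length. -/
theorem exists_size (h : DynamicAssumptionWith P ℱ T N p c q x₀ X f) {n : ℕ} (hn : n < N) :
    ∃ s : Ω → ℝ≥0∞, Measurable s ∧ ∫⁻ ω, s ω ∂P ≤ ENNReal.ofReal (c * (D : ℝ) ^ q) ∧
      ∀ᵐ ω ∂P, ∃ k : ℕ, s ω = k ∧ ∃ L, Build (coordBase D) (2 * k) L ∧
        ∀ j, (fun x => f n x ω j) ∈ L := by
  obtain ⟨k, θ, hθ, -, heq, hsize⟩ := h.random_net n hn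
  refine ⟨fun ω => (θ ω).size, measurable_size hθ, hsize, ?_⟩
  filter_upwards [heq, ae_lt_top (measurable_size hθ)
    (ne_top_of_le_ne_top ENNReal.ofReal_ne_top hsize)] with ω hω hlt
  have hne : (θ ω).size ≠ ⊤ := by
    intro h
    simp [h] at hlt
  obtain ⟨m, hm⟩ := ENat.ne_top_iff_exists.1 hne
  refine ⟨m, by simp [← hm], ?_⟩
  obtain ⟨L, hL, hmem⟩ := (θ ω).exists_build hm.symm
  refine ⟨L, hL, fun j => ?_⟩
  simp only [hω]
  exact hmem j

theorem ae_continuous (h : DynamicAssumptionWith P ℱ T N p c q x₀ X f) {n : ℕ} (hn : n < N) :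
    ∀ᵐ ω ∂P, Continuous fun x => f n x ω := by
  obtain ⟨s, -, -, hs⟩ := h.exists_size hn
  filter_upwards [hs] with ω hω
  obtain ⟨k, -, L, hL, hmem⟩ := hω
  have : Continuous fun x => (f n x ω).ofLp :=
    continuous_pi fun j => hL.continuous continuous_of_mem_coordBase _ (hmem j)
  exact (PiLp.continuous_toLp 2 _).comp this

theorem aemeasurable_growth (h : DynamicAssumptionWith P ℱ T N p c q x₀ X f) {n : ℕ}
    (hn : n < N) : AEMeasurable (fun ω => growth fun x => f n x ω) P :=
  DeepMartingale.aemeasurable_growth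
    (fun _ => (h.measurable_uncurry hn).comp measurable_prodMk_left) (h.ae_continuous hn)

theorem lintegral_growth_le [IsProbabilityMeasure P]
    (h : DynamicAssumptionWith P ℱ T N p c q x₀ X f) (hp : 1 < p) {n : ℕ}
    (hn : n < N) : ∫⁻ ω, growth (fun x => f n x ω) ∂P ≤ ENNReal.ofReal (c * (D : ℝ) ^ q) :=
  lintegral_le_of_rpow_le (h.aemeasurable_growth hn) hp (h.growth_le n hn)

theorem map_eq [IsProbabilityMeasure P]
    (h : DynamicAssumptionWith P ℱ T N p c q x₀ X f) {n : ℕ} (hn : n < N)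
    {Λ : Ω → ℝ≥0∞} (hΛ : Measurable[ℱ (date T N n)] Λ) (hfin : ∫⁻ ω, Λ ω ∂P ≠ ⊤) :
    (P.withDensity Λ).map (X (date T N (n + 1)))
      = (((P.withDensity Λ).map (X (date T N n))).prod P).map (Function.uncurry (f n)) := by
  rw [← map_freezing (ℱ.le _) (h.measurable_uncurry hn) (h.ae_continuous hn) (h.indep n hn)
    (h.adapted n hn.le) hΛ hfin]
  exact Measure.map_congr ((withDensity_absolutelyContinuous P Λ).ae_le (h.transition n hn))

theorem measurable_state (h : DynamicAssumptionWith P ℱ T N p c q x₀ X f) {n : ℕ} (hn : n ≤ N) :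
    Measurable (X (date T N n)) := (h.adapted n hn).mono (ℱ.le _) le_rfl

/-- The bound 1 + ‖f_n(x)‖ ≤ (1 + Growth(f_n)) (1 + ‖x‖) together with the product form of the law
makes L^p norms multiply. Each transition contributes a factor 1 + c D^q, and so does the initial
state. -/
theorem lintegral_state_le [IsProbabilityMeasure P]
    (h : DynamicAssumptionWith P ℱ T N p c q x₀ X f) (hp : 1 < p) :
    ∀ n ≤ N, ∫⁻ ω, (1 + ‖X (date T N n) ω‖ₑ) ^ p ∂P
      ≤ ((1 + ENNReal.ofReal (c * (D : ℝ) ^ q)) ^ (n + 1)) ^ p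
  | 0, _ => by
    have h0 : date T N 0 = 0 := by simp [date]
    rw [h0, lintegral_congr_ae (g := fun _ => (1 + ‖x₀‖ₑ) ^ p)]
    · simp only [lintegral_const, measure_univ, mul_one, zero_add, pow_one]
      gcongr
      rw [← ofReal_norm]
      exact ENNReal.ofReal_le_ofReal h.initial_le
    · filter_upwards [h.initial] with ω hω
      rw [hω]
  | n + 1, hn => by
    have hn' : n < N := hn
    have ih := h.lintegral_state_le hp n hn'.le
    have hone : Measurable[ℱ (date T N n)] (1 : Ω → ℝ≥0∞) := @measurable_const _ _ _ (ℱ _) 1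
    have hmap := h.map_eq hn' hone (by simp)
    rw [withDensity_one] at hmap
    have hm : Measurable fun x : E D => (1 + ‖x‖ₑ) ^ p := by fun_prop
    rw [← lintegral_map hm (h.measurable_state hn), hmap]
    refine (lintegral_map_uncurry_le (h.measurable_uncurry hn') _ (by linarith)).trans ?_
    rw [lintegral_map hm (h.measurable_state hn'.le)]
    calc _ ≤ (1 + ENNReal.ofReal (c * (D : ℝ) ^ q)) ^ p
          * ((1 + ENNReal.ofReal (c * (D : ℝ) ^ q)) ^ (n + 1)) ^ p := by
          gcongr
          exact lintegral_one_add_rpow_le (h.aemeasurable_growth hn') hp.le (h.growth_le n hn')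
      _ = _ := by
          rw [← ENNReal.mul_rpow_of_nonneg _ _ (by linarith), ← pow_succ']

theorem integrable_state [IsProbabilityMeasure P]
    (h : DynamicAssumptionWith P ℱ T N p c q x₀ X f) (hp : 1 < p) {n : ℕ}
    (hn : n ≤ N) : Integrable (X (date T N n)) P := by
  refine ⟨(h.measurable_state hn).aestronglyMeasurable, ?_⟩
  have hm := h.measurable_state hn
  have h1 : ∫⁻ ω, (1 + ‖X (date T N n) ω‖ₑ) ∂P
      ≤ (1 + ENNReal.ofReal (c * (D : ℝ) ^ q)) ^ (n + 1) := by
    refine lintegral_le_of_rpow_le (by fun_prop) hp ?_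
    rw [one_div, ENNReal.rpow_inv_le_iff (by linarith)]
    exact h.lintegral_state_le hp n hn
  refine lt_of_le_of_lt (lintegral_mono fun ω => le_add_self) (lt_of_le_of_lt h1 ?_)
  finiteness

end DynamicAssumptionWith

end Dynamic

/-! ### Regularity of the payoff. -/

section Payoff

variable {T : ℝ≥0} {N : ℕ} {c q r : ℝ} {D : ℕ} {g : ℝ≥0 → E D → ℝ}

/-- The approximating networks share one Lipschitz constant, which passes to their pointwise limit.
-/
theorem PayoffAssumption.lipschitz (h : PayoffAssumption T N c q r g) (hb : 0 ≤ c * (D : ℝ) ^ q)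
    {n : ℕ} (hn : n ≤ N) :
    LipschitzWith (c * (D : ℝ) ^ q).toNNReal (g (date T N n)) := by
  refine LipschitzWith.of_dist_le_mul fun x y => ?_
  rw [Real.coe_toNNReal _ hb]
  set b := c * (D : ℝ) ^ q with hbdef
  refine le_of_forall_pos_le_add fun δ hδ => ?_
  set K := b * (1 + ‖x‖) + b * (1 + ‖y‖) with hK
  have hK0 : 0 ≤ K := by positivity
  -- The errors at `x` and `y` add up to the accuracy times `K`; the summand 1 keeps the denominator
  -- positive when `K` vanishes.
  obtain ⟨φ, -, h1, -, h2, -⟩ := h (δ / (K + 1)) (by positivity) n hn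
  have hx := h1 x
  have hy := h1 y
  have hl := h2.dist_le_mul x y
  rw [Real.coe_toNNReal _ hb] at hl
  rw [Real.dist_eq] at hl ⊢
  have hK1 : δ / (K + 1) * K ≤ δ := by
    rw [div_mul_eq_mul_div, div_le_iff₀ (by positivity)]
    nlinarith
  have e1 : δ / (K + 1) * c * (D : ℝ) ^ q * (1 + ‖x‖) + δ / (K + 1) * c * (D : ℝ) ^ q * (1 + ‖y‖)
      = δ / (K + 1) * K := by
    rw [hK, hbdef]
    ring
  rw [abs_le] at hx hy hl ⊢
  constructor <;> linarith [hx.1, hx.2, hy.1, hy.2, hl.1, hl.2]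

theorem PayoffAssumption.abs_le (h : PayoffAssumption T N c q r g) (hb : 0 ≤ c * (D : ℝ) ^ q)
    {n : ℕ} (hn : n ≤ N) (x : E D) :
    |g (date T N n) x| ≤ c * (D : ℝ) ^ q * (1 + ‖x‖) := by
  obtain ⟨-, -, -, -, -, h0⟩ := h 1 one_pos n hn
  have hl := (h.lipschitz hb hn).dist_le_mul x 0
  rw [Real.coe_toNNReal _ hb, Real.dist_eq, dist_zero_right] at hl
  rw [_root_.abs_le] at h0 hl ⊢
  constructor <;> nlinarith [h0.1, h0.2, hl.1, hl.2]

theorem PayoffAssumption.linGrowth (h : PayoffAssumption T N c q r g)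
    (hb : 0 ≤ c * (D : ℝ) ^ q) {n : ℕ} (hn : n ≤ N) : LinGrowth (g (date T N n)) := by
  refine ⟨(c * (D : ℝ) ^ q).toNNReal, fun x => ?_⟩
  rw [Real.enorm_eq_ofReal_abs]
  refine (ENNReal.ofReal_le_ofReal (h.abs_le hb hn x)).trans (le_of_eq ?_)
  rw [ENNReal.ofReal_mul hb, ENNReal.ofReal_add (by positivity) (by positivity), ofReal_norm]
  simp [ENNReal.ofReal]

end Payoff

/-! ### Identification of the value function. -/

section ValueFunction

variable {Ω : Type*} {mΩ : MeasurableSpace Ω} {P : Measure Ω}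
  {ℱ : Filtration ℝ≥0 mΩ} {T : ℝ≥0} {N : ℕ} {p c q r : ℝ} {D : ℕ} {x₀ : E D}
  {X : ℝ≥0 → Ω → E D} {f : ℕ → E D → Ω → E D} {g : ℝ≥0 → E D → ℝ}

theorem stoppingProblem [IsProbabilityMeasure P] (h : DynamicAssumptionWith P ℱ T N p c q x₀ X f)
    (hg : PayoffAssumption T N c q r g) (hp : 1 < p) (hb : 0 ≤ c * (D : ℝ) ^ q) :
    StoppingProblem P (disFiltration ℱ T N) N (fun n => X (date T N n))
      (fun n => g (date T N n)) f where
  adapted := h.adapted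
  integrable _ hn := h.integrable_state hp hn
  measurable _ hn := h.measurable_uncurry hn
  continuous _ hn := h.ae_continuous hn
  indep := h.indep
  transition := h.transition
  growth_ne_top _ hn := ne_top_of_le_ne_top ENNReal.ofReal_ne_top (h.lintegral_growth_le hp hn)
  payoff_measurable _ hn := (hg.lipschitz hb hn).continuous.measurable
  payoff_growth _ hn := hg.linGrowth hb hn

theorem isStoppingRule_iff {n : ℕ} {τ : Ω → ℕ} :
    IsStoppingRule ℱ T N n τ ↔ IsRule (disFiltration ℱ T N) N n τ := by
  simp only [IsStoppingRule, IsRule, IsStoppingTime]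
  simp

theorem isValueFunction_dpValue [IsProbabilityMeasure P]
    (h : DynamicAssumptionWith P ℱ T N p c q x₀ X f)
    (hg : PayoffAssumption T N c q r g) (hp : 1 < p) (hb : 0 ≤ c * (D : ℝ) ^ q) {j n : ℕ}
    (hn : n + j = N) :
    IsValueFunction P ℱ T N n X g (dpValue P (fun n => g (date T N n)) f j n) := by
  have hS := stoppingProblem h hg hp hb
  have hm := hS.dpValue_measurable j n hn
  refine ⟨hm, hm.comp (h.measurable_state (by omega)), ?_, ?_⟩
  · rintro Z ⟨τ, hτ, rfl⟩
    exact hS.condExp_reward_le j n hn τ (isStoppingRule_iff.1 hτ)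
  · intro Y' _ hY'
    obtain ⟨τ, hτ, heq⟩ := hS.exists_optimal j n hn
    exact heq.symm.trans_le (hY' _ ⟨τ, isStoppingRule_iff.2 hτ, rfl⟩)

theorem IsEssSup.ae_eq {S : Set (Ω → ℝ)} {Y Y' : Ω → ℝ} (h : IsEssSup P S Y)
    (h' : IsEssSup P S Y') : Y =ᵐ[P] Y' :=
  (h.least Y' h'.measurable h'.upper).antisymm (h'.least Y h.measurable h.upper)

end ValueFunction

/-! ### Moments of the Brownian weight. -/

section Weight

variable {Ω : Type*} {mΩ : MeasurableSpace Ω} {P : Measure Ω}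
  {ℱ : Filtration ℝ≥0 mΩ} {T : ℝ≥0} {N : ℕ} {D : ℕ} {W : ℝ≥0 → Ω → E D}

/-- The sum of the squared increments of `W` between `t_n` and `t_{n+1}`. -/
def quadVar (T : ℝ≥0) (N N₀ n : ℕ) (W : ℝ≥0 → Ω → E D) (ω : Ω) : ℝ≥0∞ :=
  ∑ k ∈ Finset.range N₀, ‖W (subdate T N N₀ n (k + 1)) ω - W (subdate T N N₀ n k) ω‖ₑ ^ 2

theorem subdate_le {N₀ n k : ℕ} (hN₀ : 1 ≤ N₀) (hk : k ≤ N₀) :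
    subdate T N N₀ n k ≤ date T N (n + 1) := by
  have h0 : (N₀ : ℝ≥0) ≠ 0 := by positivity
  calc subdate T N N₀ n k ≤ date T N n + N₀ * (T / (N * N₀)) := by
        unfold subdate
        gcongr
    _ = date T N (n + 1) := by
        unfold date
        have : (N₀ : ℝ≥0) * (T / (N * N₀)) = T / N := by
          rw [mul_comm (N : ℝ≥0), ← mul_div_assoc, mul_div_mul_left _ _ h0]
        rw [this]
        push_cast
        rw [← add_div]
        ring

theorem date_le {n : ℕ} (hn : n ≤ N) : date T N n ≤ T := by
  unfold date
  rcases Nat.eq_zero_or_pos N with rfl | hN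
  · simp
  · rw [div_le_iff₀ (by positivity), mul_comm]
    gcongr

theorem measurable_quadVar_of_forall {Ω : Type*} {m : MeasurableSpace Ω} {W : ℝ≥0 → Ω → E D}
    {N₀ n : ℕ} (hW : ∀ k ≤ N₀, Measurable (W (subdate T N N₀ n k))) :
    Measurable (quadVar T N N₀ n W) := by
  unfold quadVar
  refine Finset.measurable_fun_sum _ fun k hk => ?_
  have hk' := Finset.mem_range.1 hk
  exact ((hW (k + 1) hk').sub (hW k hk'.le)).enorm.pow_const 2

/-- The weight is known at t_{n+1}, hence at every later date. This is what allows freezing under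
the weighted measure from t_{n+1} on. -/
theorem measurable_quadVar (hW : IsBrownianMotion P ℱ T W) {N₀ n : ℕ} (hN₀ : 1 ≤ N₀)
    (hn : n < N) : Measurable[ℱ (date T N (n + 1))] (quadVar T N N₀ n W) :=
  measurable_quadVar_of_forall fun _ hk =>
    (hW.adapted _ ((subdate_le hN₀ hk).trans (date_le hn))).mono (ℱ.mono (subdate_le hN₀ hk))
      le_rfl

/-- By Minkowski the N₀ increments contribute N₀ times a bound linear in the time step T / (N N₀),
so N₀ cancels. -/
theorem lintegral_quadVar_le (hW : IsBrownianMotion P ℱ T W) {N₀ n : ℕ} (hN₀ : 1 ≤ N₀)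
    (hn : n < N) {s : ℝ} (hs : 1 ≤ s) :
    (∫⁻ ω, quadVar T N N₀ n W ω ^ s ∂P) ^ (1 / s) ≤ D * (T * gaussSqNorm s) := by
  have hm : ∀ k ≤ N₀, subdate T N N₀ n k ≤ T := fun k hk =>
    (subdate_le hN₀ hk).trans (date_le hn)
  have hsub : ∀ k, subdate T N N₀ n (k + 1) = subdate T N N₀ n k + T / (N * N₀) := by
    intro k
    unfold subdate
    push_cast
    ring
  have hlaw : ∀ k < N₀, (∫⁻ ω, (‖W (subdate T N N₀ n (k + 1)) ω
      - W (subdate T N N₀ n k) ω‖ₑ ^ 2) ^ s ∂P) ^ (1 / s)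
      ≤ D * ((T / (N * N₀) : ℝ≥0) * gaussSqNorm s) := by
    intro k hk
    have hle : subdate T N N₀ n k ≤ subdate T N N₀ n (k + 1) := by
      rw [hsub]
      exact le_self_add
    have := lintegral_multivariateGaussian_sq_le hs
      (sub_nonneg.2 (NNReal.coe_le_coe.2 hle)) (hW.law _ _ hle (hm _ hk))
    refine this.trans (le_of_eq ?_)
    congr 2
    rw [hsub, NNReal.coe_add, add_sub_cancel_left, ENNReal.ofReal_coe_nnreal]
  have hmeas : ∀ k ≤ N₀, Measurable (W (subdate T N N₀ n k)) := fun k hk =>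
    (hW.adapted _ (hm k hk)).mono (ℱ.le _) le_rfl
  have hN : 1 ≤ N := by omega
  have hq : ∀ ω, quadVar T N N₀ n W ω = ∑ k : Fin N₀, ‖W (subdate T N N₀ n (k + 1)) ω
      - W (subdate T N N₀ n k) ω‖ₑ ^ 2 := fun ω => by
    unfold quadVar
    rw [Finset.sum_range]
  simp only [hq]
  calc _ ≤ ∑ k : Fin N₀, (∫⁻ ω, (‖W (subdate T N N₀ n (k + 1)) ω
        - W (subdate T N N₀ n k) ω‖ₑ ^ 2) ^ s ∂P) ^ (1 / s) := by
        refine lintegral_Lp_sum_le hs _ (fun (k : Fin N₀) ω => ‖W (subdate T N N₀ n (k + 1)) ω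
          - W (subdate T N N₀ n k) ω‖ₑ ^ 2) fun k => ?_
        exact (((hmeas (k + 1) k.2).sub (hmeas k k.2.le)).enorm.pow_const 2).aemeasurable
    _ ≤ ∑ _k : Fin N₀, D * ((T / (N * N₀) : ℝ≥0) * gaussSqNorm s) :=
        Finset.sum_le_sum fun k _ => hlaw k k.2
    _ = D * (((N₀ * (T / (N * N₀)) : ℝ≥0)) * gaussSqNorm s) := by
        simp only [Finset.sum_const, Finset.card_univ, Fintype.card_fin, nsmul_eq_mul]
        push_cast
        ring
    _ ≤ D * (T * gaussSqNorm s) := by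
        gcongr
        have h0 : (N₀ : ℝ≥0) ≠ 0 := by positivity
        rw [mul_comm (N : ℝ≥0), ← mul_div_assoc, mul_div_mul_left _ _ h0]
        refine div_le_self zero_le ?_
        exact_mod_cast hN

end Weight

section WeightedMoment

variable {Ω : Type*} {mΩ : MeasurableSpace Ω} {P : Measure Ω}
  {ℱ : Filtration ℝ≥0 mΩ} {T : ℝ≥0} {N : ℕ} {p c q : ℝ} {D : ℕ} {x₀ : E D}
  {W X : ℝ≥0 → Ω → E D} {f : ℕ → E D → Ω → E D}

/-- The weight and the state may be dependent, so Hölder's inequality separates them: exponent p/2 >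
1 for the squared state, the conjugate exponent for the weight. -/
theorem lintegral_quadVar_mul_le [IsProbabilityMeasure P] (hW : IsBrownianMotion P ℱ T W)
    (h : DynamicAssumptionWith P ℱ T N p c q x₀ X f) (hp : 2 < p) {N₀ n m : ℕ} (hN₀ : 1 ≤ N₀)
    (hn : n < N) (hm : m ≤ N) :
    ∫⁻ ω, quadVar T N N₀ n W ω * (1 + ‖X (date T N m) ω‖ₑ) ^ 2 ∂P
      ≤ D * (T * gaussSqNorm (Real.conjExponent (p / 2)))
        * ((1 + ENNReal.ofReal (c * (D : ℝ) ^ q)) ^ (m + 1)) ^ 2 := by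
  have hconj : (p / 2).HolderConjugate (Real.conjExponent (p / 2)) :=
    Real.HolderConjugate.conjExponent (by linarith)
  have hqm : Measurable (quadVar T N N₀ n W) :=
    (measurable_quadVar hW hN₀ hn).mono (ℱ.le _) le_rfl
  have hXm := h.measurable_state hm
  refine (ENNReal.lintegral_mul_le_Lp_mul_Lq P hconj.symm hqm.aemeasurable
    (g := fun ω => (1 + ‖X (date T N m) ω‖ₑ) ^ 2) (by fun_prop)).trans ?_
  gcongr
  · exact lintegral_quadVar_le hW hN₀ hn hconj.symm.lt.le
  · rw [one_div, ENNReal.rpow_inv_le_iff (by linarith)]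
    have e1 : ∀ a : ℝ≥0∞, (a ^ 2) ^ (p / 2) = a ^ p := by
      intro a
      rw [← ENNReal.rpow_natCast, ← ENNReal.rpow_mul]
      congr 1
      push_cast
      ring
    simp only [e1]
    exact h.lintegral_state_le (by linarith) m hm

end WeightedMoment

/-! ### Monte Carlo approximation -/

section MonteCarlo

variable {Ω : Type*} {mΩ : MeasurableSpace Ω} {P : Measure Ω} [IsProbabilityMeasure P]

/-- The left side is a² plus the variance of Z, since the cross term has mean zero, and the variance
is at most the second moment. -/
theorem lintegral_add_sub_integral_sq_le {Z : Ω → ℝ} (hZ : Measurable Z)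
    (hZ2 : ∫⁻ ω, ‖Z ω‖ₑ ^ 2 ∂P ≠ ⊤) (a : ℝ) :
    ∫⁻ ω, ‖a + Z ω - ∫ ω', Z ω' ∂P‖ₑ ^ 2 ∂P ≤ ‖a‖ₑ ^ 2 + ∫⁻ ω, ‖Z ω‖ₑ ^ 2 ∂P := by
  have hsq : ∀ t : ℝ, ‖t‖ₑ ^ 2 = ENNReal.ofReal (t ^ 2) := fun t => by
    rw [Real.enorm_eq_ofReal_abs, ← ENNReal.ofReal_pow (abs_nonneg _), sq_abs]
  have hL : MemLp Z 2 P := by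
    refine ⟨hZ.aestronglyMeasurable, ?_⟩
    rw [eLpNorm_lt_top_iff_lintegral_rpow_enorm_lt_top (by simp) (by simp)]
    simpa using hZ2.lt_top
  have hi1 : Integrable Z P := hL.integrable (by simp)
  have hi2 : Integrable (fun ω => Z ω ^ 2) P := hL.integrable_sq
  set m := ∫ ω', Z ω' ∂P with hm
  have hexp : ∀ ω, (a + Z ω - m) ^ 2 = Z ω ^ 2 + (2 * (a - m) * Z ω + (a - m) ^ 2) :=
    fun ω => by ring
  have hi3 : Integrable (fun ω => 2 * (a - m) * Z ω + (a - m) ^ 2) P :=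
    (hi1.const_mul _).add (integrable_const _)
  have hint : ∫ ω, (a + Z ω - m) ^ 2 ∂P = ∫ ω, Z ω ^ 2 ∂P + a ^ 2 - m ^ 2 := by
    simp only [hexp]
    rw [integral_add hi2 hi3, integral_add (hi1.const_mul _) (integrable_const _),
      integral_const_mul, integral_const, ← hm]
    simp
    ring
  simp only [hsq]
  rw [← ofReal_integral_eq_lintegral_ofReal (by simp only [hexp]; exact hi2.add hi3)
    (ae_of_all _ fun ω => sq_nonneg _), ← ofReal_integral_eq_lintegral_ofReal hi2
    (ae_of_all _ fun ω => sq_nonneg _), ← ENNReal.ofReal_add (sq_nonneg _)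
    (integral_nonneg fun ω => sq_nonneg _), hint]
  refine ENNReal.ofReal_le_ofReal ?_
  nlinarith [sq_nonneg m]

variable {S : Type*} {mS : MeasurableSpace S}

theorem lintegral_lintegral_add_sub_le {ν : Measure S} [SFinite ν] {Z : S → Ω → ℝ}
    (hZ : Measurable (Function.uncurry Z))
    (hfin : ∫⁻ x, ∫⁻ ω, ‖Z x ω‖ₑ ^ 2 ∂P ∂ν ≠ ⊤) {h : S → ℝ} (hh : Measurable h) :
    ∫⁻ ω, ∫⁻ x, ‖h x + Z x ω - ∫ ω', Z x ω' ∂P‖ₑ ^ 2 ∂ν ∂P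
      ≤ ∫⁻ x, ‖h x‖ₑ ^ 2 ∂ν + ∫⁻ x, ∫⁻ ω, ‖Z x ω‖ₑ ^ 2 ∂P ∂ν := by
  have hm : Measurable fun x => ∫ ω', Z x ω' ∂P :=
    (hZ.stronglyMeasurable.integral_prod_right' (ν := P)).measurable
  have hZ2 : Measurable fun z : S × Ω => ‖Z z.1 z.2‖ₑ ^ 2 := by
    have : Measurable fun z : S × Ω => Z z.1 z.2 := hZ
    fun_prop
  have hZx : ∀ x, Measurable (Z x) := fun x => hZ.comp measurable_prodMk_left
  have hin : Measurable fun x => ∫⁻ ω, ‖Z x ω‖ₑ ^ 2 ∂P := hZ2.lintegral_prod_right'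
  rw [lintegral_lintegral_swap]
  · calc _ ≤ ∫⁻ x, (‖h x‖ₑ ^ 2 + ∫⁻ ω, ‖Z x ω‖ₑ ^ 2 ∂P) ∂ν := by
          refine lintegral_mono_ae ?_
          filter_upwards [ae_lt_top hin hfin] with x hx
          exact lintegral_add_sub_integral_sq_le (hZx x) hx.ne (h x)
      _ = _ := lintegral_add_right _ hin
  · have h1 : Measurable fun z : Ω × S => Z z.2 z.1 := hZ.comp measurable_swap
    have h2 : Measurable fun z : Ω × S => h z.2 := hh.comp measurable_snd
    have h3 : Measurable fun z : Ω × S => ∫ ω', Z z.2 ω' ∂P := hm.comp measurable_snd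
    exact (((h2.add h1).sub h3).enorm.pow_const 2).aemeasurable

/-- Sample points chosen one after the other, which control the mean square error of the empirical
mean together with the empirical mean of a further cost `u`. -/
theorem exists_sample {ν : Measure S} [SFinite ν] {Z : S → Ω → ℝ}
    (hZ : Measurable (Function.uncurry Z)) {A : ℝ≥0∞} (hA : A ≠ ⊤)
    (hZA : ∫⁻ x, ∫⁻ ω, ‖Z x ω‖ₑ ^ 2 ∂P ∂ν ≤ A) {u : Ω → ℝ≥0∞} (hu : AEMeasurable u P) (a : ℝ≥0∞)
    {good : Ω → Prop} (hgood : ∀ᵐ ω ∂P, good ω) (M : ℕ) :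
    ∃ w : Fin M → Ω, (∀ i, good (w i)) ∧
      a * ∫⁻ x, ‖∑ i, (Z x (w i) - ∫ ω', Z x ω' ∂P)‖ₑ ^ 2 ∂ν + ∑ i, u (w i)
        ≤ M * (a * A + ∫⁻ ω, u ω ∂P) := by
  have hm : Measurable fun x => ∫ ω', Z x ω' ∂P :=
    (hZ.stronglyMeasurable.integral_prod_right' (ν := P)).measurable
  induction M with
  | zero => exact ⟨Fin.elim0, fun i => i.elim0, by simp⟩
  | succ M ih =>
    obtain ⟨w, hw, hle⟩ := ih
    set h : S → ℝ := fun x => ∑ i, (Z x (w i) - ∫ ω', Z x ω' ∂P) with hh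
    have hhm : Measurable h := Finset.measurable_fun_sum _ fun i _ =>
      (hZ.comp measurable_prodMk_right).sub hm
    have hstep := lintegral_lintegral_add_sub_le (P := P) hZ (ne_top_of_le_ne_top hA hZA) hhm
    have hJ : Measurable fun ω => ∫⁻ x, ‖h x + Z x ω - ∫ ω', Z x ω' ∂P‖ₑ ^ 2 ∂ν := by
      have h1 : Measurable fun z : S × Ω => Z z.1 z.2 := hZ
      have h2 : Measurable fun z : S × Ω => h z.1 := hhm.comp measurable_fst
      have h3 : Measurable fun z : S × Ω => ∫ ω', Z z.1 ω' ∂P := hm.comp measurable_fst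
      exact (((h2.add h1).sub h3).enorm.pow_const 2).lintegral_prod_left'
    -- Some good point does no worse than the mean. With the earlier points fixed, this greedy
    -- choice replaces independent sampling on a product space.
    obtain ⟨ω, hω, hval⟩ := exists_notMem_null_le_lintegral (μ := P)
      (f := fun ω => a * ∫⁻ x, ‖h x + Z x ω - ∫ ω', Z x ω' ∂P‖ₑ ^ 2 ∂ν + u ω)
      ((hJ.const_mul a).aemeasurable.add hu) hgood
    rw [lintegral_add_left (hJ.const_mul a), lintegral_const_mul _ hJ] at hval
    refine ⟨Fin.snoc (α := fun _ => Ω) w ω, fun i => ?_, ?_⟩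
    · cases i using Fin.lastCases with
      | last => simpa using hω
      | cast i => simpa using hw i
    · simp only [Fin.sum_univ_castSucc, Fin.snoc_castSucc, Fin.snoc_last]
      have e1 : ∀ x, ∑ i, (Z x (w i) - ∫ ω', Z x ω' ∂P) + (Z x ω - ∫ ω', Z x ω' ∂P)
          = h x + Z x ω - ∫ ω', Z x ω' ∂P := fun x => by
        rw [hh]
        ring
      simp only [e1]
      calc _ = (a * ∫⁻ x, ‖h x + Z x ω - ∫ ω', Z x ω' ∂P‖ₑ ^ 2 ∂ν + u ω) + ∑ i, u (w i) := by
            ring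
        _ ≤ (a * (∫⁻ x, ‖h x‖ₑ ^ 2 ∂ν + A) + ∫⁻ ω, u ω ∂P) + ∑ i, u (w i) := by
            refine add_le_add (hval.trans ?_) le_rfl
            gcongr
            exact hstep.trans (by gcongr)
        _ = (a * ∫⁻ x, ‖h x‖ₑ ^ 2 ∂ν + ∑ i, u (w i)) + (a * A + ∫⁻ ω, u ω ∂P) := by ring
        _ ≤ M * (a * A + ∫⁻ ω, u ω ∂P) + (a * A + ∫⁻ ω, u ω ∂P) := by gcongr
        _ = _ := by
            push_cast
            ring

/-- Averaging over `ω` does not increase the `L²` norm. -/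
theorem eLpNorm_integral_le {ν : Measure S} [SFinite ν] {Z : S → Ω → ℝ}
    (hZ : Measurable (Function.uncurry Z)) :
    eLpNorm (fun x => ∫ ω, Z x ω ∂P) 2 ν ≤ eLpNorm (Function.uncurry Z) 2 (ν.prod P) := by
  rw [eLpNorm_eq_lintegral_rpow_enorm_toReal (by simp) (by simp),
    eLpNorm_eq_lintegral_rpow_enorm_toReal (by simp) (by simp)]
  refine ENNReal.rpow_le_rpow ?_ (by simp)
  have hZ2 : Measurable fun z : S × Ω => ‖Function.uncurry Z z‖ₑ ^ (2 : ℝ≥0∞).toReal := by fun_prop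
  rw [lintegral_prod _ hZ2.aemeasurable]
  refine lintegral_mono fun x => ?_
  have hZx : Measurable (Z x) := hZ.comp measurable_prodMk_left
  have h1 : ‖∫ ω, Z x ω ∂P‖ₑ ≤ ∫⁻ ω, ‖Z x ω‖ₑ ∂P := enorm_integral_le_lintegral_enorm _
  have h2 : ∫⁻ ω, ‖Z x ω‖ₑ ∂P ≤ (∫⁻ ω, ‖Z x ω‖ₑ ^ (2 : ℝ) ∂P) ^ (1 / (2 : ℝ)) :=
    lintegral_le_of_rpow_le hZx.enorm.aemeasurable (by norm_num) le_rfl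
  have h3 := h1.trans h2
  rw [one_div, ENNReal.le_rpow_inv_iff (by norm_num)] at h3
  simpa using h3

end MonteCarlo

/-! ### Programs for the sampled recursion -/

theorem Build.exists_sum {X : Type*} {B : Set (X → ℝ)} (h0 : (fun _ => 0) ∈ B) :
    ∀ (M : ℕ) (u : Fin M → X → ℝ) (t : Fin M → ℕ),
      (∀ i, ∃ L, Build B (t i) L ∧ u i ∈ L) →
      ∃ L, Build B (∑ i, (t i + 1)) L ∧ (fun x => ∑ i, u i x) ∈ L
  | 0, _, _, _ => ⟨B, by simpa using Build.refl, by simpa using h0⟩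
  | M + 1, u, t, h => by
    obtain ⟨L, hL, hmem⟩ := Build.exists_sum h0 M (fun i => u i.castSucc) (fun i => t i.castSucc)
      (fun i => h _)
    obtain ⟨L', hL', hmem'⟩ := h (Fin.last M)
    rw [Fin.sum_univ_castSucc, ← add_assoc]
    refine ⟨_, .step 1 1 0 (hL.both hL') (Or.inr hmem) (Or.inl hmem'), Or.inl ?_⟩
    funext x
    rw [Fin.sum_univ_castSucc]
    ring

/-- The program of `φ` runs first; its outputs then serve as the coordinates for the second program.
-/
theorem Build.exists_comp {D s t : ℕ} {L L' : Set (E D → ℝ)} (h : Build (coordBase D) s L)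
    {φ : E D → E D} (hφ : ∀ j, (fun x => φ x j) ∈ L) (h' : Build (coordBase D) t L')
    {v : E D → ℝ} (hv : v ∈ L') :
    ∃ L'', Build (coordBase D) (s + t) L'' ∧ (fun x => v (φ x)) ∈ L'' := by
  refine ⟨_, h.trans ((h'.comp φ).mono ?_), Or.inl ⟨v, hv, rfl⟩⟩
  rintro _ ⟨u, hu, rfl⟩
  rcases hu with rfl | rfl | ⟨i, rfl⟩
  · exact h.subset (zero_mem_coordBase D)
  · exact h.subset (one_mem_coordBase D)
  · exact hφ i

/-- Since max(φ, S) = φ + σ(S - φ), two instructions suffice after the sum has been formed. -/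
theorem Build.exists_max_average {D M t₀ : ℕ} {φ : E D → ℝ} {L₀ : Set (E D → ℝ)}
    (h₀ : Build (coordBase D) t₀ L₀) (hφ : φ ∈ L₀) (u : Fin M → E D → ℝ) (t : Fin M → ℕ)
    (h : ∀ i, ∃ L, Build (coordBase D) (t i) L ∧ u i ∈ L) (a : ℝ) :
    ∃ L, Build (coordBase D) (t₀ + ∑ i, (t i + 1) + 2) L ∧
      (fun x => max (φ x) (a * ∑ i, u i x)) ∈ L := by
  obtain ⟨L, hL, hmem⟩ := Build.exists_sum (zero_mem_coordBase D) M u t h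
  have h1 := Build.step a (-1) 0 (h₀.both hL) (Or.inl hmem) (Or.inr hφ)
  have h2 := Build.step 0 1 1 h1 (Set.mem_insert _ _) (Set.mem_insert_of_mem _ (Or.inr hφ))
  refine ⟨_, h2, Or.inl ?_⟩
  funext x
  rw [zero_mul, zero_mul, add_zero, zero_add, one_mul, one_mul, relu]
  rcases le_total (φ x) (a * ∑ i, u i x) with hx | hx
  · rw [max_eq_right hx, max_eq_left (by linarith)]
    ring
  · rw [max_eq_left hx, max_eq_right (by linarith)]
    ring

/-! ### Approximation of the dynamic programming recursion -/

/-- `V` is approximated up to `δ` in `L²(ν)` by a program of length at most `K` and of growth at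
most `K`. -/
def Approximable {D : ℕ} (V : E D → ℝ) (ν : Measure (E D)) (K δ : ℝ) : Prop :=
  ∃ (v : E D → ℝ) (s : ℕ) (L : Set (E D → ℝ)), Build (coordBase D) s L ∧ v ∈ L ∧ (s : ℝ) ≤ K ∧
    (∀ x, |v x| ≤ K * (1 + ‖x‖)) ∧ eLpNorm (fun x => V x - v x) 2 ν ≤ ENNReal.ofReal δ

/-! ### Pointwise bounds and L² norms. -/

section L2

variable {D : ℕ} {ν : Measure (E D)}

theorem enorm_le_of_abs_le {v : E D → ℝ} {K : ℝ} (hK : 0 ≤ K) (hv : ∀ x, |v x| ≤ K * (1 + ‖x‖))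
    (x : E D) : ‖v x‖ₑ ≤ ENNReal.ofReal K * (1 + ‖x‖ₑ) := by
  rw [Real.enorm_eq_ofReal_abs]
  refine (ENNReal.ofReal_le_ofReal (hv x)).trans (le_of_eq ?_)
  rw [ENNReal.ofReal_mul hK, ENNReal.ofReal_add (by positivity) (by positivity), ofReal_norm]
  simp

theorem lintegral_sq_le_of_abs_le {v : E D → ℝ} {K B : ℝ} (hK : 0 ≤ K)
    (hv : ∀ x, |v x| ≤ K * (1 + ‖x‖)) (hν : ∫⁻ x, (1 + ‖x‖ₑ) ^ 2 ∂ν ≤ ENNReal.ofReal B) :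
    ∫⁻ x, ‖v x‖ₑ ^ 2 ∂ν ≤ ENNReal.ofReal (K ^ 2 * B) := by
  calc ∫⁻ x, ‖v x‖ₑ ^ 2 ∂ν ≤ ∫⁻ x, ENNReal.ofReal K ^ 2 * (1 + ‖x‖ₑ) ^ 2 ∂ν := by
        refine lintegral_mono fun x => ?_
        rw [← mul_pow]
        gcongr
        exact enorm_le_of_abs_le hK hv x
    _ = ENNReal.ofReal K ^ 2 * ∫⁻ x, (1 + ‖x‖ₑ) ^ 2 ∂ν := lintegral_const_mul' _ _ (by finiteness)
    _ ≤ ENNReal.ofReal K ^ 2 * ENNReal.ofReal B := by gcongr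
    _ = _ := by rw [ENNReal.ofReal_mul (by positivity), ENNReal.ofReal_pow hK]

theorem eLpNorm_two_le {v : E D → ℝ} {δ : ℝ} (hδ : 0 ≤ δ)
    (h : ∫⁻ x, ‖v x‖ₑ ^ 2 ∂ν ≤ ENNReal.ofReal (δ ^ 2)) :
    eLpNorm v 2 ν ≤ ENNReal.ofReal δ := by
  rw [eLpNorm_eq_lintegral_rpow_enorm_toReal (by simp) (by simp), ENNReal.toReal_ofNat, one_div,
    ENNReal.rpow_inv_le_iff (by norm_num)]
  have e : ENNReal.ofReal δ ^ (2 : ℝ) = ENNReal.ofReal (δ ^ 2) := by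
    rw [ENNReal.ofReal_pow hδ]
    exact_mod_cast ENNReal.rpow_natCast _ 2
  rw [e]
  refine le_trans (le_of_eq (lintegral_congr fun x => ?_)) h
  exact_mod_cast ENNReal.rpow_natCast _ 2

theorem eLpNorm_two_le_add {h a b c : E D → ℝ} (ha : Measurable a) (hb : Measurable b)
    (hc : Measurable c) (hle : ∀ x, |h x| ≤ |a x| + (|b x| + |c x|)) {δ : ℝ≥0∞}
    (hδa : eLpNorm a 2 ν ≤ δ) (hδb : eLpNorm b 2 ν ≤ δ) (hδc : eLpNorm c 2 ν ≤ δ) :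
    eLpNorm h 2 ν ≤ δ + (δ + δ) := by
  have h1 : eLpNorm h 2 ν ≤ eLpNorm ((fun x => ‖a x‖) + ((fun x => ‖b x‖) + fun x => ‖c x‖)) 2 ν :=
    eLpNorm_mono_real hle
  refine h1.trans ((eLpNorm_add_le ha.norm.aestronglyMeasurable
    (hb.norm.add hc.norm).aestronglyMeasurable (by norm_num)).trans ?_)
  refine add_le_add (by rwa [eLpNorm_norm]) ?_
  refine (eLpNorm_add_le hb.norm.aestronglyMeasurable hc.norm.aestronglyMeasurable
    (by norm_num)).trans ?_
  exact add_le_add (by rwa [eLpNorm_norm]) (by rwa [eLpNorm_norm])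

end L2

/-! ### One backward step of the approximate recursion. -/

section Step

variable {Ω : Type*} {mΩ : MeasurableSpace Ω} {P : Measure Ω} {D : ℕ}
  {F : E D → Ω → E D}

theorem integrable_of_growth (hF : Measurable (Function.uncurry F))
    (hG : ∫⁻ ω, growth (fun x => F x ω) ∂P ≠ ⊤) (x : E D) : Integrable (F x) P := by
  refine ⟨(hF.comp measurable_prodMk_left).aestronglyMeasurable, ?_⟩
  calc ∫⁻ ω, ‖F x ω‖ₑ ∂P ≤ ∫⁻ ω, growth (fun x => F x ω) * (1 + ‖x‖ₑ) ∂P :=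
        lintegral_mono fun ω => enorm_le_growth (fun x => F x ω) x
    _ = (∫⁻ ω, growth (fun x => F x ω) ∂P) * (1 + ‖x‖ₑ) := lintegral_mul_const' _ _ (by simp)
    _ < ⊤ := by
        refine ENNReal.mul_lt_top hG.lt_top (by simp)

/-- The sampling step: an average of `M` compositions with sampled maps. -/
theorem exists_average [IsProbabilityMeasure P]
    (hF : Measurable (Function.uncurry F)) {B : ℝ} (hB : 3 ≤ B) {k : ℕ}
    (hs : ∃ s : Ω → ℝ≥0∞, Measurable s ∧ ∫⁻ ω, s ω ∂P ≤ ENNReal.ofReal B ∧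
      ∀ᵐ ω ∂P, ∃ k : ℕ, s ω = k ∧ ∃ L, Build (coordBase D) (2 * k) L ∧
        ∀ j, (fun x => F x ω j) ∈ L)
    (hGm : AEMeasurable (fun ω => growth fun x => F x ω) P)
    (hG : ∫⁻ ω, growth (fun x => F x ω) ∂P ≤ ENNReal.ofReal B)
    {ν : Measure (E D)} [SFinite ν]
    (hν' : ∫⁻ x, (1 + ‖x‖ₑ) ^ 2 ∂((ν.prod P).map (Function.uncurry F)) ≤ ENNReal.ofReal B)
    {v : E D → ℝ} (hv : Measurable v) (hvB : ∀ x, |v x| ≤ B ^ k * (1 + ‖x‖)) :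
    ∃ (M : ℕ) (w : Fin M → Ω) (t : Fin M → ℕ), 0 < M ∧ (M : ℝ) ≤ B ^ (2 * k + 8) ∧
      (∀ i, ∃ L, Build (coordBase D) (2 * t i) L ∧ ∀ j, (fun x => F x (w i) j) ∈ L) ∧
      ∑ i, (t i : ℝ) ≤ 3 * B * M ∧
      (∀ x, |(M : ℝ)⁻¹ * ∑ i, v (F x (w i))| ≤ B ^ k * (1 + 3 * B) * (1 + ‖x‖)) ∧
      eLpNorm (fun x => ∫ ω, v (F x ω) ∂P - (M : ℝ)⁻¹ * ∑ i, v (F x (w i))) 2 ν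
        ≤ ENNReal.ofReal (B ^ 2)⁻¹ := by
  have hB0 : 0 < B := by linarith
  have hB1 : 1 ≤ B := by linarith
  obtain ⟨s, hsm, hsB, hsize⟩ := hs
  set A : ℝ := B ^ (2 * k + 1) with hA
  have hA0 : 0 < A := by positivity
  have hZm : Measurable (Function.uncurry fun x ω => v (F x ω)) := hv.comp hF
  have hZA : ∫⁻ x, ∫⁻ ω, ‖v (F x ω)‖ₑ ^ 2 ∂P ∂ν ≤ ENNReal.ofReal A := by
    have h1 := lintegral_sq_le_of_abs_le (by positivity) hvB hν'
    rw [lintegral_map (by fun_prop) hF, lintegral_prod _ (by fun_prop)] at h1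
    refine h1.trans (le_of_eq ?_)
    rw [hA]
    congr 1
    ring
  -- The mean square error of the average will be at most 3AB / M with A = B^(2k+1). It has to be at
  -- most B⁻⁴, so M ≥ 3 B^(2k+6) is needed, and 3 ≤ B.
  set M : ℕ := ⌈B ^ (2 * k + 7)⌉₊ with hM
  have hM1 : B ^ (2 * k + 7) ≤ M := Nat.le_ceil _
  have hM2 : (M : ℝ) ≤ B ^ (2 * k + 8) := by
    have h1 : (M : ℝ) < B ^ (2 * k + 7) + 1 := Nat.ceil_lt_add_one (by positivity)
    have h2 : 1 ≤ B ^ (2 * k + 7) := one_le_pow₀ hB1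
    have h3 : B ^ (2 * k + 8) = B ^ (2 * k + 7) * B := pow_succ _ _
    nlinarith
  have hMpos : (0 : ℝ) < M := lt_of_lt_of_le (by positivity) hM1
  have hgood : ∀ᵐ ω ∂P, growth (fun x => F x ω) < ⊤ ∧ ∃ k : ℕ, s ω = k ∧
      ∃ L, Build (coordBase D) (2 * k) L ∧ ∀ j, (fun x => F x ω j) ∈ L := by
    filter_upwards [ae_lt_top' hGm (ne_top_of_le_ne_top ENNReal.ofReal_ne_top hG), hsize]
      with ω h1 h2 using ⟨h1, h2⟩
  -- The factor A⁻¹ normalizes the squared error, so that per sample the error, the growth and the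
  -- size each have mean at most B. The total cost is then at most 3BM, and so is each of the three
  -- nonnegative parts.
  obtain ⟨w, hw, hle⟩ := exists_sample (P := P) (ν := ν) hZm ENNReal.ofReal_ne_top hZA
    (hGm.add hsm.aemeasurable) (ENNReal.ofReal A)⁻¹ hgood M
  have hA' : ENNReal.ofReal A ≠ 0 := by simpa using hA0
  have hbound : (M : ℝ≥0∞) * ((ENNReal.ofReal A)⁻¹ * ENNReal.ofReal A
      + ∫⁻ ω, (growth (fun x => F x ω) + s ω) ∂P) ≤ ENNReal.ofReal (3 * B * M) := by
    rw [ENNReal.inv_mul_cancel hA' ENNReal.ofReal_ne_top, lintegral_add_right _ hsm]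
    calc _ ≤ (M : ℝ≥0∞) * (ENNReal.ofReal B + (ENNReal.ofReal B + ENNReal.ofReal B)) := by
          gcongr
          simpa using hB1
      _ = ENNReal.ofReal (3 * B * M) := by
          rw [← ENNReal.ofReal_add hB0.le hB0.le, ← ENNReal.ofReal_add hB0.le (by positivity),
            ← ENNReal.ofReal_natCast, ← ENNReal.ofReal_mul (by positivity)]
          congr 1
          ring
  replace hle := hle.trans hbound
  choose hfin t ht hL using hw
  have hI : ∫⁻ x, ‖∑ i, (v (F x (w i)) - ∫ ω', v (F x ω') ∂P)‖ₑ ^ 2 ∂ν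
      ≤ ENNReal.ofReal (A * (3 * B * M)) := by
    have := le_self_add.trans hle
    rw [ENNReal.inv_mul_le_iff hA' ENNReal.ofReal_ne_top] at this
    rwa [ENNReal.ofReal_mul hA0.le]
  have hu : ∑ i, (growth (fun x => F x (w i)) + s (w i)) ≤ ENNReal.ofReal (3 * B * M) :=
    le_add_self.trans hle
  rw [Finset.sum_add_distrib] at hu
  have hsum : ∑ i, (t i : ℝ) ≤ 3 * B * M := by
    have h1 : ∑ i, s (w i) ≤ ENNReal.ofReal (3 * B * M) := le_add_self.trans hu
    simp only [ht] at h1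
    have h2 := ENNReal.toReal_mono ENNReal.ofReal_ne_top h1
    rw [ENNReal.toReal_ofReal (by positivity)] at h2
    simpa [ENNReal.toReal_sum] using h2
  have hGsum : ∑ i, (growth (fun x => F x (w i))).toReal ≤ 3 * B * M := by
    have h1 : ∑ i, growth (fun x => F x (w i)) ≤ ENNReal.ofReal (3 * B * M) :=
      le_self_add.trans hu
    have h2 := ENNReal.toReal_mono ENNReal.ofReal_ne_top h1
    rwa [ENNReal.toReal_ofReal (by positivity), ENNReal.toReal_sum fun i _ => (hfin i).ne] at h2
  refine ⟨M, w, t, by exact_mod_cast hMpos, hM2, hL, hsum, fun x => ?_, ?_⟩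
  · have h1 : ∀ i, |v (F x (w i))|
        ≤ B ^ k * (1 + ‖x‖) * (1 + (growth (fun x => F x (w i))).toReal) := by
      intro i
      have h2 : ‖F x (w i)‖ ≤ (growth (fun x => F x (w i))).toReal * (1 + ‖x‖) := by
        have h3 := ENNReal.toReal_mono (ENNReal.mul_ne_top (hfin i).ne (by simp))
          (enorm_le_growth (fun x => F x (w i)) x)
        rw [ENNReal.toReal_mul, ENNReal.toReal_add (by simp) (by simp)] at h3
        simpa using h3
      calc |v (F x (w i))| ≤ B ^ k * (1 + ‖F x (w i)‖) := hvB _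
        _ ≤ B ^ k * ((1 + ‖x‖) + (growth (fun x => F x (w i))).toReal * (1 + ‖x‖)) := by
            gcongr
            linarith [norm_nonneg x]
        _ = _ := by ring
    rw [abs_mul, abs_inv, Nat.abs_cast, inv_mul_le_iff₀ hMpos]
    calc |∑ i, v (F x (w i))| ≤ ∑ i, |v (F x (w i))| := Finset.abs_sum_le_sum_abs _ _
      _ ≤ ∑ i, B ^ k * (1 + ‖x‖) * (1 + (growth (fun x => F x (w i))).toReal) :=
          Finset.sum_le_sum fun i _ => h1 i
      _ = B ^ k * (1 + ‖x‖) * (M + ∑ i, (growth (fun x => F x (w i))).toReal) := by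
          rw [← Finset.mul_sum, Finset.sum_add_distrib]
          simp
      _ ≤ B ^ k * (1 + ‖x‖) * (M + 3 * B * M) := by gcongr
      _ = _ := by ring
  · refine eLpNorm_two_le (by positivity) ?_
    have e1 : ∀ x, ‖∫ ω, v (F x ω) ∂P - (M : ℝ)⁻¹ * ∑ i, v (F x (w i))‖ₑ ^ 2
        = ENNReal.ofReal (((M : ℝ)⁻¹) ^ 2)
          * ‖∑ i, (v (F x (w i)) - ∫ ω', v (F x ω') ∂P)‖ₑ ^ 2 := by
      intro x
      have : ∫ ω, v (F x ω) ∂P - (M : ℝ)⁻¹ * ∑ i, v (F x (w i))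
          = -((M : ℝ)⁻¹ * ∑ i, (v (F x (w i)) - ∫ ω', v (F x ω') ∂P)) := by
        rw [Finset.sum_sub_distrib]
        simp
        field_simp
        ring
      rw [this, enorm_neg, enorm_mul, mul_pow, ENNReal.ofReal_pow (by positivity),
        Real.enorm_eq_ofReal (by positivity)]
    simp only [e1]
    rw [lintegral_const_mul' _ _ ENNReal.ofReal_ne_top]
    refine (mul_le_mul_right hI _).trans ?_
    rw [← ENNReal.ofReal_mul (by positivity)]
    refine ENNReal.ofReal_le_ofReal ?_
    have h3 : 3 * B ^ (2 * k + 6) ≤ M := by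
      refine le_trans ?_ hM1
      rw [pow_succ _ (2 * k + 6), mul_comm]
      gcongr
    rw [inv_pow, inv_pow, inv_mul_le_iff₀ (by positivity), ← div_eq_mul_inv,
      le_div_iff₀ (by positivity)]
    calc A * (3 * B * M) * (B ^ 2) ^ 2 = 3 * B ^ (2 * k + 6) * M := by
          rw [hA]
          ring
      _ ≤ M * M := by gcongr
      _ = (M : ℝ) ^ 2 := by ring

/-- The maximum is 1-Lipschitz, so three errors of size B⁻² add up: that of the payoff, that of v in
place of V, which averaging over ω does not increase, and that of sampling. Their sum is at most B⁻¹
because 3 ≤ B. -/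
theorem Approximable.step [IsProbabilityMeasure P]
    (hF : Measurable (Function.uncurry F)) {B : ℝ} (hB : 3 ≤ B) {k l : ℕ}
    (hs : ∃ s : Ω → ℝ≥0∞, Measurable s ∧ ∫⁻ ω, s ω ∂P ≤ ENNReal.ofReal B ∧
      ∀ᵐ ω ∂P, ∃ k : ℕ, s ω = k ∧ ∃ L, Build (coordBase D) (2 * k) L ∧
        ∀ j, (fun x => F x ω j) ∈ L)
    (hGm : AEMeasurable (fun ω => growth fun x => F x ω) P)
    (hG : ∫⁻ ω, growth (fun x => F x ω) ∂P ≤ ENNReal.ofReal B)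
    {ν : Measure (E D)} [SFinite ν]
    (hν' : ∫⁻ x, (1 + ‖x‖ₑ) ^ 2 ∂((ν.prod P).map (Function.uncurry F)) ≤ ENNReal.ofReal B)
    {γ V : E D → ℝ} (hγm : Measurable γ) (hγ : Approximable γ ν (B ^ l) (B ^ 2)⁻¹)
    (hV : Measurable V) (hVg : LinGrowth V)
    (hVa : Approximable V ((ν.prod P).map (Function.uncurry F)) (B ^ k) (B ^ 2)⁻¹) :
    Approximable (fun x => max (γ x) (∫ ω, V (F x ω) ∂P)) ν (B ^ (l + 3 * k + 14)) B⁻¹ := by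
  have hB0 : 0 < B := by linarith
  have hB1 : 1 ≤ B := by linarith
  obtain ⟨φ, t₀, L₀, hL₀, hφL, ht₀, hφB, hφγ⟩ := hγ
  obtain ⟨v, s', L', hL', hvL, hs', hvB, hVv⟩ := hVa
  have hφm : Measurable φ := (hL₀.continuous continuous_of_mem_coordBase _ hφL).measurable
  have hvm : Measurable v := (hL'.continuous continuous_of_mem_coordBase _ hvL).measurable
  have hGt := ne_top_of_le_ne_top ENNReal.ofReal_ne_top hG
  have hvg : LinGrowth v := ⟨(B ^ k).toNNReal, enorm_le_of_abs_le (by positivity) hvB⟩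
  obtain ⟨M, w, t, hM0, hM, hL, ht, hav, herr⟩ :=
    exists_average hF hB hs hGm hG hν' hvm hvB
  obtain ⟨L, hLb, hmem⟩ := Build.exists_max_average hL₀ hφL (fun i x => v (F x (w i)))
    (fun i => 2 * t i + s') (fun i => by
      obtain ⟨L, hL, hj⟩ := hL i
      exact hL.exists_comp hj hL' hvL) (M : ℝ)⁻¹
  refine ⟨_, _, L, hLb, hmem, ?_, fun x => ?_, ?_⟩
  · push_cast
    have e1 : ∑ i : Fin M, (2 * (t i : ℝ) + s' + 1) = 2 * ∑ i, (t i : ℝ) + M * (s' + 1) := by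
      rw [Finset.sum_add_distrib, Finset.sum_add_distrib, ← Finset.mul_sum]
      simp
      ring
    rw [e1]
    -- The payoff program, the sampled part and the two final instructions are each at most
    -- B^(l+3k+13); the last power of B absorbs the factor 3.
    have p1 : B ^ l ≤ B ^ (l + 3 * k + 13) := pow_le_pow_right₀ hB1 (by omega)
    have hBk : 1 ≤ B ^ k := one_le_pow₀ hB1
    have p2 : 2 * (3 * B * M) + M * (B ^ k + 1) ≤ B ^ (l + 3 * k + 13) := by
      have a1 : 6 * B + (B ^ k + 1) ≤ B ^ k * B ^ 4 := by
        have b1 : 6 * B + 2 ≤ B ^ 4 := by nlinarith [sq_nonneg (B ^ 2 - 9), sq_nonneg (B - 3)]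
        nlinarith
      calc 2 * (3 * B * M) + M * (B ^ k + 1) = M * (6 * B + (B ^ k + 1)) := by ring
        _ ≤ B ^ (2 * k + 8) * (B ^ k * B ^ 4) := by gcongr
        _ = B ^ (3 * k + 12) := by ring
        _ ≤ _ := pow_le_pow_right₀ hB1 (by omega)
    have p3 : (2 : ℝ) ≤ B ^ (l + 3 * k + 13) := by
      calc (2 : ℝ) ≤ B ^ 1 := by linarith
        _ ≤ _ := pow_le_pow_right₀ hB1 (by omega)
    have p4 : (M : ℝ) * (s' + 1) ≤ M * (B ^ k + 1) := by gcongr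
    have p5 : B ^ (l + 3 * k + 14) = B ^ (l + 3 * k + 13) * B := pow_succ _ _
    nlinarith
  · have h1 : B ^ l ≤ B ^ (l + 3 * k + 14) := pow_le_pow_right₀ hB1 (by omega)
    have h2 : B ^ k * (1 + 3 * B) ≤ B ^ (l + 3 * k + 14) := by
      calc B ^ k * (1 + 3 * B) ≤ B ^ k * B ^ 3 := by
            gcongr
            nlinarith [sq_nonneg (B - 3)]
        _ = B ^ (k + 3) := by ring
        _ ≤ _ := pow_le_pow_right₀ hB1 (by omega)
    refine abs_max_le_max_abs_abs.trans (max_le ((hφB x).trans ?_) ((hav x).trans ?_)) <;> gcongr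
  · have hm1 : Measurable fun x => ∫ ω, V (F x ω) ∂P :=
      ((hV.comp hF).stronglyMeasurable.integral_prod_right' (ν := P)).measurable
    have hm2 : Measurable fun x => ∫ ω, v (F x ω) ∂P :=
      ((hvm.comp hF).stronglyMeasurable.integral_prod_right' (ν := P)).measurable
    have hm3 : Measurable fun x => (M : ℝ)⁻¹ * ∑ i, v (F x (w i)) :=
      (Finset.measurable_fun_sum _ fun i _ =>
        hvm.comp (hF.comp measurable_prodMk_right)).const_mul _
    have hmid : eLpNorm (fun x => ∫ ω, V (F x ω) ∂P - ∫ ω, v (F x ω) ∂P) 2 ν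
        ≤ ENNReal.ofReal (B ^ 2)⁻¹ := by
      have e1 : ∀ x, ∫ ω, V (F x ω) ∂P - ∫ ω, v (F x ω) ∂P
          = ∫ ω, (V (F x ω) - v (F x ω)) ∂P := fun x =>
        (integral_sub (hVg.integrable hV (integrable_of_growth hF hGt x))
          (hvg.integrable hvm (integrable_of_growth hF hGt x))).symm
      simp only [e1]
      refine (eLpNorm_integral_le (Z := fun x ω => V (F x ω) - v (F x ω))
        ((hV.sub hvm).comp hF)).trans (le_trans (le_of_eq ?_) hVv)
      exact (eLpNorm_map_measure (g := fun x => V x - v x) (hV.sub hvm).aestronglyMeasurable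
        hF.aemeasurable).symm
    refine (eLpNorm_two_le_add (hγm.sub hφm) (hm1.sub hm2) (hm2.sub hm3) (fun x => ?_)
      hφγ hmid herr).trans ?_
    · refine (abs_max_sub_max_le_max _ _ _ _).trans (max_le ?_ ?_)
      · exact le_add_of_nonneg_right (by positivity)
      · exact (abs_sub_le _ (∫ ω, v (F x ω) ∂P) _).trans (le_add_of_nonneg_left (by positivity))
    · rw [← ENNReal.ofReal_add (by positivity) (by positivity),
        ← ENNReal.ofReal_add (by positivity) (by positivity)]
      refine ENNReal.ofReal_le_ofReal ?_
      have : (B ^ 2)⁻¹ + ((B ^ 2)⁻¹ + (B ^ 2)⁻¹) = 3 / B * B⁻¹ := by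
        field_simp
        norm_num
      rw [this]
      refine mul_le_of_le_one_left (by positivity) ?_
      rwa [div_le_one hB0]

end Step

theorem Approximable.mono {D : ℕ} {V : E D → ℝ} {ν : Measure (E D)} {K K' δ δ' : ℝ}
    (h : Approximable V ν K δ) (hK : K ≤ K') (hδ : δ ≤ δ') : Approximable V ν K' δ' := by
  obtain ⟨v, s, L, hL, hv, hs, hg, he⟩ := h
  refine ⟨v, s, L, hL, hv, hs.trans hK, fun x => (hg x).trans ?_,
    he.trans (ENNReal.ofReal_le_ofReal hδ)⟩
  gcongr

/-- Accuracy B⁻⁴ in the assumption gives the pointwise error B⁻³ (1 + ‖x‖), and a second moment of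
at most B turns it into an L² error below B⁻². The size is at most B · B^(4R), and another B covers
the factor 2 of the program length. -/
theorem PayoffAssumption.approximable {T : ℝ≥0} {N : ℕ} {c q r : ℝ} {D : ℕ} {g : ℝ≥0 → E D → ℝ}
    (h : PayoffAssumption T N c q r g) (hb : 0 ≤ c * (D : ℝ) ^ q) {B : ℝ} (hB : 3 ≤ B)
    (hbB : c * (D : ℝ) ^ q ≤ B) {R : ℕ} (hR : r ≤ R) {ν : Measure (E D)}
    (hν : ∫⁻ x, (1 + ‖x‖ₑ) ^ 2 ∂ν ≤ ENNReal.ofReal B) {n : ℕ} (hn : n ≤ N) :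
    Approximable (g (date T N n)) ν (B ^ (4 * R + 2)) (B ^ 2)⁻¹ := by
  have hB0 : 0 < B := by linarith
  have hB1 : 1 ≤ B := by linarith
  obtain ⟨φ, -, h1, h2, h3, h4⟩ := h (B ^ 4)⁻¹ (by positivity) n hn
  set b := c * (D : ℝ) ^ q with hbdef
  have h1' : ∀ x, |g (date T N n) x - φ.real x| ≤ (B ^ 3)⁻¹ * (1 + ‖x‖) := by
    intro x
    rw [abs_sub_comm]
    refine (h1 x).trans ?_
    gcongr
    rw [mul_assoc, ← hbdef]
    calc (B ^ 4)⁻¹ * b ≤ (B ^ 4)⁻¹ * B := by gcongr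
      _ = (B ^ 3)⁻¹ := by field_simp
  obtain ⟨L, hL, hmem⟩ := φ.exists_build (B := coordBase D) (fun x : E D => x.ofLp)
    coord_mem_coordBase (zero_mem_coordBase D) (one_mem_coordBase D)
  have hpow : B ^ (4 * R + 2) = B ^ (4 * R) * B * B := by ring
  have hP1 : 1 ≤ B ^ (4 * R) := one_le_pow₀ hB1
  refine ⟨φ.real, _, L, hL, hmem 0, ?_, fun x => ?_, ?_⟩
  · have hε : ((B ^ 4)⁻¹) ^ (-r) ≤ B ^ (4 * R) := by
      rw [Real.inv_rpow (by positivity), Real.rpow_neg (by positivity), inv_inv, pow_mul,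
        ← Real.rpow_natCast (B ^ 4) R]
      exact Real.rpow_le_rpow_of_exponent_le (one_le_pow₀ hB1) hR
    push_cast
    calc 2 * (φ.size : ℝ) ≤ 2 * (B * B ^ (4 * R)) := by
          gcongr
          exact h2.trans (by gcongr)
      _ ≤ B * (B * B ^ (4 * R)) := by
          gcongr
          linarith
      _ = _ := by rw [hpow]; ring
  · have hl := h3.dist_le_mul x 0
    rw [Real.coe_toNNReal _ hb, Real.dist_eq, dist_zero_right] at hl
    have h0 := h1' 0
    rw [norm_zero, add_zero, mul_one] at h0
    have hB3 : (B ^ 3)⁻¹ ≤ 1 := inv_le_one_of_one_le₀ (one_le_pow₀ hB1)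
    have hx := norm_nonneg x
    have hφ0 : |φ.real 0| ≤ 1 + B := by
      rw [_root_.abs_le] at h0 h4 ⊢
      constructor <;> linarith [h0.1, h0.2, h4.1, h4.2]
    have hφx : |φ.real x| ≤ (1 + B) * (1 + ‖x‖) := by
      have hbx : b * ‖x‖ ≤ (1 + B) * ‖x‖ := by gcongr; linarith
      rw [_root_.abs_le] at hl hφ0 ⊢
      constructor <;> nlinarith [hl.1, hl.2, hφ0.1, hφ0.2]
    refine hφx.trans ?_
    gcongr
    rw [hpow, mul_assoc]
    have hBB : 1 + B ≤ B * B := by nlinarith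
    nlinarith
  · refine eLpNorm_two_le (by positivity)
      ((lintegral_sq_le_of_abs_le (by positivity) h1' hν).trans (ENNReal.ofReal_le_ofReal ?_))
    rw [inv_pow, inv_pow, inv_mul_le_iff₀ (by positivity), ← div_eq_mul_inv,
      le_div_iff₀ (by positivity)]
    calc B * (B ^ 2) ^ 2 = B ^ 5 := by ring
      _ ≤ B ^ 6 := pow_le_pow_right₀ hB1 (by norm_num)
      _ = (B ^ 3) ^ 2 := by ring

/-- The exponent of the complexity bound with `j` remaining dates. -/
def complexityExponent (R : ℕ) : ℕ → ℕ
  | 0 => 4 * R + 2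
  | j + 1 => 4 * R + 2 + 3 * (2 * complexityExponent R j) + 14

/-! ### Backward induction over the dates. -/

section Induction

variable {Ω : Type*} {mΩ : MeasurableSpace Ω} {P : Measure Ω}
  {ℱ : Filtration ℝ≥0 mΩ} {T : ℝ≥0} {N : ℕ} {p c q r : ℝ} {D : ℕ} {x₀ : E D}
  {W X : ℝ≥0 → Ω → E D} {f : ℕ → E D → Ω → E D} {g : ℝ≥0 → E D → ℝ}

/-- The weight is fixed and only the date moves. The condition n₀ ≤ n keeps the weight measurable at
t_n, so the measure at the next date is the image of the present one under the transition map. -/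
theorem dpValue_approximable [IsProbabilityMeasure P]
    (h : DynamicAssumptionWith P ℱ T N p c q x₀ X f)
    (hg : PayoffAssumption T N c q r g) (hp : 1 < p) (hb : 0 ≤ c * (D : ℝ) ^ q) {R : ℕ}
    (hR : r ≤ R) {n₀ : ℕ} {Λ : Ω → ℝ≥0∞} (hΛ : Measurable[ℱ (date T N n₀)] Λ)
    (hfin : ∫⁻ ω, Λ ω ∂P ≠ ⊤) :
    ∀ j n, n + j = N → n₀ ≤ n → ∀ B : ℝ, 3 ≤ B → c * (D : ℝ) ^ q ≤ B →
      (∀ m ≤ N, ∫⁻ x, (1 + ‖x‖ₑ) ^ 2 ∂((P.withDensity Λ).map (X (date T N m)))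
        ≤ ENNReal.ofReal B) →
      Approximable (dpValue P (fun n => g (date T N n)) f j n)
        ((P.withDensity Λ).map (X (date T N n))) (B ^ complexityExponent R j) B⁻¹
  | 0, n, hn, _, B, hB, hbB, hmom => by
    refine (hg.approximable hb hB hbB hR (hmom n (by omega)) (by omega)).mono le_rfl ?_
    refine inv_anti₀ (by linarith) ?_
    nlinarith
  | j + 1, n, hn, hn₀, B, hB, hbB, hmom => by
    have hnN : n < N := by omega
    have hB2 : B ≤ B ^ 2 := by nlinarith
    have hS := stoppingProblem h hg hp hb
    have : IsFiniteMeasure (P.withDensity Λ) := isFiniteMeasure_withDensity hfin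
    -- Accuracy B⁻¹ at this date requires B⁻² at the next one, so the induction hypothesis is used
    -- with B² in place of B. This doubles the exponent, as in `complexityExponent`.
    have ih := dpValue_approximable h hg hp hb hR hΛ hfin j (n + 1) (by omega) (by omega) (B ^ 2)
      (hB.trans hB2) (hbB.trans hB2)
      (fun m hm => (hmom m hm).trans (ENNReal.ofReal_le_ofReal hB2))
    have hΛn : Measurable[ℱ (date T N n)] Λ :=
      hΛ.mono ((disFiltration ℱ T N).mono hn₀) le_rfl
    have hmap := h.map_eq hnN hΛn hfin
    have hm1 := hmom (n + 1) (by omega)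
    rw [hmap] at ih hm1
    rw [← pow_mul] at ih
    obtain ⟨s, hs1, hs2, hs3⟩ := h.exists_size hnN
    exact Approximable.step (h.measurable_uncurry hnN) hB
      ⟨s, hs1, hs2.trans (ENNReal.ofReal_le_ofReal hbB), hs3⟩ (h.aemeasurable_growth hnN)
      ((h.lintegral_growth_le hp hnN).trans (ENNReal.ofReal_le_ofReal hbB)) hm1
      (hS.payoff_measurable n hnN.le)
      (hg.approximable hb hB hbB hR (hmom n hnN.le) hnN.le)
      (hS.dpValue_measurable j (n + 1) (by omega)) (hS.dpValue_growth j (n + 1) (by omega)) ih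

theorem lintegral_map_quadVar_le [IsProbabilityMeasure P] (hW : IsBrownianMotion P ℱ T W)
    (h : DynamicAssumptionWith P ℱ T N p c q x₀ X f) (hp : 2 < p) (hb : 0 ≤ c * (D : ℝ) ^ q)
    {N₀ n m : ℕ} (hN₀ : 1 ≤ N₀) (hn : n < N) (hm : m ≤ N) :
    ∫⁻ x, (1 + ‖x‖ₑ) ^ 2 ∂((P.withDensity (quadVar T N N₀ n W)).map (X (date T N m)))
      ≤ ENNReal.ofReal (D * (T * (gaussSqNorm (Real.conjExponent (p / 2))).toReal)
        * (1 + c * (D : ℝ) ^ q) ^ (2 * N + 2)) := by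
  have hqm : Measurable (quadVar T N N₀ n W) :=
    (measurable_quadVar hW hN₀ hn).mono (ℱ.le _) le_rfl
  have hXm := h.measurable_state hm
  have hs : 1 ≤ Real.conjExponent (p / 2) :=
    (Real.HolderConjugate.conjExponent (by linarith)).symm.lt.le
  rw [lintegral_map (by fun_prop) hXm,
    lintegral_withDensity_eq_lintegral_mul _ hqm (by fun_prop)]
  refine (lintegral_quadVar_mul_le hW h hp hN₀ hn hm).trans ?_
  generalize c * (D : ℝ) ^ q = b at hb ⊢
  rw [ENNReal.ofReal_mul (by positivity), ENNReal.ofReal_mul (by positivity),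
    ENNReal.ofReal_mul (by positivity), ENNReal.ofReal_natCast, ENNReal.ofReal_coe_nnreal,
    ENNReal.ofReal_toReal (gaussSqNorm_ne_top hs), ENNReal.ofReal_pow (by positivity),
    ENNReal.ofReal_add (by positivity) hb, ENNReal.ofReal_one, ← pow_mul]
  gcongr
  · exact le_self_add
  · omega

theorem lintegral_quadVar_ne_top (hW : IsBrownianMotion P ℱ T W) {N₀ n : ℕ} (hN₀ : 1 ≤ N₀)
    (hn : n < N) : ∫⁻ ω, quadVar T N N₀ n W ω ∂P ≠ ⊤ := by
  have h := lintegral_quadVar_le hW hN₀ hn le_rfl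
  simp only [ENNReal.rpow_one, div_one] at h
  refine ne_top_of_le_ne_top ?_ h
  have := gaussSqNorm_ne_top le_rfl
  finiteness

end Induction

/-! ### The final estimates -/

theorem growth_le_of_abs_le {D : ℕ} {v : E D → ℝ} {K : ℝ} (hK : 0 ≤ K)
    (hv : ∀ x, |v x| ≤ K * (1 + ‖x‖)) : growth v ≤ ENNReal.ofReal K :=
  iSup_le fun x => (ENNReal.div_le_iff (by simp) (by simp)).2 (enorm_le_of_abs_le hK hv x)

theorem exists_zero_net (D : ℕ) :
    ∃ φ : Net D 1, 1 ≤ φ.depth ∧ φ.size = 0 ∧ ∀ x, φ.real x = 0 := by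
  refine ⟨.hidden (m := 0) 0 0 (.output 0 0), le_rfl, ?_, fun x => ?_⟩
  · rw [Net.size_hidden, Net.size_output]
    simp [affineSize]
  · rw [Net.real, Net.eval_hidden, Net.eval_output]
    simp

/-- A network obtained from a program. -/
theorem Approximable.exists_net {D : ℕ} {V : E D → ℝ} {ν : Measure (E D)} {B δ : ℝ} {k : ℕ}
    (h : Approximable V ν (B ^ k) δ) (hB : 3 ≤ B) :
    ∃ φ : Net D 1, 1 ≤ φ.depth ∧ eLpNorm (fun x => V x - φ.real x) 2 ν ≤ ENNReal.ofReal δ ∧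
      (φ.size : ℝ) ≤ B ^ (2 * k + 5) ∧ growth φ.real ≤ ENNReal.ofReal (B ^ (2 * k + 5)) := by
  have hB0 : 0 < B := by linarith
  have hB1 : 1 ≤ B := by linarith
  obtain ⟨v, s, L, hL, hv, hs, hg, he⟩ := h
  obtain ⟨φ, h1, h2, h3⟩ := hL.exists_net hv
  have h3' : φ.real = v := funext h3
  have hk : 1 ≤ B ^ k := one_le_pow₀ hB1
  refine ⟨φ, h1, by simpa only [h3] using he, ?_, ?_⟩
  · have h4 : (φ.size : ℝ) ≤ 50 * ((s : ℝ) + 1) ^ 2 := by exact_mod_cast h2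
    calc (φ.size : ℝ) ≤ 50 * ((s : ℝ) + 1) ^ 2 := h4
      _ ≤ 50 * (B ^ k + B ^ k) ^ 2 := by gcongr
      _ = B ^ (2 * k) * 200 := by ring
      _ ≤ B ^ (2 * k) * B ^ 5 := by
          gcongr
          calc (200 : ℝ) ≤ 3 ^ 5 := by norm_num
            _ ≤ B ^ 5 := by gcongr
      _ = _ := by ring
  · rw [h3']
    refine (growth_le_of_abs_le (by positivity) hg).trans (ENNReal.ofReal_le_ofReal ?_)
    exact pow_le_pow_right₀ hB1 (by omega)

/-- A crude bound on the norm, which shows that the zero network is accurate enough for very large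
ε. -/
theorem Approximable.eLpNorm_le {D : ℕ} {V : E D → ℝ} (hV : Measurable V) {ν : Measure (E D)}
    {B : ℝ} {k : ℕ} (h : Approximable V ν (B ^ k) B⁻¹) (hB : 3 ≤ B)
    (hν : ∫⁻ x, (1 + ‖x‖ₑ) ^ 2 ∂ν ≤ ENNReal.ofReal B) :
    eLpNorm V 2 ν ≤ ENNReal.ofReal (B ^ (k + 2)) := by
  have hB0 : 0 < B := by linarith
  have hB1 : 1 ≤ B := by linarith
  obtain ⟨v, s, L, hL, hv, hs, hg, he⟩ := h
  have hvm : Measurable v := (hL.continuous continuous_of_mem_coordBase _ hv).measurable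
  have hk : 1 ≤ B ^ (k + 1) := one_le_pow₀ hB1
  have h1 : eLpNorm v 2 ν ≤ ENNReal.ofReal (B ^ (k + 1)) := by
    refine eLpNorm_two_le (by positivity)
      ((lintegral_sq_le_of_abs_le (by positivity) hg hν).trans (ENNReal.ofReal_le_ofReal ?_))
    calc (B ^ k) ^ 2 * B ≤ (B ^ k) ^ 2 * B ^ 2 := by
          gcongr
          nlinarith
      _ = _ := by ring
  have e : V = (fun x => V x - v x) + v := by
    funext x
    simp
  rw [e]
  refine (eLpNorm_add_le (hV.sub hvm).aestronglyMeasurable hvm.aestronglyMeasurable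
    (by norm_num)).trans ((add_le_add he h1).trans ?_)
  rw [← ENNReal.ofReal_add (by positivity) (by positivity)]
  refine ENNReal.ofReal_le_ofReal ?_
  have h2 : B⁻¹ ≤ 1 := inv_le_one_of_one_le₀ hB1
  have h3 : B ^ (k + 2) = B ^ (k + 1) * B := pow_succ _ _
  nlinarith

/-- Accuracy `ε` for all `ε > 0`, from accuracy `B⁻¹` for all large `B`. -/
theorem exists_net_of_approximable {D : ℕ} {V : E D → ℝ} (hV : Measurable V) {ν : Measure (E D)}
    {B : ℝ} {k : ℕ} (hB : 3 ≤ B) (hν : ∫⁻ x, (1 + ‖x‖ₑ) ^ 2 ∂ν ≤ ENNReal.ofReal B)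
    (h : ∀ B' ≥ B, Approximable V ν (B' ^ k) B'⁻¹) {ε : ℝ} (hε : 0 < ε) :
    ∃ φ : Net D 1, 1 ≤ φ.depth ∧ eLpNorm (fun x => V x - φ.real x) 2 ν ≤ ENNReal.ofReal ε ∧
      (φ.size : ℝ) ≤ B ^ ((2 * k + 5) * (k + 3)) * (ε ^ (2 * k + 5))⁻¹ ∧
      growth φ.real ≤ ENNReal.ofReal (B ^ ((2 * k + 5) * (k + 3)) * (ε ^ (2 * k + 5))⁻¹) := by
  have hB0 : 0 < B := by linarith
  have hB1 : 1 ≤ B := by linarith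
  rcases le_or_gt ε 1 with hε1 | hε1
  -- For ε ≤ 1 the hypothesis is applied with B / ε, whose inverse is at most ε.
  · have hBε : B ≤ B / ε := by
      rw [le_div_iff₀ hε]
      exact mul_le_of_le_one_right hB0.le hε1
    obtain ⟨φ, h1, h2, h3, h4⟩ := (h (B / ε) hBε).exists_net (hB.trans hBε)
    have hle : (B / ε) ^ (2 * k + 5) ≤ B ^ ((2 * k + 5) * (k + 3)) * (ε ^ (2 * k + 5))⁻¹ := by
      rw [div_pow, div_eq_mul_inv]
      gcongr
      nlinarith
    refine ⟨φ, h1, h2.trans (ENNReal.ofReal_le_ofReal ?_), h3.trans hle,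
      h4.trans (ENNReal.ofReal_le_ofReal hle)⟩
    rw [inv_div]
    exact div_le_self hε.le hB1
  -- For ε > 1 the claimed bound decreases in ε. Up to B^(k+2) the network for B itself serves, and
  -- the additional power B^((2k+5)(k+2)) compensates the negative power of ε; beyond that the zero
  -- network suffices.
  · rcases le_or_gt ε (B ^ (k + 2)) with hε2 | hε2
    · obtain ⟨φ, h1, h2, h3, h4⟩ := (h B le_rfl).exists_net hB
      have hle : B ^ (2 * k + 5) ≤ B ^ ((2 * k + 5) * (k + 3)) * (ε ^ (2 * k + 5))⁻¹ := by
        rw [← div_eq_mul_inv, le_div_iff₀ (by positivity)]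
        calc B ^ (2 * k + 5) * ε ^ (2 * k + 5)
            ≤ B ^ (2 * k + 5) * (B ^ (k + 2)) ^ (2 * k + 5) := by gcongr
          _ = B ^ ((2 * k + 5) * (k + 3)) := by
              rw [← pow_mul, ← pow_add]
              congr 1
              ring
      refine ⟨φ, h1, h2.trans (ENNReal.ofReal_le_ofReal ?_), h3.trans hle,
        h4.trans (ENNReal.ofReal_le_ofReal hle)⟩
      exact (inv_le_one_of_one_le₀ hB1).trans hε1.le
    · obtain ⟨φ, h1, h2, h3⟩ := exists_zero_net D
      have h3' : φ.real = fun _ => 0 := funext h3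
      refine ⟨φ, h1, ?_, ?_, ?_⟩
      · simp only [h3, sub_zero]
        exact ((h B le_rfl).eLpNorm_le hV hB hν).trans (ENNReal.ofReal_le_ofReal hε2.le)
      · rw [h2]
        push_cast
        positivity
      · rw [h3']
        exact growth_le_of_abs_le (by positivity) fun x => by
          rw [abs_zero]
          positivity

/-- Essential suprema are almost surely unique, and the weighted law is absolutely continuous with
respect to the law of the state. -/
theorem IsValueFunction.eLpNorm_sub_eq {Ω : Type*} {mΩ : MeasurableSpace Ω} {P : Measure Ω}
    {ℱ : Filtration ℝ≥0 mΩ} {T : ℝ≥0} {N n : ℕ} {D : ℕ} {X : ℝ≥0 → Ω → E D}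
    {g : ℝ≥0 → E D → ℝ} {V V' : E D → ℝ} (h : IsValueFunction P ℱ T N n X g V)
    (h' : IsValueFunction P ℱ T N n X g V') (hX : Measurable (X (date T N n))) (Λ : Ω → ℝ≥0∞)
    (v : E D → ℝ) :
    eLpNorm (fun z => V z - v z) 2 ((P.withDensity Λ).map (X (date T N n)))
      = eLpNorm (fun z => V' z - v z) 2 ((P.withDensity Λ).map (X (date T N n))) := by
  have hae : ∀ᵐ z ∂((P.withDensity Λ).map (X (date T N n))), V z = V' z := by
    rw [ae_map_iff hX.aemeasurable (measurableSet_eq_fun h.1 h'.1)]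
    exact (withDensity_absolutelyContinuous P Λ).ae_le (h.2.ae_eq h'.2)
  refine eLpNorm_congr_ae ?_
  filter_upwards [hae] with z hz
  rw [hz]

end DeepMartingale
end

open DeepMartingale in
theorem mainTheorem9 (T : ℝ≥0) (hT : 0 < T) (N : ℕ) (p : ℝ) (hp : 2 < p)
    (c q r : ℝ) (hc : 0 < c) (hq : 0 < q) (hr : 0 < r) (n : ℕ) (hn : n < N) :
    ∃ c' q' τ' : ℝ, 1 ≤ c' ∧ 1 ≤ q' ∧ 1 ≤ τ' ∧
      ∀ (D : ℕ), 1 ≤ D →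
      ∀ {Ω : Type*} {mΩ : MeasurableSpace Ω} (P : Measure Ω) [IsProbabilityMeasure P]
        (ℱ : Filtration ℝ≥0 mΩ) (W : ℝ≥0 → Ω → E D) (x₀ : E D) (X : ℝ≥0 → Ω → E D)
        (g : ℝ≥0 → E D → ℝ),
        IsBrownianMotion P ℱ T W →
        DynamicAssumption P ℱ T N p c q x₀ X →
        PayoffAssumption T N c q r g →
        (∃ V : E D → ℝ, IsValueFunction P ℱ T N (n + 1) X g V) ∧
        ∀ V : E D → ℝ, IsValueFunction P ℱ T N (n + 1) X g V →
          ∀ ε : ℝ, 0 < ε → ∀ N₀ : ℕ, 1 ≤ N₀ →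
            ∃ φ : Net D 1, 1 ≤ φ.depth ∧
              eLpNorm (fun z => V z - φ.real z) 2 (rhoTilde P T N N₀ n W X) ≤ ENNReal.ofReal ε ∧
              (φ.size : ℝ) ≤ c' * (D : ℝ) ^ q' * ε ^ (-τ') ∧
              growth φ.real ≤ ENNReal.ofReal (c' * (D : ℝ) ^ q' * ε ^ (-τ')) := by
  obtain ⟨R, hR⟩ := exists_nat_ge r
  -- The number of dates remaining after t_{n+1} is `j`; it fixes the exponent `k`.
  obtain ⟨j, hj⟩ := Nat.exists_eq_add_of_lt hn
  have hj' : n + 1 + j = N := by omega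
  set k := complexityExponent R j with hk
  set κ := (gaussSqNorm (Real.conjExponent (p / 2))).toReal with hκ
  have hκ0 : 0 ≤ κ := ENNReal.toReal_nonneg
  set e := (2 * k + 5) * (k + 3) with he
  have he1 : 1 ≤ e := by rw [he]; nlinarith
  -- `C` and `Q` are chosen so that B = C D^Q dominates 3, c D^q and the weighted second moments D T
  -- κ (1 + c D^q)^(2N+2), the last by 1 + c D^q ≤ (1 + c) D^q.
  set C : ℝ := 3 + c + T * κ * (1 + c) ^ (2 * N + 2) with hC
  set Q : ℝ := 1 + q * (2 * N + 2) with hQ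
  have hC3 : 3 ≤ C := by
    have : 0 ≤ (T : ℝ) * κ * (1 + c) ^ (2 * N + 2) := by positivity
    linarith
  have hQ1 : 1 ≤ Q := by
    have : 0 ≤ q * (2 * N + 2) := by positivity
    linarith
  -- These are read off from B^e ε^(-(2k+5)) with B = C D^Q.
  refine ⟨C ^ e, Q * e, (2 * k + 5 : ℕ), one_le_pow₀ (by linarith), ?_, ?_, ?_⟩
  · have : (1 : ℝ) ≤ e := by exact_mod_cast he1
    nlinarith
  · exact_mod_cast (by omega : 1 ≤ 2 * k + 5)
  intro D hD Ω mΩ P _ ℱ W x₀ X g hW hdyn hg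
  obtain ⟨f, h⟩ := hdyn
  have hD1 : (1 : ℝ) ≤ D := by exact_mod_cast hD
  have hb : 0 ≤ c * (D : ℝ) ^ q := by positivity
  have hp1 : 1 < p := by linarith
  have hval := isValueFunction_dpValue h hg hp1 hb hj'
  refine ⟨⟨_, hval⟩, fun V hV ε hε N₀ hN₀ => ?_⟩
  set B : ℝ := C * (D : ℝ) ^ Q with hBdef
  have hDq1 : 1 ≤ (D : ℝ) ^ q := Real.one_le_rpow hD1 hq.le
  have hDQ1 : 1 ≤ (D : ℝ) ^ Q := Real.one_le_rpow hD1 (by linarith)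
  have hB3 : 3 ≤ B := by nlinarith
  have hbB : c * (D : ℝ) ^ q ≤ B := by
    have h1 : (D : ℝ) ^ q ≤ (D : ℝ) ^ Q := by
      refine Real.rpow_le_rpow_of_exponent_le hD1 ?_
      have : 0 ≤ q * (2 * N) := by positivity
      rw [hQ]
      linarith
    have h2 : c ≤ C := by
      have : 0 ≤ (T : ℝ) * κ * (1 + c) ^ (2 * N + 2) := by positivity
      linarith
    rw [hBdef]
    gcongr
  have hmomB : D * (T * κ) * (1 + c * (D : ℝ) ^ q) ^ (2 * N + 2) ≤ B := by
    have h1 : 1 + c * (D : ℝ) ^ q ≤ (1 + c) * (D : ℝ) ^ q := by linarith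
    have h2 : (D : ℝ) * ((D : ℝ) ^ q) ^ (2 * N + 2) = (D : ℝ) ^ Q := by
      rw [← Real.rpow_natCast, ← Real.rpow_mul (by positivity), hQ,
        Real.rpow_add (by positivity), Real.rpow_one]
      push_cast
      rfl
    calc D * (T * κ) * (1 + c * (D : ℝ) ^ q) ^ (2 * N + 2)
        ≤ D * (T * κ) * ((1 + c) * (D : ℝ) ^ q) ^ (2 * N + 2) := by gcongr
      _ = T * κ * (1 + c) ^ (2 * N + 2) * ((D : ℝ) * ((D : ℝ) ^ q) ^ (2 * N + 2)) := by
          rw [mul_pow]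
          ring
      _ ≤ C * (D : ℝ) ^ Q := by
          rw [h2]
          gcongr
          linarith
  have hmom : ∀ m ≤ N, ∫⁻ x, (1 + ‖x‖ₑ) ^ 2
      ∂((P.withDensity (quadVar T N N₀ n W)).map (X (date T N m))) ≤ ENNReal.ofReal B :=
    fun m hm => (lintegral_map_quadVar_le hW h hp hb hN₀ hn hm).trans
      (ENNReal.ofReal_le_ofReal hmomB)
  obtain ⟨φ, h1, h2, h3, h4⟩ := exists_net_of_approximable hval.1 hB3 (hmom (n + 1) hn)
    (fun B' hB' => dpValue_approximable h hg hp1 hb hR (measurable_quadVar hW hN₀ hn)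
      (lintegral_quadVar_ne_top hW hN₀ hn) j (n + 1) hj' le_rfl B' (hB3.trans hB')
      (hbB.trans hB') fun m hm => (hmom m hm).trans (ENNReal.ofReal_le_ofReal hB')) hε
  have hconst : B ^ e * (ε ^ (2 * k + 5))⁻¹
      = C ^ e * (D : ℝ) ^ (Q * e) * ε ^ (-((2 * k + 5 : ℕ) : ℝ)) := by
    rw [Real.rpow_neg hε.le, Real.rpow_natCast, hBdef, mul_pow, Real.rpow_mul (by positivity),
      Real.rpow_natCast]
  rw [hconst] at h3 h4
  refine ⟨φ, h1, ?_, h3, h4⟩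
  have hρ : rhoTilde P T N N₀ n W X
      = (P.withDensity (quadVar T N N₀ n W)).map (X (date T N (n + 1))) := rfl
  rw [hρ, hV.eLpNorm_sub_eq hval (h.measurable_state hn)]
  exact h2
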